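/- **Setting.** Let $f\in L^2(\mathbb R)$ be real-valued, $\hat f(\omega)=\int f(x)e^{-i\omega x}\,dx$, and let $Bf(\omega_1,\omega_2)=\hat f(\omega_1)\overline{\hat f(\omega_2)}\hat f(\omega_2-\omega_1)$ be its bispectrum. Points of $\mathbb R^2$ are also written in polar coordinates $(r,\theta)$. In the noisy dilation MRA model one has $M\ge 1$ independent observations $$y_j(x)=f_j(x)+\varepsilon_j(x),\qquad f_j(x)=f\big((1-\tau_j)^{-1}(x-t_j)\big),\qquad 1\le j\le M,$$ with $\operatorname{supp} y_j\subset[-\tfrac12,\tfrac12]$, where the pairs $(t_j,\tau_j)$ are independent over $j$, the $t_j$ are identically distributed, each $\tau_j$ is uniformly distributed on an interval with mean $0$ and variance $\eta^2$, $0<\eta^2\le\frac1{12}$, and the $\varepsilon_j$ are independent Gaussian white noises on $[-\frac12,\frac12]$ with variance $\sigma^2$ ($\sigma\ge0$), independent of all $(t_j,\tau_j)$. **Estimator.** Put $h(\omega)=2\sigma^2\sin(\omega/2)/\omega$ for $\omega\neq 0$, $h(0)=\sigma^2$, $\tilde\mu(\omega)=\frac1M\sum_j\hat y_j(\omega)$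 and $$R_\sigma(\omega_1,\omega_2)=\tilde\mu(\omega_1)h(\omega_1)+\overline{\tilde\mu(\omega_2)}\,h(\omega_2)+\tilde\mu(\omega_2-\omega_1)h(\omega_2-\omega_1).$$ Let $\phi_L(\omega)=(2\pi L^2)^{-1}e^{-|\omega|^2/(2L^2)}$ on $\mathbb R^2$, $L>0$, let $(L_Cg)(\omega_1,\omega_2)=C^4g(C\omega_1,C\omega_2)$, and let $C_0=\frac{1-\sqrt3\eta}{1+\sqrt3\eta}$, $C_1=2\sqrt3\,\eta$, $C_2=\frac1{1+\sqrt3\eta}$. The estimator is $$\widetilde{Bf}=(I-L_{C_0})^{-1}C_1L_{C_2}\big[4\,(G*\phi_L)+r\,\partial_r(G*\phi_L)\big],\qquad G=\frac1M\sum_{j=1}^M By_j-R_\sigma,$$ where $(I-L_{C_0})^{-1}=\sum_{k\ge0}L_{C_0}^k$ and $By_j(\omega_1,\omega_2)=\hat y_j(\omega_1)\overline{\hat y_j(\omega_2)}\hat y_j(\omega_2-\omega_1)$. **Theorem 3.** Assume that $Bf\in C^3(\mathbb R^2)$; that for some $\kappa\ge3$ the Fourier transform of the function $r\,Bf(r,\theta)$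 on $\mathbb R^2$ (as a tempered distribution) is given outside some ball by a function bounded by a constant times $|x|^{-\kappa}$; and that the functions $r^k\max_{\alpha\in[r/2,2r]}|\partial_\alpha^kBf(\alpha,\theta)|$, $k=2,3$, belong to $L^2(\mathbb R^2)$. Let $\Omega\subset\mathbb R^2$ be bounded and measurable. Then there is a constant $C_{f,\Omega}$, depending only on $f$ and $\Omega$, such that for all $M\ge1$, $L>0$, $\sigma\ge0$ and $\eta>0$ with $\eta^2\le\frac1{12}$, in the model above, $$\mathbb E\Big[\|Bf-\widetilde{Bf}\|_{L^2(\Omega)}^2\Big]\le C_{f,\Omega}\left(\frac{\eta^2}{M}+L^4+\frac{\sigma^2\vee\sigma^6}{L^2M}\right).$$ -/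

import Mathlib

open MeasureTheory ProbabilityTheory
open scoped FourierTransform SchwartzMap ComplexConjugate

namespace DilationMRA

noncomputable section

/-! ## Frequency plane, Fourier transform, bispectrum -/

/-- The plane of frequency pairs `(ω₁, ω₂) = (ω 0, ω 1)`, with the Euclidean norm `r = ‖ω‖`. -/
abbrev Plane : Type := EuclideanSpace ℝ (Fin 2)

/-- The Fourier transform `∫ f(x) e^{-iωx} dx` of a real signal. -/
def fourierHat (f : ℝ → ℝ) (ω : ℝ) : ℂ :=
  ∫ x : ℝ, (f x : ℂ) * Complex.exp (-(Complex.I * (ω : ℂ) * (x : ℂ)))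

/-- `F(ω₁) F(ω₂)^* F(ω₂ - ω₁)`: the bispectrum of a signal, in terms of its Fourier transform
`F`. -/
def tripleProduct (F : ℝ → ℂ) (ω : Plane) : ℂ :=
  F (ω 0) * conj (F (ω 1)) * F (ω 1 - ω 0)

/-- The bispectrum `Bf(ω₁, ω₂)`. -/
def bispectrum (f : ℝ → ℝ) : Plane → ℂ :=
  tripleProduct (fourierHat f)

/-! ## Operators on functions of the frequency plane -/

/-- The dilation operator `(L_C G)(ω₁, ω₂) = C⁴ G(C ω₁, C ω₂)`. -/
def dilation (C : ℝ) (G : Plane → ℂ) (ω : Plane) : ℂ :=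
  ((C ^ 4 : ℝ) : ℂ) * G (C • ω)

/-- `(I - L_C)⁻¹`, as the Neumann series `∑ₖ L_C^k`. For `0 ≤ C < 1` it converges absolutely at
every point on functions that are bounded near the origin, and it inverts `I - L_C` there: see
`invIdSubDilation_sub_dilation` and `eq_invIdSubDilation`. -/
def invIdSubDilation (C : ℝ) (G : Plane → ℂ) (ω : Plane) : ℂ :=
  ∑' k : ℕ, (dilation C)^[k] G ω

/-- The operator `r ∂_r`. -/
def rDeriv (G : Plane → ℂ) (ω : Plane) : ℂ :=
  deriv (fun s : ℝ => G (s • ω)) 1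

/-- The radial Gaussian low pass filter of width `L` and total mass one on the plane. -/
def gaussianFilter (L : ℝ) (ω : Plane) : ℝ :=
  (2 * Real.pi * L ^ 2)⁻¹ * Real.exp (-(‖ω‖ ^ 2) / (2 * L ^ 2))

/-- The convolution `G ∗ φ_L` on the plane. -/
def smoothing (L : ℝ) (G : Plane → ℂ) (ω : Plane) : ℂ :=
  ∫ s : Plane, G (ω - s) * (gaussianFilter L s : ℂ)

/-- The constant `C₀ = (1 - √3 η) / (1 + √3 η)`. -/
def constC0 (η : ℝ) : ℝ := (1 - √3 * η) / (1 + √3 * η)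

/-- The constant `C₁ = 2 √3 η`. -/
def constC1 (η : ℝ) : ℝ := 2 * √3 * η

/-- The constant `C₂ = 1 / (1 + √3 η)`. -/
def constC2 (η : ℝ) : ℝ := 1 / (1 + √3 * η)

/-- The dilation unbiasing operator `(I - L_{C₀})⁻¹ C₁ L_{C₂} (4 G + r ∂_r G)`. -/
def dilationUnbias (η : ℝ) (G : Plane → ℂ) : Plane → ℂ :=
  invIdSubDilation (constC0 η) fun ω =>
    (constC1 η : ℂ) * dilation (constC2 η) (fun ζ => 4 * G ζ + rDeriv G ζ) ω

lemma dilation_iterate (C : ℝ) (G : Plane → ℂ) (k : ℕ) (ω : Plane) :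
    (dilation C)^[k] G ω = (((C ^ 4) ^ k : ℝ) : ℂ) * G (C ^ k • ω) := by
  induction k generalizing ω with
  | zero => simp
  | succ k ih =>
    rw [Function.iterate_succ_apply', dilation, ih, smul_smul, ← pow_succ]
    push_cast
    ring

lemma summable_dilation_iterate {C : ℝ} (hC0 : 0 ≤ C) (hC1 : C < 1) {G : Plane → ℂ} {K : ℝ}
    {ω : Plane} (hG : ∀ ζ : Plane, ‖ζ‖ ≤ ‖ω‖ → ‖G ζ‖ ≤ K) :
    Summable fun k : ℕ => (dilation C)^[k] G ω := by
  have h4 : C ^ 4 < 1 := pow_lt_one₀ hC0 hC1 (by norm_num)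
  refine Summable.of_norm_bounded
    ((summable_geometric_of_lt_one (by positivity) h4).mul_right K) fun k => ?_
  rw [dilation_iterate, norm_mul, Complex.norm_real, Real.norm_of_nonneg (by positivity)]
  refine mul_le_mul_of_nonneg_left (hG _ ?_) (by positivity)
  rw [norm_smul, Real.norm_of_nonneg (by positivity)]
  exact mul_le_of_le_one_left (norm_nonneg _) (pow_le_one₀ hC0 hC1.le)

/-- `u = (I - L_C)⁻¹ G` satisfies `u - L_C u = G`. -/
theorem invIdSubDilation_sub_dilation {C : ℝ} (hC0 : 0 ≤ C) (hC1 : C < 1) {G : Plane → ℂ} {K : ℝ}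
    {ω : Plane} (hG : ∀ ζ : Plane, ‖ζ‖ ≤ ‖ω‖ → ‖G ζ‖ ≤ K) :
    invIdSubDilation C G ω - dilation C (invIdSubDilation C G) ω = G ω := by
  have h := (summable_dilation_iterate hC0 hC1 hG).tsum_eq_zero_add
  have h2 : dilation C (invIdSubDilation C G) ω = ∑' k : ℕ, (dilation C)^[k + 1] G ω := by
    simp only [Function.iterate_succ_apply']
    simp only [dilation, invIdSubDilation, tsum_mul_left]
  rw [h2, invIdSubDilation, h]
  simp

/-- `(I - L_C)⁻¹ G` is the only solution of `u - L_C u = G` that is bounded on the ball. -/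
theorem eq_invIdSubDilation {C : ℝ} (hC0 : 0 ≤ C) (hC1 : C < 1) {G u : Plane → ℂ} {K : ℝ}
    {ω : Plane} (hu : ∀ ζ : Plane, ‖ζ‖ ≤ ‖ω‖ → ‖u ζ‖ ≤ K)
    (hG : ∀ ζ : Plane, ‖ζ‖ ≤ ‖ω‖ → u ζ - dilation C u ζ = G ζ) :
    u ω = invIdSubDilation C G ω := by
  have h4 : C ^ 4 < 1 := pow_lt_one₀ hC0 hC1 (by norm_num)
  have hball : ∀ k : ℕ, ‖C ^ k • ω‖ ≤ ‖ω‖ := fun k => by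
    rw [norm_smul, Real.norm_of_nonneg (by positivity)]
    exact mul_le_of_le_one_left (norm_nonneg _) (pow_le_one₀ hC0 hC1.le)
  have hterm : ∀ k : ℕ, (dilation C)^[k] G ω
      = (dilation C)^[k] u ω - (dilation C)^[k + 1] u ω := fun k => by
    rw [dilation_iterate, dilation_iterate, dilation_iterate, ← hG _ (hball k), dilation,
      smul_smul, ← pow_succ']
    push_cast
    ring
  have hs := (summable_dilation_iterate hC0 hC1 hu).tsum_eq_zero_add
  have hsum := summable_dilation_iterate hC0 hC1 hu
  rw [invIdSubDilation]
  simp_rw [hterm]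
  rw [hsum.tsum_sub ((summable_nat_add_iff 1).2 hsum), hs]
  simp

/-! ## Regularity conditions on the bispectrum -/

/-- `r^k max_{α ∈ [r/2, 2r]} |∂_α^k G(α, θ)|` at the point with polar coordinates `(r, θ)`. -/
def radialMaximal (k : ℕ) (G : Plane → ℂ) (ω : Plane) : ℝ :=
  ‖ω‖ ^ k * sSup ((fun α : ℝ => ‖iteratedDeriv k (fun a : ℝ => G (a • (‖ω‖⁻¹ • ω))) α‖) ''
    Set.Icc (‖ω‖ / 2) (2 * ‖ω‖))

/-- The Fourier transform of `q` decays like `|x|^{-κ}`. The function `q` need not be integrable,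
so its Fourier transform is taken in the sense of tempered distributions: outside some ball it is
a function `Q` with `|Q(x)| ≤ C |x|^{-κ}`. (Rescaling the Fourier variable does not affect the
condition.) -/
def FourierDecay (q : Plane → ℂ) (κ : ℝ) : Prop :=
  ∃ (Q : Plane → ℂ) (C R : ℝ), Measurable Q ∧ 0 < R ∧
    (∀ x : Plane, R < ‖x‖ → ‖Q x‖ ≤ C * ‖x‖ ^ (-κ)) ∧
    ∀ φ : 𝓢(Plane, ℂ), tsupport φ ⊆ {x : Plane | R < ‖x‖} →
      ∫ ω : Plane, q ω * (𝓕 φ : 𝓢(Plane, ℂ)) ω = ∫ x : Plane, Q x * φ x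

/-! ## White noise and the observation model -/

/-- The observation window `[-1/2, 1/2]`. -/
def window : Set ℝ := Set.Icc (-(1 / 2)) (1 / 2)

/-- The Hilbert space `L²([-1/2, 1/2])` of test functions. -/
abbrev L2Window : Type := Lp ℝ 2 (volume.restrict window)

lemma memLp_window_of_bounded {g : ℝ → ℝ} (hg : Continuous g) (hb : ∀ x, |g x| ≤ 1) :
    MemLp g 2 (volume.restrict window) := by
  have : IsFiniteMeasure (volume.restrict window) :=
    ⟨by simp [window, Real.volume_Icc]⟩
  exact MemLp.of_bound hg.aestronglyMeasurable 1 (Filter.Eventually.of_forall hb)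

/-- The test function `x ↦ cos(ωx)`. -/
def cosTest (ω : ℝ) : L2Window :=
  (memLp_window_of_bounded (g := fun x : ℝ => Real.cos (ω * x)) (by fun_prop)
    fun x => Real.abs_cos_le_one _).toLp _

/-- The test function `x ↦ sin(ωx)`. -/
def sinTest (ω : ℝ) : L2Window :=
  (memLp_window_of_bounded (g := fun x : ℝ => Real.sin (ω * x)) (by fun_prop)
    fun x => Real.abs_sin_le_one _).toLp _

/-- `W` is (Gaussian) white noise with variance `σ²` on `[-1/2, 1/2]`: `W φ = ∫ φ(x) ε(x) dx` is a
centred Gaussian process indexed by `φ ∈ L²([-1/2, 1/2])`, and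
`E[W φ W ψ] = σ² ∫ φ ψ`. -/
structure IsWhiteNoise {S : Type*} [MeasurableSpace S] (P : Measure S) (σ : ℝ)
    (W : L2Window → S → ℝ) : Prop where
  measurable : ∀ φ, Measurable (W φ)
  gaussian : IsGaussianProcess W P
  mean : ∀ φ, ∫ s, W φ s ∂P = 0
  cov : ∀ φ ψ, ∫ s, W φ s * W ψ s ∂P = σ ^ 2 * inner ℝ φ ψ

/-- `E` is the Fourier transform `ω ↦ ∫ e^{-iωx} ε(x) dx = W(cos(ω·)) - i W(sin(ω·))` of the white
noise `W`, in a version that is jointly measurable in the frequency and the sample point. -/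
structure IsNoiseFourier {S : Type*} [MeasurableSpace S] (P : Measure S)
    (W : L2Window → S → ℝ) (E : ℝ → S → ℂ) : Prop where
  measurable : Measurable (Function.uncurry E)
  version : ∀ ω : ℝ, ∀ᵐ s ∂P, E ω s = (W (cosTest ω) s : ℂ) - Complex.I * (W (sinTest ω) s : ℂ)

/-- The clean translated and dilated signal `f_j(x) = f((1 - τ_j)⁻¹ (x - t_j))`. -/
def dilatedSignal (f : ℝ → ℝ) (t τ : ℝ) (x : ℝ) : ℝ :=
  f ((1 - τ)⁻¹ * (x - t))

/-- The noisy dilation model: `M` observations `y_j = f_j + ε_j`, where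
`f_j(x) = f((1 - τ_j)⁻¹ (x - t_j))`, with translations `t_j`, dilations `τ_j` and white noises
`ε_j` (tested against functions through `W j`, with Fourier transform `E j`). No independence of
`t_j` from `τ_j` for the same `j` is required. -/
structure NoisyDilationModel {S : Type*} [MeasurableSpace S] (P : Measure S) (f : ℝ → ℝ)
    (η σ : ℝ) (M : ℕ) (t τ : Fin M → S → ℝ) (W : Fin M → L2Window → S → ℝ)
    (E : Fin M → ℝ → S → ℂ) : Prop where
  measurable_t : ∀ j, Measurable (t j)
  measurable_τ : ∀ j, Measurable (τ j)
  /-- the observations are supported in the window -/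
  support : ∀ᵐ s ∂P, ∀ j, ∀ᵐ x : ℝ, x ∉ window → dilatedSignal f (t j s) (τ j s) x = 0
  /-- different observations use independent translations and dilations -/
  indep_transform : iIndepFun (fun j s => (t j s, τ j s)) P
  identDistrib_t : ∀ i j, IdentDistrib (t i) (t j) P P
  /-- the dilations are uniform on an interval, with mean `0` and variance `η²` -/
  uniform_τ : ∀ j, ∃ a b : ℝ, a < b ∧ pdf.IsUniform (τ j) (Set.Icc a b) P volume
  mean_τ : ∀ j, ∫ s, τ j s ∂P = 0
  var_τ : ∀ j, variance (τ j) P = η ^ 2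
  whiteNoise : ∀ j, IsWhiteNoise P σ (W j)
  noiseFourier : ∀ j, IsNoiseFourier P (W j) (E j)
  /-- the noises of different observations are independent -/
  indep_noise : iIndepFun (fun j s φ => W j φ s) P
  /-- the noises are independent of the translations and dilations -/
  indep_transform_noise : IndepFun (fun s j => (t j s, τ j s)) (fun s j φ => W j φ s) P

/-! ## The estimator -/

/-- The Fourier transform `ŷ = f̂_j + ε̂_j` of an observation. -/
def obsFourier (f : ℝ → ℝ) (t τ : ℝ) (E : ℝ → ℂ) (ω : ℝ) : ℂ :=
  fourierHat (dilatedSignal f t τ) ω + E ω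

/-- `h(ω) = 2σ² sin(ω/2)/ω`, with `h(0) = σ²`. -/
def noiseKernel (σ ω : ℝ) : ℝ :=
  if ω = 0 then σ ^ 2 else 2 * σ ^ 2 * (Real.sin (ω / 2) / ω)

/-- The empirical mean `μ̃(ω) = (1/M) ∑ ŷ_j(ω)` of the Fourier transforms of the observations. -/
def empiricalMean {M : ℕ} (Y : Fin M → ℝ → ℂ) (ω : ℝ) : ℂ :=
  (M : ℂ)⁻¹ * ∑ j, Y j ω

/-- The additive noise centering term
`R_σ(ω₁, ω₂) = μ̃(ω₁) h(ω₁) + μ̃(ω₂)^* h(ω₂) + μ̃(ω₂ - ω₁) h(ω₂ - ω₁)`. -/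
def noiseCentering {M : ℕ} (σ : ℝ) (Y : Fin M → ℝ → ℂ) (ω : Plane) : ℂ :=
  empiricalMean Y (ω 0) * (noiseKernel σ (ω 0) : ℂ)
    + conj (empiricalMean Y (ω 1)) * (noiseKernel σ (ω 1) : ℂ)
    + empiricalMean Y (ω 1 - ω 0) * (noiseKernel σ (ω 1 - ω 0) : ℂ)

/-- The centred empirical bispectrum `(1/M) ∑ By_j - R_σ`. -/
def centeredBispectrum {M : ℕ} (σ : ℝ) (Y : Fin M → ℝ → ℂ) (ω : Plane) : ℂ :=
  (M : ℂ)⁻¹ * ∑ j, tripleProduct (Y j) ω - noiseCentering σ Y ω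

/-- The bispectrum estimator computed from the Fourier transforms `Y j` of the observations:
centering, Gaussian smoothing of width `L`, then dilation unbiasing. -/
def bispectrumEstimator {M : ℕ} (η σ L : ℝ) (Y : Fin M → ℝ → ℂ) : Plane → ℂ :=
  dilationUnbias η (smoothing L (centeredBispectrum σ Y))

/-- The squared `L²(D)` distance of two functions on the plane. -/
def sqErrorOn (D : Set Plane) (G H : Plane → ℂ) : ENNReal :=
  ∫⁻ ω in D, ‖G ω - H ω‖ₑ ^ 2

end

end DilationMRA

/-!
# Risk of the bispectrum estimator in the noisy dilation model

**Bounded support.** The clean observations `f((1 - τ)⁻¹ (x - t))` live in the window, and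
`|τ| ≤ 1/2` almost surely, so as soon as the model is satisfied by one observation the signal `f`
has bounded support (`exists_support_bound`). Then `f̂` is smooth, bounded and square-integrable
(`boundedC3_fourierHat`, `memLp_fourierHat`), and `B = Bf` is bounded with its derivatives up to
order three. The constants of the theorem are built from these bounds and from the size of `D`.

**Unbiasing.** A clean observation has bispectrum `s³ B(s ·)` with `s = 1 - τ`, and
`(4 + r∂_r)[s³ B(s ·)](ζ) = ∂_s (s⁴ B(sζ))`, called `dilationProfile B ζ s`. As `s` is uniform on
`[1 - √3η, 1 + √3η]`, its mean is `C₁⁻¹ (I - L_{C₀}) L_{C₂}⁻¹ B`, called `meanProfile`, and the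
Neumann series recovers `B` from it exactly (`tsum_meanProfile`). The weights of the series have
total mass at most `2` uniformly in `η`, since `C₁` compensates `(1 - C₀⁴)⁻¹`
(`tsum_weights_le`). Hence the mean squared error of the estimator is bounded by that of
`(4 + r∂_r)(G ∗ φ_L)` as an estimator of `meanProfile`, uniformly on a ball
(`lintegral_sqErrorOn_le`).

**Three errors.** The latter splits into three parts (`lintegral_profileError_le`).
* The fluctuation of the average of `M` independent variables `dilationProfile B ζ (1 - τ_j)`: the
  profile is Lipschitz in `s`, so the variance is `O(η² / M)`.
* The smoothing bias: `φ_L` is even, so it is `O(L²)` (`exists_smoothing_bias`), and contributes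
  `O(L⁴)`.
* The noise. The centring term `R_σ` turns all products of noise factors into Wick products
  (`tripleProduct_add_sub`), which are centred, and whose covariances are permanents of the
  covariance `h` of the noise (`expect_wick₃_mul_wick₃`). Noise terms of different observations are
  uncorrelated, which gives the factor `1 / M`. Smoothing followed by `4 + r∂_r` is integration
  against `testKernel L ζ`, whose `L¹` norm is `O(1 + 1/L)` and whose sup norm is
  `O((1 + 1/L) / L²)`. For `L ≤ 1` the bounded covariances suffice, as `‖ψ‖₁² = O(1 / L²)`. For
  `L ≥ 1` one uses `‖ψ‖₁ ‖ψ‖_∞ = O(1 / L²)` and the integrability of the covariances over the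
  plane, or of the square-integrable signal factors in front of them
  (`lintegral_covWeight_le`, `exists_testKernel_covWeight_bound`).
-/

namespace DilationMRA

/-! ### Wick calculus in an algebra with an expectation -/

section WickAlgebra

variable {A : Type*} [CommRing A] [Algebra ℂ A] (e : A →ₗ[ℂ] ℂ)

/-- `X` behaves under the linear functional `e` like a centred Gaussian variable, as far as the
moments of order `1, 3, 4, 6` are concerned; the variance `e (X ^ 2)` may be any complex
number. -/
structure HasGaussianMoments (X : A) : Prop where
  one : e X = 0
  three : e (X ^ 3) = 0
  four : e (X ^ 4) = 3 * e (X ^ 2) ^ 2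
  six : e (X ^ 6) = 15 * e (X ^ 2) ^ 3

/-- The moment `e ((X + z Y) ^ n)` as a polynomial in `z`. -/
noncomputable def momentPoly (X Y : A) (n : ℕ) : Polynomial ℂ :=
  ∑ k ∈ Finset.range (n + 1), Polynomial.monomial k (e (X ^ (n - k) * Y ^ k) * (n.choose k : ℂ))

lemma eval_momentPoly (X Y : A) (n : ℕ) (z : ℂ) :
    (momentPoly e X Y n).eval z = e ((X + z • Y) ^ n) := by
  rw [momentPoly, Polynomial.eval_finsetSum, add_comm X, add_pow, map_sum]
  refine Finset.sum_congr rfl fun k _ => ?_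
  have h : (z • Y) ^ k * X ^ (n - k) * (n.choose k : A)
      = (z ^ k * (n.choose k : ℂ)) • (X ^ (n - k) * Y ^ k) := by
    rw [smul_pow, mul_smul, Nat.cast_smul_eq_nsmul, nsmul_eq_mul, smul_mul_assoc, smul_mul_assoc]
    congr 1
    ring
  rw [h, map_smul, Polynomial.eval_monomial, smul_eq_mul]
  ring

/-- Both sides of a Gaussian moment identity for `X + z Y` are polynomials in `z`, so the identity
extends from real to complex `z`. -/
lemma hasGaussianMoments_add_smul {X Y : A}
    (h : ∀ t : ℝ, HasGaussianMoments e (X + (t : ℂ) • Y)) (z : ℂ) :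
    HasGaussianMoments e (X + z • Y) := by
  have key : ∀ p q : Polynomial ℂ, (∀ t : ℝ, p.eval (t : ℂ) = q.eval (t : ℂ)) → p = q := by
    intro p q hpq
    refine Polynomial.eq_of_infinite_eval_eq p q
      (Set.Infinite.mono ?_ (Set.infinite_range_of_injective Complex.ofReal_injective))
    rintro _ ⟨t, rfl⟩
    exact hpq t
  have h1 := key (momentPoly e X Y 1) 0 fun t => by
    rw [eval_momentPoly, pow_one, (h t).one, Polynomial.eval_zero]
  have h3 := key (momentPoly e X Y 3) 0 fun t => by
    rw [eval_momentPoly, (h t).three, Polynomial.eval_zero]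
  have h4 := key (momentPoly e X Y 4) (Polynomial.C 3 * momentPoly e X Y 2 ^ 2) fun t => by
    simp only [Polynomial.eval_mul, Polynomial.eval_C, Polynomial.eval_pow, eval_momentPoly,
      (h t).four]
  have h6 := key (momentPoly e X Y 6) (Polynomial.C 15 * momentPoly e X Y 2 ^ 3) fun t => by
    simp only [Polynomial.eval_mul, Polynomial.eval_C, Polynomial.eval_pow, eval_momentPoly,
      (h t).six]
  refine ⟨?_, ?_, ?_, ?_⟩
  · rw [← pow_one (X + z • Y), ← eval_momentPoly, h1, Polynomial.eval_zero]
  · rw [← eval_momentPoly, h3, Polynomial.eval_zero]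
  · rw [← eval_momentPoly, h4]; simp [eval_momentPoly]
  · rw [← eval_momentPoly, h6]; simp [eval_momentPoly]

/-- The second Wick product `:XY: = XY - e(XY)`. -/
noncomputable def wick₂ (X Y : A) : A := X * Y - e (X * Y) • 1

/-- The third Wick product `:XYZ: = XYZ - e(XY) Z - e(XZ) Y - e(YZ) X`. -/
noncomputable def wick₃ (X Y Z : A) : A :=
  X * Y * Z - e (X * Y) • Z - e (X * Z) • Y - e (Y * Z) • X

variable {e} {G : Submodule ℂ A} (hG : ∀ X ∈ G, HasGaussianMoments e X)
include hG

/-- Comparison of the coefficients of `t ^ 2` in the fourth moment of `X + t Y`. -/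
lemma moment_two_two {X Y : A} (hX : X ∈ G) (hY : Y ∈ G) :
    e (X ^ 2 * Y ^ 2) = e (X ^ 2) * e (Y ^ 2) + 2 * e (X * Y) ^ 2 := by
  have key : ∀ t : ℂ, e (X ^ 4) + 4 * t * e (X ^ 3 * Y) + 6 * t ^ 2 * e (X ^ 2 * Y ^ 2)
      + 4 * t ^ 3 * e (X * Y ^ 3) + t ^ 4 * e (Y ^ 4)
      = 3 * (e (X ^ 2) + 2 * t * e (X * Y) + t ^ 2 * e (Y ^ 2)) ^ 2 := fun t => by
    have h := (hG _ (G.add_mem hX (G.smul_mem t hY))).four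
    have e4 : (X + t • Y) ^ 4 = X ^ 4 + (4 * t) • (X ^ 3 * Y) + (6 * t ^ 2) • (X ^ 2 * Y ^ 2)
        + (4 * t ^ 3) • (X * Y ^ 3) + (t ^ 4) • Y ^ 4 := by
      simp only [Algebra.smul_def, map_mul, map_pow, map_ofNat]; ring
    have e2 : (X + t • Y) ^ 2 = X ^ 2 + (2 * t) • (X * Y) + (t ^ 2) • Y ^ 2 := by
      simp only [Algebra.smul_def, map_mul, map_pow, map_ofNat]; ring
    rw [e4, e2] at h
    simpa only [map_add, map_smul, smul_eq_mul] using h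
  have k0 := (hG _ hX).four
  have k1 := (hG _ hY).four
  linear_combination (1 / 12) * (key 1 + key (-1)) - (1 / 6) * (k0 + k1)

lemma moment_three_one {X Y : A} (hX : X ∈ G) (hY : Y ∈ G) :
    e (X ^ 3 * Y) = 3 * e (X ^ 2) * e (X * Y) := by
  have key : ∀ t : ℂ, e (X ^ 4) + 4 * t * e (X ^ 3 * Y) + 6 * t ^ 2 * e (X ^ 2 * Y ^ 2)
      + 4 * t ^ 3 * e (X * Y ^ 3) + t ^ 4 * e (Y ^ 4)
      = 3 * (e (X ^ 2) + 2 * t * e (X * Y) + t ^ 2 * e (Y ^ 2)) ^ 2 := fun t => by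
    have h := (hG _ (G.add_mem hX (G.smul_mem t hY))).four
    have e4 : (X + t • Y) ^ 4 = X ^ 4 + (4 * t) • (X ^ 3 * Y) + (6 * t ^ 2) • (X ^ 2 * Y ^ 2)
        + (4 * t ^ 3) • (X * Y ^ 3) + (t ^ 4) • Y ^ 4 := by
      simp only [Algebra.smul_def, map_mul, map_pow, map_ofNat]; ring
    have e2 : (X + t • Y) ^ 2 = X ^ 2 + (2 * t) • (X * Y) + (t ^ 2) • Y ^ 2 := by
      simp only [Algebra.smul_def, map_mul, map_pow, map_ofNat]; ring
    rw [e4, e2] at h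
    simpa only [map_add, map_smul, smul_eq_mul] using h
  linear_combination (1 / 6) * (key 1 - key (-1)) - (1 / 48) * (key 2 - key (-2))

lemma moment_three_three {X Y : A} (hX : X ∈ G) (hY : Y ∈ G) :
    e (X ^ 3 * Y ^ 3) = 9 * e (X ^ 2) * e (Y ^ 2) * e (X * Y) + 6 * e (X * Y) ^ 3 := by
  have key : ∀ t : ℂ, e (X ^ 6) + 6 * t * e (X ^ 5 * Y) + 15 * t ^ 2 * e (X ^ 4 * Y ^ 2)
      + 20 * t ^ 3 * e (X ^ 3 * Y ^ 3) + 15 * t ^ 4 * e (X ^ 2 * Y ^ 4)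
      + 6 * t ^ 5 * e (X * Y ^ 5) + t ^ 6 * e (Y ^ 6)
      = 15 * (e (X ^ 2) + 2 * t * e (X * Y) + t ^ 2 * e (Y ^ 2)) ^ 3 := fun t => by
    have h := (hG _ (G.add_mem hX (G.smul_mem t hY))).six
    have e6 : (X + t • Y) ^ 6 = X ^ 6 + (6 * t) • (X ^ 5 * Y) + (15 * t ^ 2) • (X ^ 4 * Y ^ 2)
        + (20 * t ^ 3) • (X ^ 3 * Y ^ 3) + (15 * t ^ 4) • (X ^ 2 * Y ^ 4)
        + (6 * t ^ 5) • (X * Y ^ 5) + (t ^ 6) • Y ^ 6 := by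
      simp only [Algebra.smul_def, map_mul, map_pow, map_ofNat]; ring
    have e2 : (X + t • Y) ^ 2 = X ^ 2 + (2 * t) • (X * Y) + (t ^ 2) • Y ^ 2 := by
      simp only [Algebra.smul_def, map_mul, map_pow, map_ofNat]; ring
    rw [e6, e2] at h
    simpa only [map_add, map_smul, smul_eq_mul] using h
  -- this combination isolates the coefficient of `t ^ 3` in an odd polynomial of degree `5`
  linear_combination (1 / 40) * (-(13 / 24) * (key 1 - key (-1)) + (1 / 3) * (key 2 - key (-2))
    - (1 / 24) * (key 3 - key (-3)))

lemma moment_one_one_one {X Y Z : A} (hX : X ∈ G) (hY : Y ∈ G) (hZ : Z ∈ G) :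
    e (X * Y * Z) = 0 := by
  have h1 := (hG _ (G.add_mem (G.add_mem hX hY) hZ)).three
  have h2 := (hG _ (G.sub_mem (G.add_mem hX hY) hZ)).three
  have h3 := (hG _ (G.add_mem (G.sub_mem hX hY) hZ)).three
  have h4 := (hG _ (G.sub_mem (G.sub_mem hX hY) hZ)).three
  have h : (24 : ℂ) • (X * Y * Z)
      = (X + Y + Z) ^ 3 - (X + Y - Z) ^ 3 - (X - Y + Z) ^ 3 + (X - Y - Z) ^ 3 := by
    simp only [Algebra.smul_def, map_ofNat]; ring
  have h' := congrArg e h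
  simp only [map_smul, map_add, map_sub, smul_eq_mul] at h'
  linear_combination (1 / 24) * (h' + h1 - h2 - h3 + h4)

/-- Isserlis' formula for four factors, by polarization of `moment_two_two`. -/
lemma moment_four {X Y U V : A} (hX : X ∈ G) (hY : Y ∈ G) (hU : U ∈ G) (hV : V ∈ G) :
    e (X * Y * (U * V)) = e (X * Y) * e (U * V) + e (X * U) * e (Y * V)
      + e (X * V) * e (Y * U) := by
  have step : ∀ W ∈ G, e (X * Y * W ^ 2) = e (X * Y) * e (W ^ 2) + 2 * e (X * W) * e (Y * W) := by
    intro W hW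
    have h1 := moment_two_two hG (G.add_mem hX hY) hW
    have h2 := moment_two_two hG (G.sub_mem hX hY) hW
    have h : (4 : ℂ) • (X * Y * W ^ 2) = (X + Y) ^ 2 * W ^ 2 - (X - Y) ^ 2 * W ^ 2 := by
      simp only [Algebra.smul_def, map_ofNat]; ring
    have h' := congrArg e h
    have e1 : (X + Y) ^ 2 = X ^ 2 + (2 : ℂ) • (X * Y) + Y ^ 2 := by
      simp only [Algebra.smul_def, map_ofNat]; ring
    have e2 : (X - Y) ^ 2 = X ^ 2 - (2 : ℂ) • (X * Y) + Y ^ 2 := by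
      simp only [Algebra.smul_def, map_ofNat]; ring
    rw [map_smul, map_sub, h1, h2, e1, e2] at h'
    simp only [map_smul, map_add, map_sub, smul_eq_mul, add_mul, sub_mul] at h'
    linear_combination (1 / 4) * h'
  have h1 := step _ (G.add_mem hU hV)
  have h2 := step _ (G.sub_mem hU hV)
  have h : (4 : ℂ) • (X * Y * (U * V)) = X * Y * (U + V) ^ 2 - X * Y * (U - V) ^ 2 := by
    simp only [Algebra.smul_def, map_ofNat]; ring
  have h' := congrArg e h
  have e1 : (U + V) ^ 2 = U ^ 2 + (2 : ℂ) • (U * V) + V ^ 2 := by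
    simp only [Algebra.smul_def, map_ofNat]; ring
  have e2 : (U - V) ^ 2 = U ^ 2 - (2 : ℂ) • (U * V) + V ^ 2 := by
    simp only [Algebra.smul_def, map_ofNat]; ring
  rw [map_smul, map_sub, h1, h2, e1, e2] at h'
  simp only [map_smul, map_add, map_sub, smul_eq_mul, mul_add, mul_sub] at h'
  linear_combination (1 / 4) * h'

lemma expect_wick₃ {X Y Z : A} (hX : X ∈ G) (hY : Y ∈ G) (hZ : Z ∈ G) :
    e (wick₃ e X Y Z) = 0 := by
  simp [wick₃, moment_one_one_one hG hX hY hZ, (hG _ hX).one, (hG _ hY).one, (hG _ hZ).one]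

omit hG in
lemma expect_wick₂ (h1 : e 1 = 1) (X Y : A) : e (wick₂ e X Y) = 0 := by
  simp [wick₂, h1]

lemma expect_wick₂_mul_wick₂ (h1 : e 1 = 1) {X Y U V : A} (hX : X ∈ G) (hY : Y ∈ G) (hU : U ∈ G)
    (hV : V ∈ G) :
    e (wick₂ e X Y * wick₂ e U V) = e (X * U) * e (Y * V) + e (X * V) * e (Y * U) := by
  have h : wick₂ e X Y * wick₂ e U V = X * Y * (U * V) - e (U * V) • (X * Y)
      - e (X * Y) • (U * V) + (e (X * Y) * e (U * V)) • 1 := by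
    simp only [wick₂, Algebra.smul_def, map_mul]; ring
  rw [h]
  simp only [map_add, map_sub, map_smul, smul_eq_mul, h1, moment_four hG hX hY hU hV]
  ring

lemma expect_hermite₃_mul_hermite₃ {X Y : A} (hX : X ∈ G) (hY : Y ∈ G) :
    e (wick₃ e X X X * wick₃ e Y Y Y) = 6 * e (X * Y) ^ 3 := by
  have h : wick₃ e X X X * wick₃ e Y Y Y = X ^ 3 * Y ^ 3 - (3 * e (Y ^ 2)) • (X ^ 3 * Y)
      - (3 * e (X ^ 2)) • (Y ^ 3 * X) + (9 * (e (X ^ 2) * e (Y ^ 2))) • (X * Y) := by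
    simp only [wick₃, Algebra.smul_def, map_mul, map_ofNat, ← pow_two]; ring
  rw [h]
  simp only [map_add, map_sub, map_smul, smul_eq_mul, moment_three_three hG hX hY,
    moment_three_one hG hX hY, moment_three_one hG hY hX, mul_comm Y X]
  ring

omit hG in
/-- Polarization of the third Wick product. -/
lemma wick₃_polarization (X Y Z : A) :
    (24 : ℂ) • wick₃ e X Y Z
      = wick₃ e (X + Y + Z) (X + Y + Z) (X + Y + Z) - wick₃ e (X + Y - Z) (X + Y - Z) (X + Y - Z)
        - wick₃ e (X - Y + Z) (X - Y + Z) (X - Y + Z)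
        + wick₃ e (X - Y - Z) (X - Y - Z) (X - Y - Z) := by
  simp only [wick₃, add_mul, mul_add, sub_mul, mul_sub, map_add, map_sub, mul_comm Y X,
    mul_comm Z X, mul_comm Z Y]
  simp only [Algebra.smul_def, map_add, map_sub, map_ofNat]
  ring

/-- The covariance of two third Wick products is the permanent of the covariance matrix. -/
lemma expect_wick₃_mul_wick₃ {X Y Z U V W : A} (hX : X ∈ G) (hY : Y ∈ G) (hZ : Z ∈ G)
    (hU : U ∈ G) (hV : V ∈ G) (hW : W ∈ G) :
    e (wick₃ e X Y Z * wick₃ e U V W)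
      = e (X * U) * e (Y * V) * e (Z * W) + e (X * U) * e (Y * W) * e (Z * V)
        + e (X * V) * e (Y * U) * e (Z * W) + e (X * V) * e (Y * W) * e (Z * U)
        + e (X * W) * e (Y * U) * e (Z * V) + e (X * W) * e (Y * V) * e (Z * U) := by
  have step : ∀ T ∈ G, e (wick₃ e X Y Z * wick₃ e T T T)
      = 6 * (e (X * T) * e (Y * T) * e (Z * T)) := by
    intro T hT
    have h := congrArg (fun a => e (a * wick₃ e T T T)) (wick₃_polarization (e := e) X Y Z)
    simp only [smul_mul_assoc, add_mul, sub_mul, map_add, map_sub, map_smul, smul_eq_mul] at h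
    rw [expect_hermite₃_mul_hermite₃ hG (G.add_mem (G.add_mem hX hY) hZ) hT,
      expect_hermite₃_mul_hermite₃ hG (G.sub_mem (G.add_mem hX hY) hZ) hT,
      expect_hermite₃_mul_hermite₃ hG (G.add_mem (G.sub_mem hX hY) hZ) hT,
      expect_hermite₃_mul_hermite₃ hG (G.sub_mem (G.sub_mem hX hY) hZ) hT] at h
    simp only [add_mul, sub_mul, map_add, map_sub] at h
    linear_combination (1 / 24) * h
  have h := congrArg (fun a => e (wick₃ e X Y Z * a)) (wick₃_polarization (e := e) U V W)
  simp only [mul_smul_comm, mul_add, mul_sub, map_add, map_sub, map_smul, smul_eq_mul] at h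
  rw [step _ (G.add_mem (G.add_mem hU hV) hW), step _ (G.sub_mem (G.add_mem hU hV) hW),
    step _ (G.add_mem (G.sub_mem hU hV) hW), step _ (G.sub_mem (G.sub_mem hU hV) hW)] at h
  simp only [mul_add, mul_sub, map_add, map_sub] at h
  linear_combination (1 / 24) * h

end WickAlgebra

/-! ### Random variables with all moments and Gaussian processes -/

section GaussianMoments

open scoped NNReal ENNReal

lemma deriv_poly_mul_exp {p q : ℝ → ℝ} (v : ℝ) (hp : ∀ t, HasDerivAt p (q t) t) :
    deriv (fun t => p t * Real.exp (v * t ^ 2 / 2))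
      = fun t => (q t + v * t * p t) * Real.exp (v * t ^ 2 / 2) := by
  ext t
  have h : HasDerivAt (fun t : ℝ => v * t ^ 2 / 2) (v * t) t := by
    have := ((hasDerivAt_pow 2 t).const_mul v).div_const 2
    exact this.congr_deriv (by push_cast; ring)
  exact (((hp t).mul h.exp).congr_deriv (by ring)).deriv

/-- Moments of the centred Gaussian law, from the derivatives of `exp (v t² / 2)` at `0`. -/
lemma gaussianReal_moments (v : ℝ≥0) :
    ∫ x, x ^ 2 ∂(gaussianReal 0 v) = v ∧ ∫ x, x ^ 3 ∂(gaussianReal 0 v) = 0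
      ∧ ∫ x, x ^ 4 ∂(gaussianReal 0 v) = 3 * (v : ℝ) ^ 2
      ∧ ∫ x, x ^ 6 ∂(gaussianReal 0 v) = 15 * (v : ℝ) ^ 3 := by
  have key : ∀ n : ℕ, ∫ x, x ^ n ∂(gaussianReal 0 v)
      = iteratedDeriv n (fun t : ℝ => Real.exp ((v : ℝ) * t ^ 2 / 2)) 0 := fun n => by
    have h := iteratedDeriv_mgf_zero (X := id) (μ := gaussianReal 0 v) (by simp) n
    rw [mgf_id_gaussianReal] at h
    simp only [zero_mul, zero_add] at h
    rw [h]
    rfl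
  have d1 : iteratedDeriv 1 (fun t : ℝ => Real.exp ((v : ℝ) * t ^ 2 / 2))
      = fun t => ((v : ℝ) * t) * Real.exp (v * t ^ 2 / 2) := by
    rw [iteratedDeriv_one]
    have := deriv_poly_mul_exp (p := fun _ => 1) (q := fun _ => 0) v (fun t => hasDerivAt_const t 1)
    simpa using this
  have d2 : iteratedDeriv 2 (fun t : ℝ => Real.exp ((v : ℝ) * t ^ 2 / 2))
      = fun t => ((v : ℝ) + v ^ 2 * t ^ 2) * Real.exp (v * t ^ 2 / 2) := by
    rw [iteratedDeriv_succ, d1, deriv_poly_mul_exp (q := fun _ => (v : ℝ)) v]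
    · ext t; ring
    · intro t; simpa using (hasDerivAt_id t).const_mul (v : ℝ)
  have d3 : iteratedDeriv 3 (fun t : ℝ => Real.exp ((v : ℝ) * t ^ 2 / 2))
      = fun t => (3 * (v : ℝ) ^ 2 * t + v ^ 3 * t ^ 3) * Real.exp (v * t ^ 2 / 2) := by
    rw [iteratedDeriv_succ, d2, deriv_poly_mul_exp (q := fun t => 2 * (v : ℝ) ^ 2 * t) v]
    · ext t; ring
    · intro t
      have := ((hasDerivAt_pow 2 t).const_mul ((v : ℝ) ^ 2)).const_add (v : ℝ)
      exact this.congr_deriv (by push_cast; ring)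
  have d4 : iteratedDeriv 4 (fun t : ℝ => Real.exp ((v : ℝ) * t ^ 2 / 2))
      = fun t => (3 * (v : ℝ) ^ 2 + 6 * v ^ 3 * t ^ 2 + v ^ 4 * t ^ 4)
        * Real.exp (v * t ^ 2 / 2) := by
    rw [iteratedDeriv_succ, d3,
      deriv_poly_mul_exp (q := fun t => 3 * (v : ℝ) ^ 2 + 3 * v ^ 3 * t ^ 2) v]
    · ext t; ring
    · intro t
      have := ((hasDerivAt_id t).const_mul (3 * (v : ℝ) ^ 2)).add
        ((hasDerivAt_pow 3 t).const_mul ((v : ℝ) ^ 3))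
      exact this.congr_deriv (by push_cast; ring)
  have d5 : iteratedDeriv 5 (fun t : ℝ => Real.exp ((v : ℝ) * t ^ 2 / 2))
      = fun t => (15 * (v : ℝ) ^ 3 * t + 10 * v ^ 4 * t ^ 3 + v ^ 5 * t ^ 5)
        * Real.exp (v * t ^ 2 / 2) := by
    rw [iteratedDeriv_succ, d4,
      deriv_poly_mul_exp (q := fun t => 12 * (v : ℝ) ^ 3 * t + 4 * v ^ 4 * t ^ 3) v]
    · ext t; ring
    · intro t
      have := (((hasDerivAt_pow 2 t).const_mul (6 * (v : ℝ) ^ 3)).const_add (3 * (v : ℝ) ^ 2)).add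
        ((hasDerivAt_pow 4 t).const_mul ((v : ℝ) ^ 4))
      exact this.congr_deriv (by push_cast; ring)
  have d6 : iteratedDeriv 6 (fun t : ℝ => Real.exp ((v : ℝ) * t ^ 2 / 2))
      = fun t => (15 * (v : ℝ) ^ 3 + 45 * v ^ 4 * t ^ 2 + 15 * v ^ 5 * t ^ 4 + v ^ 6 * t ^ 6)
        * Real.exp (v * t ^ 2 / 2) := by
    rw [iteratedDeriv_succ, d5, deriv_poly_mul_exp
      (q := fun t => 15 * (v : ℝ) ^ 3 + 30 * v ^ 4 * t ^ 2 + 5 * v ^ 5 * t ^ 4) v]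
    · ext t; ring
    · intro t
      have := (((hasDerivAt_id t).const_mul (15 * (v : ℝ) ^ 3)).add
        ((hasDerivAt_pow 3 t).const_mul (10 * (v : ℝ) ^ 4))).add
        ((hasDerivAt_pow 5 t).const_mul ((v : ℝ) ^ 5))
      exact this.congr_deriv (by push_cast; ring)
  refine ⟨?_, ?_, ?_, ?_⟩
  · rw [key, d2]; simp
  · rw [key, d3]; simp
  · rw [key, d4]; simp
  · rw [key, d6]; simp

end GaussianMoments

section MomentAlgebra

open scoped NNReal ENNReal

variable {S : Type*} [MeasurableSpace S]

/-- The algebra of complex random variables all of whose moments are finite. -/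
def momentAlgebra (P : Measure S) [IsFiniteMeasure P] : Subalgebra ℂ (S → ℂ) where
  carrier := {F | ∀ p : ℝ≥0∞, p ≠ ∞ → MemLp F p P}
  mul_mem' := fun {F G} hF hG p hp => by
    have h2 : 2 * p ≠ ∞ := ENNReal.mul_ne_top (by simp) hp
    have : ENNReal.HolderTriple (2 * p) (2 * p) p := ⟨by
      rw [ENNReal.mul_inv (by simp) (by simp), ← add_mul, ENNReal.inv_two_add_inv_two, one_mul]⟩
    exact (hG _ h2).mul (hF _ h2)
  add_mem' := fun hF hG p hp => (hF p hp).add (hG p hp)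
  algebraMap_mem' := fun z p _ => memLp_const z

variable {P : Measure S} [IsProbabilityMeasure P]

lemma momentAlgebra.memLp (F : momentAlgebra P) {p : ℝ≥0∞} (hp : p ≠ ∞) :
    MemLp (F : S → ℂ) p P := F.2 p hp

lemma momentAlgebra.integrable (F : momentAlgebra P) : Integrable (F : S → ℂ) P :=
  memLp_one_iff_integrable.1 (F.2 1 (by simp))

/-- The expectation, as a linear functional on the algebra of random variables with all
moments. -/
noncomputable def expectation (P : Measure S) [IsProbabilityMeasure P] :
    momentAlgebra P →ₗ[ℂ] ℂ where
  toFun F := ∫ s, (F : S → ℂ) s ∂P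
  map_add' F G := integral_add (momentAlgebra.integrable F) (momentAlgebra.integrable G)
  map_smul' z _ := integral_const_mul z _

lemma expectation_apply (F : momentAlgebra P) : expectation P F = ∫ s, (F : S → ℂ) s ∂P := rfl

lemma expectation_one : expectation P (1 : momentAlgebra P) = 1 := by
  simp [expectation_apply]

lemma ofReal_mem_momentAlgebra {X : S → ℝ} (hX : HasGaussianLaw X P) :
    (fun s => (X s : ℂ)) ∈ momentAlgebra P := fun _ hp => (hX.memLp hp).ofReal

variable {T : Type*} {W : T → S → ℝ}

/-- The members of a Gaussian process, as elements of the algebra of random variables with all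
moments. -/
noncomputable def gaussianElt (hW : IsGaussianProcess W P) (φ : T) : momentAlgebra P :=
  ⟨fun s => (W φ s : ℂ), ofReal_mem_momentAlgebra (hW.hasGaussianLaw_eval φ)⟩

/-- The complex span of a Gaussian process. -/
noncomputable def gaussianSpan (hW : IsGaussianProcess W P) : Submodule ℂ (momentAlgebra P) :=
  Submodule.span ℂ (Set.range (gaussianElt hW))

lemma hasGaussianMoments_of_hasGaussianLaw {X : S → ℝ} (hX : HasGaussianLaw X P)
    (h0 : ∫ s, X s ∂P = 0) {F : momentAlgebra P} (hF : ∀ s, (F : S → ℂ) s = X s) :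
    HasGaussianMoments (expectation P) F := by
  have hlaw := hX.map_eq_gaussianReal
  rw [h0] at hlaw
  obtain ⟨m2, m3, m4, m6⟩ := gaussianReal_moments Var[X; P].toNNReal
  have key : ∀ n : ℕ, expectation P (F ^ n)
      = ((∫ x, x ^ n ∂(gaussianReal 0 Var[X; P].toNNReal) : ℝ) : ℂ) := fun n => by
    rw [← hlaw, integral_map hX.aemeasurable (by fun_prop), expectation_apply, ← integral_complex_ofReal]
    refine integral_congr_ae (.of_forall fun s => ?_)
    simp [hF s]
  refine ⟨?_, ?_, ?_, ?_⟩
  · rw [expectation_apply]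
    simp_rw [hF]
    rw [integral_complex_ofReal, h0, Complex.ofReal_zero]
  · rw [key, m3]; simp
  · rw [key, key, m4, m2]; push_cast; ring
  · rw [key, key, m6, m2]; push_cast; ring

/-- Real linear combinations of a Gaussian process are Gaussian; complex ones inherit the moment
identities by polynomial continuation. -/
lemma hasGaussianMoments_of_mem_gaussianSpan (hW : IsGaussianProcess W P)
    (h0 : ∀ φ, ∫ s, W φ s ∂P = 0) {F : momentAlgebra P} (hF : F ∈ gaussianSpan hW) :
    HasGaussianMoments (expectation P) F := by
  obtain ⟨c, rfl⟩ := (Finsupp.mem_span_range_iff_exists_finsupp).1 hF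
  have real : ∀ b : T → ℝ, HasGaussianMoments (expectation P)
      (∑ φ ∈ c.support, (b φ : ℂ) • gaussianElt hW φ) := fun b => by
    refine hasGaussianMoments_of_hasGaussianLaw ((hW.smul b).hasGaussianLaw_fun_sum
      (I := c.support)) ?_ fun s => ?_
    · rw [integral_finsetSum _ fun φ _ => ((hW.smul b).hasGaussianLaw_eval φ).integrable]
      refine Finset.sum_eq_zero fun φ _ => ?_
      rw [integral_smul, h0, smul_zero]
    · simp [gaussianElt]
  have hdec : (c.sum fun φ a => a • gaussianElt hW φ)
      = (∑ φ ∈ c.support, (((c φ).re : ℝ) : ℂ) • gaussianElt hW φ)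
        + Complex.I • (∑ φ ∈ c.support, (((c φ).im : ℝ) : ℂ) • gaussianElt hW φ) := by
    rw [Finsupp.sum, Finset.smul_sum, ← Finset.sum_add_distrib]
    refine Finset.sum_congr rfl fun φ _ => ?_
    rw [smul_smul, ← add_smul, mul_comm Complex.I, Complex.re_add_im]
  rw [hdec]
  refine hasGaussianMoments_add_smul _ (fun t => ?_) _
  convert! real (fun φ => (c φ).re + t * (c φ).im) using 1
  rw [Finset.smul_sum, ← Finset.sum_add_distrib]
  refine Finset.sum_congr rfl fun φ _ => ?_
  rw [smul_smul, ← add_smul]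
  push_cast
  rfl

end MomentAlgebra

/-! ### Fourier transform of white noise and its Wick products -/

lemma noiseKernel_neg (σ u : ℝ) : noiseKernel σ (-u) = noiseKernel σ u := by
  unfold noiseKernel
  by_cases hu : u = 0
  · simp [hu]
  · rw [if_neg hu, if_neg (neg_ne_zero.2 hu), neg_div, Real.sin_neg, neg_div_neg_eq]

lemma integral_window (g : ℝ → ℝ) :
    ∫ x in window, g x = ∫ x in (-(1 / 2))..(1 / 2), g x := by
  rw [window, integral_Icc_eq_integral_Ioc, intervalIntegral.integral_of_le (by norm_num)]

lemma integral_window_cos (u : ℝ) :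
    ∫ x in window, Real.cos (u * x) = if u = 0 then 1 else 2 * (Real.sin (u / 2) / u) := by
  rw [integral_window]
  split_ifs with hu
  · simp only [hu, zero_mul, Real.cos_zero, intervalIntegral.integral_const]
    norm_num
  · rw [intervalIntegral.integral_comp_mul_left (fun x => Real.cos x) hu, integral_cos,
      show u * (1 / 2) = u / 2 by ring, show u * -(1 / 2) = -(u / 2) by ring, Real.sin_neg,
      smul_eq_mul]
    ring

lemma integral_window_sin (u : ℝ) : ∫ x in window, Real.sin (u * x) = 0 := by
  rw [integral_window]
  by_cases hu : u = 0
  · simp [hu]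
  · rw [intervalIntegral.integral_comp_mul_left (fun x => Real.sin x) hu, integral_sin,
      show u * (1 / 2) = u / 2 by ring, show u * -(1 / 2) = -(u / 2) by ring, Real.cos_neg]
    simp

lemma noiseKernel_eq (σ u : ℝ) :
    noiseKernel σ u = σ ^ 2 * ∫ x in window, Real.cos (u * x) := by
  rw [integral_window_cos, noiseKernel]
  split_ifs <;> ring

lemma inner_toLp_window {g h : ℝ → ℝ} (hg : MemLp g 2 (volume.restrict window))
    (hh : MemLp h 2 (volume.restrict window)) :
    inner ℝ (hg.toLp g) (hh.toLp h) = ∫ x in window, g x * h x := by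
  rw [L2.inner_def]
  refine integral_congr_ae ?_
  filter_upwards [hg.coeFn_toLp, hh.coeFn_toLp] with x h1 h2
  rw [h1, h2]
  simp [mul_comm]

lemma integrableOn_window {g : ℝ → ℝ} (hg : Continuous g) : IntegrableOn g window :=
  hg.continuousOn.integrableOn_compact isCompact_Icc

lemma inner_cosTest_sub (a b : ℝ) :
    inner ℝ (cosTest a) (cosTest b) - inner ℝ (sinTest a) (sinTest b)
      = ∫ x in window, Real.cos ((a + b) * x) := by
  rw [cosTest, cosTest, sinTest, sinTest, inner_toLp_window, inner_toLp_window, ← integral_sub]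
  · simp_rw [add_mul, Real.cos_add]
  · exact integrableOn_window (by fun_prop)
  · exact integrableOn_window (by fun_prop)

lemma inner_cosTest_sinTest_add (a b : ℝ) :
    inner ℝ (cosTest a) (sinTest b) + inner ℝ (sinTest a) (cosTest b) = 0 := by
  rw [cosTest, cosTest, sinTest, sinTest, inner_toLp_window, inner_toLp_window, ← integral_add]
  · rw [← integral_window_sin (a + b)]
    simp_rw [add_mul, Real.sin_add]
    congr 1; ext x; ring
  · exact integrableOn_window (by fun_prop)
  · exact integrableOn_window (by fun_prop)

lemma cosTest_neg (a : ℝ) : cosTest (-a) = cosTest a := by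
  simp only [cosTest, neg_mul, Real.cos_neg]

lemma sinTest_neg (a : ℝ) : sinTest (-a) = -sinTest a := by
  rw [sinTest, sinTest, ← MemLp.toLp_neg]
  refine MemLp.toLp_congr _ _ (.of_forall fun x => ?_)
  simp

/-- The Fourier transform `w(cos(ω·)) - i w(sin(ω·))` of a functional `w` on test functions. -/
noncomputable def functionalFourier (w : L2Window → ℝ) (ω : ℝ) : ℂ :=
  (w (cosTest ω) : ℂ) - Complex.I * (w (sinTest ω) : ℂ)

section WhiteNoise

variable {S : Type*} [MeasurableSpace S] {P : Measure S} [IsProbabilityMeasure P] {σ : ℝ}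
  {W : L2Window → S → ℝ} (hW : IsWhiteNoise P σ W)

/-- The Fourier transform of white noise at a frequency, as a random variable with all moments. -/
noncomputable def noiseElt (hW : IsGaussianProcess W P) (a : ℝ) : momentAlgebra P :=
  gaussianElt hW (cosTest a) - Complex.I • gaussianElt hW (sinTest a)

lemma noiseElt_apply (hW : IsGaussianProcess W P) (a : ℝ) (s : S) :
    (noiseElt hW a : S → ℂ) s = functionalFourier (fun φ => W φ s) a := by
  simp [noiseElt, gaussianElt, functionalFourier]

lemma noiseElt_mem (hW : IsGaussianProcess W P) (a : ℝ) : noiseElt hW a ∈ gaussianSpan hW :=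
  Submodule.sub_mem _ (Submodule.subset_span ⟨_, rfl⟩)
    (Submodule.smul_mem _ _ (Submodule.subset_span ⟨_, rfl⟩))

include hW

lemma expectation_gaussianElt_mul (φ ψ : L2Window) :
    expectation P (gaussianElt hW.gaussian φ * gaussianElt hW.gaussian ψ)
      = ((σ ^ 2 * inner ℝ φ ψ : ℝ) : ℂ) := by
  rw [← hW.cov, ← integral_complex_ofReal, expectation_apply]
  simp [gaussianElt]

lemma expectation_noiseElt_mul (a b : ℝ) :
    expectation P (noiseElt hW.gaussian a * noiseElt hW.gaussian b)
      = (noiseKernel σ (a + b) : ℂ) := by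
  have h : noiseElt hW.gaussian a * noiseElt hW.gaussian b
      = gaussianElt hW.gaussian (cosTest a) * gaussianElt hW.gaussian (cosTest b)
        - gaussianElt hW.gaussian (sinTest a) * gaussianElt hW.gaussian (sinTest b)
        - Complex.I • (gaussianElt hW.gaussian (cosTest a) * gaussianElt hW.gaussian (sinTest b)
          + gaussianElt hW.gaussian (sinTest a) * gaussianElt hW.gaussian (cosTest b)) := by
    have hI : (Complex.I • (1 : momentAlgebra P)) * (Complex.I • (1 : momentAlgebra P)) = -1 := by
      rw [smul_mul_smul_comm, Complex.I_mul_I, one_mul, neg_one_smul]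
    have hs : ∀ F : momentAlgebra P, Complex.I • F = (Complex.I • (1 : momentAlgebra P)) * F :=
      fun F => by rw [smul_mul_assoc, one_mul]
    rw [noiseElt, noiseElt, hs, hs (gaussianElt hW.gaussian (sinTest b)), hs (_ + _)]
    linear_combination (gaussianElt hW.gaussian (sinTest a)
      * gaussianElt hW.gaussian (sinTest b)) * hI
  rw [h]
  simp only [map_add, map_sub, map_smul, expectation_gaussianElt_mul hW, smul_eq_mul]
  have h1 := inner_cosTest_sub a b
  have h2 := inner_cosTest_sinTest_add a b
  rw [← Complex.ofReal_sub, ← Complex.ofReal_add, ← mul_sub, ← mul_add, h1, h2, noiseKernel_eq]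
  simp

omit [IsProbabilityMeasure P] in
/-- Linearity of white noise is only available almost surely, from its covariance. -/
lemma whiteNoise_neg (φ : L2Window) : ∀ᵐ s ∂P, W (-φ) s = -W φ s := by
  have hL : ∀ ψ, MemLp (W ψ) 2 P := fun ψ => (hW.gaussian.hasGaussianLaw_eval ψ).memLp_two
  have hi : ∀ ψ χ, Integrable (fun s => W ψ s * W χ s) P := fun ψ χ =>
    (hL ψ).integrable_mul (hL χ)
  have h0 : ∫ s, (W (-φ) s + W φ s) ^ 2 ∂P = 0 := by
    have : (fun s => (W (-φ) s + W φ s) ^ 2)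
        = fun s => W (-φ) s * W (-φ) s + 2 * (W (-φ) s * W φ s) + W φ s * W φ s := by
      ext s; ring
    have hi2 : Integrable (fun s => W (-φ) s * W (-φ) s + 2 * (W (-φ) s * W φ s)) P :=
      (hi _ _).add ((hi _ _).const_mul 2)
    rw [this, integral_add hi2 (hi _ _),
      integral_add (hi _ _) ((hi _ _).const_mul 2), integral_const_mul, hW.cov, hW.cov, hW.cov]
    simp only [inner_neg_left, inner_neg_right]
    ring
  have hi3 : Integrable (fun s => (W (-φ) s + W φ s) ^ 2) P := ((hL _).add (hL _)).integrable_sq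
  rw [integral_eq_zero_iff_of_nonneg (fun s => sq_nonneg _) hi3] at h0
  filter_upwards [h0] with s hs
  have : W (-φ) s + W φ s = 0 := by simpa using hs
  linarith

lemma conj_functionalFourier (a : ℝ) :
    ∀ᵐ s ∂P, conj (functionalFourier (fun φ => W φ s) a)
      = functionalFourier (fun φ => W φ s) (-a) := by
  filter_upwards [whiteNoise_neg hW (sinTest a)] with s hs
  simp [functionalFourier, cosTest_neg, sinTest_neg, hs]

end WhiteNoise

/-! ### The noise terms of the centred bispectrum -/

/-- The frequencies `(ω₁, -ω₂, ω₂ - ω₁)` of the three factors of the bispectrum; they add up to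
zero. -/
def freq (i : Fin 3) (ω : Plane) : ℝ := ![ω 0, -ω 1, ω 1 - ω 0] i

/-- The three factors of the bispectrum. -/
noncomputable def factor (Y : ℝ → ℂ) (i : Fin 3) (ω : Plane) : ℂ :=
  ![Y (ω 0), conj (Y (ω 1)), Y (ω 1 - ω 0)] i

/-- Labels of the Wick monomials in the expansion of the bispectrum of signal plus noise: the cubic
one, the quadratic ones (labelled by the position of the signal factor) and the linear ones
(labelled by the position of the noise factor). -/
abbrev NoiseKind : Type := Unit ⊕ Fin 3 ⊕ Fin 3

/-- The Wick monomial of the noise with Fourier transform `Y`. -/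
noncomputable def wickTerm (σ : ℝ) : NoiseKind → (ℝ → ℂ) → Plane → ℂ
  | .inl _, Y, ω => factor Y 0 ω * factor Y 1 ω * factor Y 2 ω
      - noiseKernel σ (freq 2 ω) * factor Y 2 ω - noiseKernel σ (freq 1 ω) * factor Y 1 ω
      - noiseKernel σ (freq 0 ω) * factor Y 0 ω
  | .inr (.inl i), Y, ω => factor Y (i + 1) ω * factor Y (i + 2) ω - noiseKernel σ (freq i ω)
  | .inr (.inr i), Y, ω => factor Y i ω

/-- The product of the signal factors that accompanies a Wick monomial. -/
noncomputable def signalTerm : NoiseKind → (ℝ → ℂ) → Plane → ℂ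
  | .inl _, _, _ => 1
  | .inr (.inl i), F, ω => factor F i ω
  | .inr (.inr i), F, ω => factor F (i + 1) ω * factor F (i + 2) ω

/-- The covariance of a Wick monomial at two points of the frequency plane. -/
noncomputable def wickCov (σ : ℝ) : NoiseKind → Plane → Plane → ℝ
  | .inl _, ω, ξ =>
      let k := fun i j => noiseKernel σ (freq i ω - freq j ξ)
      k 0 0 * k 1 1 * k 2 2 + k 0 0 * k 1 2 * k 2 1 + k 0 1 * k 1 0 * k 2 2
        + k 0 1 * k 1 2 * k 2 0 + k 0 2 * k 1 0 * k 2 1 + k 0 2 * k 1 1 * k 2 0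
  | .inr (.inl i), ω, ξ =>
      let k := fun i j => noiseKernel σ (freq i ω - freq j ξ)
      k (i + 1) (i + 1) * k (i + 2) (i + 2) + k (i + 1) (i + 2) * k (i + 2) (i + 1)
  | .inr (.inr i), ω, ξ => noiseKernel σ (freq i ω - freq i ξ)

lemma freq_sum (ω : Plane) : freq 0 ω + freq 1 ω + freq 2 ω = 0 := by
  simp only [freq, Matrix.cons_val_zero, Matrix.cons_val_one, Matrix.cons_val]
  ring

/-- The bispectrum of signal plus noise, after subtraction of the clean bispectrum and of the
centring term, is the sum of the Wick monomials. -/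
lemma tripleProduct_add_sub (σ : ℝ) (F Y : ℝ → ℂ) (ω : Plane) :
    tripleProduct (fun a => F a + Y a) ω
        - ∑ i, noiseKernel σ (freq i ω) * factor (fun a => F a + Y a) i ω
      = tripleProduct F ω + ∑ k, signalTerm k F ω * wickTerm σ k Y ω := by
  have e2 : (1 : Fin 3) + 1 = 2 := rfl
  have e3 : (1 : Fin 3) + 2 = 0 := rfl
  have e4 : (2 : Fin 3) + 1 = 0 := rfl
  have e5 : (2 : Fin 3) + 2 = 1 := rfl
  simp only [tripleProduct, Fintype.sum_sum_type, Fin.sum_univ_three, Finset.univ_unique,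
    Finset.sum_singleton, signalTerm, wickTerm, e2, e3, e4, e5, zero_add]
  simp only [factor, Matrix.cons_val_zero, Matrix.cons_val_one, Matrix.cons_val, map_add]
  ring

section WickTerms

variable {S : Type*} [MeasurableSpace S] {P : Measure S} [IsProbabilityMeasure P] {σ : ℝ}
  {W : L2Window → S → ℝ} (hW : IsWhiteNoise P σ W)

/-- A Wick monomial of white noise at the point `ω`, with the frequencies multiplied by the sign
`ε`, as a random variable with all moments. -/
noncomputable def wickElt (hW : IsGaussianProcess W P) (ε : ℝ) :
    NoiseKind → Plane → momentAlgebra P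
  | .inl _, ω => wick₃ (expectation P) (noiseElt hW (ε * freq 0 ω)) (noiseElt hW (ε * freq 1 ω))
      (noiseElt hW (ε * freq 2 ω))
  | .inr (.inl i), ω => wick₂ (expectation P) (noiseElt hW (ε * freq (i + 1) ω))
      (noiseElt hW (ε * freq (i + 2) ω))
  | .inr (.inr i), ω => noiseElt hW (ε * freq i ω)

include hW

lemma expectation_wickElt (ε : ℝ) (k : NoiseKind) (ω : Plane) :
    expectation P (wickElt hW.gaussian ε k ω) = 0 := by
  have hG := fun F => hasGaussianMoments_of_mem_gaussianSpan hW.gaussian hW.mean (F := F)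
  obtain _ | i | i := k
  · exact expect_wick₃ hG (noiseElt_mem _ _) (noiseElt_mem _ _) (noiseElt_mem _ _)
  · exact expect_wick₂ expectation_one _ _
  · exact (hG _ (noiseElt_mem _ _)).one

lemma expectation_wickElt_mul (k : NoiseKind) (ω ξ : Plane) :
    expectation P (wickElt hW.gaussian 1 k ω * wickElt hW.gaussian (-1) k ξ)
      = (wickCov σ k ω ξ : ℂ) := by
  have hG := fun F => hasGaussianMoments_of_mem_gaussianSpan hW.gaussian hW.mean (F := F)
  obtain _ | i | i := k
  · simp only [wickElt, wickCov]
    rw [expect_wick₃_mul_wick₃ hG (noiseElt_mem _ _) (noiseElt_mem _ _) (noiseElt_mem _ _)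
      (noiseElt_mem _ _) (noiseElt_mem _ _) (noiseElt_mem _ _)]
    simp only [expectation_noiseElt_mul hW, one_mul, neg_mul, ← sub_eq_add_neg]
    push_cast
    ring
  · simp only [wickElt, wickCov]
    rw [expect_wick₂_mul_wick₂ hG expectation_one (noiseElt_mem _ _) (noiseElt_mem _ _)
      (noiseElt_mem _ _) (noiseElt_mem _ _)]
    simp only [expectation_noiseElt_mul hW, one_mul, neg_mul, ← sub_eq_add_neg]
    push_cast
    ring
  · simp only [wickElt, wickCov, expectation_noiseElt_mul hW, one_mul, neg_mul, ← sub_eq_add_neg]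

lemma factor_functionalFourier (i : Fin 3) (ω : Plane) :
    ∀ᵐ s ∂P, factor (functionalFourier fun φ => W φ s) i ω
        = functionalFourier (fun φ => W φ s) (freq i ω)
      ∧ conj (factor (functionalFourier fun φ => W φ s) i ω)
        = functionalFourier (fun φ => W φ s) (-freq i ω) := by
  filter_upwards [conj_functionalFourier hW (ω 0), conj_functionalFourier hW (ω 1),
    conj_functionalFourier hW (ω 1 - ω 0)] with s h0 h1 h2
  fin_cases i <;> simp [factor, freq, h0, h1, h2]
  rw [← h1, Complex.conj_conj]

lemma wickTerm_functionalFourier (k : NoiseKind) (ω : Plane) :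
    ∀ᵐ s ∂P, wickTerm σ k (functionalFourier fun φ => W φ s) ω
        = (wickElt hW.gaussian 1 k ω : S → ℂ) s
      ∧ conj (wickTerm σ k (functionalFourier fun φ => W φ s) ω)
        = (wickElt hW.gaussian (-1) k ω : S → ℂ) s := by
  have hsum := freq_sum ω
  have a01 : freq 0 ω + freq 1 ω = -freq 2 ω := by linarith
  have a02 : freq 0 ω + freq 2 ω = -freq 1 ω := by linarith
  have a12 : freq 1 ω + freq 2 ω = -freq 0 ω := by linarith
  have acyc : ∀ i : Fin 3, freq (i + 1) ω + freq (i + 2) ω = -freq i ω := by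
    intro i
    fin_cases i
    · exact a12
    · exact (add_comm _ _).trans a02
    · exact a01
  filter_upwards [ae_all_iff.2 fun i => factor_functionalFourier hW i ω] with s hs
  obtain _ | i | i := k
  · constructor
    · simp only [wickTerm, wickElt, wick₃, expectation_noiseElt_mul hW, one_mul, (hs _).1, a01, a02,
        a12, noiseKernel_neg]
      simp [noiseElt_apply]
    · simp only [wickTerm, wickElt, wick₃, expectation_noiseElt_mul hW, neg_mul, one_mul, map_mul,
        map_sub, Complex.conj_ofReal, (hs _).2, ← neg_add, a01, a02, a12, noiseKernel_neg]
      simp [noiseElt_apply]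
  · constructor
    · simp only [wickTerm, wickElt, wick₂, expectation_noiseElt_mul hW, one_mul, (hs _).1, acyc,
        noiseKernel_neg]
      simp [noiseElt_apply]
    · simp only [wickTerm, wickElt, wick₂, expectation_noiseElt_mul hW, neg_mul, one_mul, map_mul,
        map_sub, Complex.conj_ofReal, (hs _).2, ← neg_add, acyc, noiseKernel_neg]
      simp [noiseElt_apply]
  · exact ⟨by simp [wickTerm, wickElt, noiseElt_apply, (hs _).1],
      by simp [wickTerm, wickElt, noiseElt_apply, (hs _).2]⟩

lemma memLp_wickTerm (k : NoiseKind) (ω : Plane) :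
    MemLp (fun s => wickTerm σ k (functionalFourier fun φ => W φ s) ω) 2 P := by
  refine (momentAlgebra.memLp (wickElt hW.gaussian 1 k ω) (p := 2) (by simp)).ae_eq ?_
  filter_upwards [wickTerm_functionalFourier hW k ω] with s hs
  exact hs.1.symm

lemma integral_wickTerm (k : NoiseKind) (ω : Plane) :
    ∫ s, wickTerm σ k (functionalFourier fun φ => W φ s) ω ∂P = 0 := by
  rw [← expectation_wickElt hW 1 k ω, expectation_apply]
  refine integral_congr_ae ?_
  filter_upwards [wickTerm_functionalFourier hW k ω] with s hs
  exact hs.1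

lemma integral_wickTerm_mul_conj (k : NoiseKind) (ω ξ : Plane) :
    ∫ s, wickTerm σ k (functionalFourier fun φ => W φ s) ω
        * conj (wickTerm σ k (functionalFourier fun φ => W φ s) ξ) ∂P = (wickCov σ k ω ξ : ℂ) := by
  rw [← expectation_wickElt_mul hW k ω ξ, expectation_apply]
  refine integral_congr_ae ?_
  filter_upwards [wickTerm_functionalFourier hW k ω, wickTerm_functionalFourier hW k ξ] with s h1 h2
  rw [h1.1, h2.2]
  rfl

end WickTerms

/-! ### The Fourier transform of a compactly supported square-integrable signal -/

section Plancherel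

/-- The Fourier integral of an integrable, square-integrable function is square-integrable. -/
lemma memLp_two_fourier {g : ℝ → ℂ} (h1 : Integrable g) (h2 : MemLp g 2 volume) :
    MemLp (𝓕 g) 2 volume := by
  have hcont : Continuous (𝓕 g) := VectorFourier.fourierIntegral_continuous
    Real.continuous_fourierChar (by exact continuous_inner) h1
  have hae : ∀ᵐ x, (𝓕 (h2.toLp g) : Lp ℂ 2 volume) x = 𝓕 g x := by
    refine ae_eq_of_integral_contDiff_smul_eq
      ((Lp.memLp _).locallyIntegrable (by norm_num)) hcont.locallyIntegrable fun u hu hsu => ?_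
    have hsu' : HasCompactSupport (fun x => (u x : ℂ)) := hsu.comp_left Complex.ofReal_zero
    have hu' : ContDiff ℝ (⊤ : ℕ∞) (fun x => (u x : ℂ)) := Complex.ofRealCLM.contDiff.comp hu
    have hφ : ∀ x, (hsu'.toSchwartzMap hu') x = (u x : ℂ) := fun x => rfl
    generalize hsu'.toSchwartzMap hu' = φ at hφ
    have e1 := congrArg (fun T => T φ) (Lp.fourier_toTemperedDistribution_eq (h2.toLp g))
    simp only [TemperedDistribution.fourier_apply, Lp.toTemperedDistribution_apply] at e1
    have e2 : ∫ x, (𝓕 φ) x • (h2.toLp g) x = ∫ x, (𝓕 φ) x • g x := by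
      refine integral_congr_ae ?_
      filter_upwards [h2.coeFn_toLp] with x hx
      rw [hx]
    have e3 := VectorFourier.integral_fourierIntegral_smul_eq_flip (μ := volume) (ν := volume)
      (L := innerₗ ℝ) (f := φ) (g := g) Real.continuous_fourierChar
      (by exact continuous_inner) φ.integrable h1
    rw [flip_innerₗ] at e3
    calc ∫ x, u x • (𝓕 (h2.toLp g) : Lp ℂ 2 volume) x
        = ∫ x, φ x • (𝓕 (h2.toLp g) : Lp ℂ 2 volume) x := by
          simp_rw [hφ]; rfl
      _ = ∫ x, (𝓕 φ) x • g x := by rw [← e1, e2]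
      _ = ∫ x, φ x • 𝓕 g x := e3
      _ = ∫ x, u x • 𝓕 g x := by simp_rw [hφ]; rfl
  exact (Lp.memLp _).ae_eq hae

end Plancherel

section Signal

variable {f : ℝ → ℝ}

lemma fourierHat_eq (f : ℝ → ℝ) (ω : ℝ) :
    fourierHat f ω = 𝓕 (fun x => (f x : ℂ)) ((2 * Real.pi)⁻¹ * ω) := by
  rw [fourierHat, Real.fourier_real_eq_integral_exp_smul]
  congr 1; ext x
  rw [smul_eq_mul, mul_comm]
  congr 2
  push_cast
  have : (Real.pi : ℂ) ≠ 0 := by exact_mod_cast Real.pi_ne_zero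
  field_simp

lemma fourierHat_neg (f : ℝ → ℝ) (ω : ℝ) : fourierHat f (-ω) = conj (fourierHat f ω) := by
  rw [fourierHat, fourierHat, ← integral_conj]
  congr 1; ext x
  rw [map_mul, Complex.conj_ofReal, ← Complex.exp_conj]
  simp

/-- The Fourier transform of a translated and dilated signal. -/
lemma fourierHat_dilatedSignal (f : ℝ → ℝ) (t : ℝ) {τ : ℝ} (hτ : τ < 1) (ω : ℝ) :
    fourierHat (dilatedSignal f t τ) ω
      = ((1 - τ : ℝ) : ℂ) * Complex.exp (-(Complex.I * ω * t)) * fourierHat f ((1 - τ) * ω) := by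
  have hs : 0 < 1 - τ := by linarith
  have hs' : ((1 - τ : ℝ) : ℂ) ≠ 0 := by exact_mod_cast hs.ne'
  let G : ℝ → ℂ := fun y => (f y : ℂ) * Complex.exp (-(Complex.I * ((1 - τ) * ω : ℝ) * y))
  have h1 : ∀ x : ℝ, (dilatedSignal f t τ x : ℂ) * Complex.exp (-(Complex.I * ω * x))
      = Complex.exp (-(Complex.I * ω * t)) * G ((1 - τ)⁻¹ * (x - t)) := fun x => by
    simp only [G, dilatedSignal]
    rw [mul_left_comm, ← Complex.exp_add]
    congr 2
    push_cast
    push_cast at hs'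
    field_simp
    ring
  have h2 : ∫ x : ℝ, G ((1 - τ)⁻¹ * (x - t)) = ((1 - τ : ℝ) : ℂ) * ∫ y, G y := by
    rw [integral_sub_right_eq_self (fun x => G ((1 - τ)⁻¹ * x)) t, Measure.integral_comp_mul_left,
      inv_inv, abs_of_pos hs, Complex.real_smul]
  rw [fourierHat]
  simp_rw [h1]
  rw [integral_const_mul, h2]
  simp only [G, fourierHat]
  ring

/-- The bispectrum does not see translations, and scales under dilations. -/
lemma tripleProduct_dilatedSignal (f : ℝ → ℝ) (t : ℝ) {τ : ℝ} (hτ : τ < 1) (ω : Plane) :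
    tripleProduct (fourierHat (dilatedSignal f t τ)) ω
      = (((1 - τ) ^ 3 : ℝ) : ℂ) * bispectrum f ((1 - τ) • ω) := by
  simp only [tripleProduct, bispectrum, fourierHat_dilatedSignal f t hτ, map_mul,
    Complex.conj_ofReal, ← Complex.exp_conj, map_neg, Complex.conj_I, PiLp.smul_apply, smul_eq_mul,
    mul_sub]
  have h : Complex.exp (-(Complex.I * (ω 0 : ℝ) * t)) * Complex.exp (-(-Complex.I * (ω 1 : ℝ) * t))
      * Complex.exp (-(Complex.I * ((ω 1 - ω 0 : ℝ) : ℂ) * t)) = 1 := by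
    rw [← Complex.exp_add, ← Complex.exp_add, ← Complex.exp_zero]
    congr 1
    push_cast
    ring
  push_cast at h ⊢
  linear_combination ((1 - (τ : ℂ)) ^ 3 * fourierHat f ((1 - τ) * ω 0)
    * conj (fourierHat f ((1 - τ) * ω 1))
    * fourierHat f ((1 - τ) * ω 1 - (1 - τ) * ω 0)) * h

/-- Functions of class `C³` that are bounded together with their derivatives up to order three. -/
def BoundedC3 {E F : Type*} [NormedAddCommGroup E] [NormedSpace ℝ E] [NormedAddCommGroup F]
    [NormedSpace ℝ F] (G : E → F) : Prop :=
  ContDiff ℝ 3 G ∧ ∃ C : ℝ, ∀ k : ℕ, k ≤ 3 → ∀ x, ‖iteratedFDeriv ℝ k G x‖ ≤ C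

lemma BoundedC3.comp_clm {E E' F : Type*} [NormedAddCommGroup E] [NormedSpace ℝ E]
    [NormedAddCommGroup E'] [NormedSpace ℝ E'] [NormedAddCommGroup F] [NormedSpace ℝ F]
    {G : E → F} (hG : BoundedC3 G) (A : E' →L[ℝ] E) : BoundedC3 (fun x => G (A x)) := by
  obtain ⟨h, C, hC⟩ := hG
  refine ⟨h.comp A.contDiff, C * (1 + ‖A‖) ^ 3, fun k hk x => ?_⟩
  have hC0 : 0 ≤ C := (norm_nonneg _).trans (hC 0 (by norm_num) 0)
  have e := A.iteratedFDeriv_comp_right h x (i := k) (by exact_mod_cast hk)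
  have e' : iteratedFDeriv ℝ k (fun x => G (A x)) x = _ := e
  rw [e']
  refine (ContinuousMultilinearMap.norm_compContinuousLinearMap_le _ _).trans ?_
  rw [Finset.prod_const, Finset.card_univ, Fintype.card_fin]
  refine mul_le_mul (hC k hk _) ?_ (by positivity) hC0
  calc ‖A‖ ^ k ≤ (1 + ‖A‖) ^ k := by gcongr; linarith
    _ ≤ (1 + ‖A‖) ^ 3 := pow_le_pow_right₀ (by linarith [norm_nonneg A]) hk

lemma BoundedC3.mul {E : Type*} [NormedAddCommGroup E] [NormedSpace ℝ E] {G H : E → ℂ}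
    (hG : BoundedC3 G) (hH : BoundedC3 H) : BoundedC3 (fun x => G x * H x) := by
  obtain ⟨h, C, hC⟩ := hG
  obtain ⟨h', C', hC'⟩ := hH
  have hC0 : 0 ≤ C := (norm_nonneg _).trans (hC 0 (by norm_num) 0)
  have hC0' : 0 ≤ C' := (norm_nonneg _).trans (hC' 0 (by norm_num) 0)
  refine ⟨h.mul h', 8 * C * C', fun k hk x => ?_⟩
  refine (norm_iteratedFDeriv_mul_le h h' x (n := k) (by exact_mod_cast hk)).trans ?_
  calc ∑ i ∈ Finset.range (k + 1),
        (k.choose i : ℝ) * ‖iteratedFDeriv ℝ i G x‖ * ‖iteratedFDeriv ℝ (k - i) H x‖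
      ≤ ∑ i ∈ Finset.range (k + 1), (k.choose i : ℝ) * C * C' := by
        refine Finset.sum_le_sum fun i hi => ?_
        have hi' : i ≤ k := by simpa [Nat.lt_succ_iff] using hi
        gcongr
        · exact hC i (hi'.trans hk) x
        · exact hC' (k - i) ((Nat.sub_le _ _).trans hk) x
    _ = 2 ^ k * C * C' := by
        rw [← Finset.sum_mul, ← Finset.sum_mul]
        congr 2
        exact_mod_cast Nat.sum_range_choose k
    _ ≤ 2 ^ 3 * C * C' := by
        gcongr
        norm_num
    _ = 8 * C * C' := by norm_num

variable (hf : MemLp f 2 volume) {ρ : ℝ} (hρ : ∀ᵐ x, ρ < |x| → f x = 0)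
include hf hρ

lemma integrable_signal : Integrable f := by
  have h : f =ᵐ[volume] (Set.Icc (-ρ) ρ).indicator f := by
    filter_upwards [hρ] with x hx
    by_cases hxm : x ∈ Set.Icc (-ρ) ρ
    · rw [Set.indicator_of_mem hxm]
    · rw [Set.indicator_of_notMem hxm, hx]
      by_contra hcon
      exact hxm (abs_le.1 (not_lt.1 hcon))
  rw [integrable_congr h, integrable_indicator_iff measurableSet_Icc]
  exact (hf.restrict _).integrable (by norm_num)

lemma integrable_pow_smul_signal (n : ℕ) : Integrable (fun x : ℝ => x ^ n • (f x : ℂ)) := by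
  have hint := integrable_signal hf hρ
  refine Integrable.mono' (hint.norm.const_mul (|ρ| ^ n)) ?_ ?_
  · exact (continuous_pow n).aestronglyMeasurable.smul
      (Complex.continuous_ofReal.comp_aestronglyMeasurable hint.1)
  · filter_upwards [hρ] with x hx
    rw [norm_smul, Complex.norm_real, norm_pow, Real.norm_eq_abs]
    by_cases h : ρ < |x|
    · simp [hx h]
    · have hle : |x| ≤ |ρ| := (not_lt.1 h).trans (le_abs_self _)
      exact mul_le_mul_of_nonneg_right (pow_le_pow_left₀ (abs_nonneg _) hle n) (norm_nonneg _)

lemma boundedC3_fourierHat : BoundedC3 (fourierHat f) := by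
  have hB : BoundedC3 (𝓕 (fun x => (f x : ℂ))) := by
    have hi := integrable_pow_smul_signal hf hρ
    have hi' : ∀ n : ℕ, (n : ℕ∞) ≤ 3 → Integrable (fun x : ℝ => ‖x‖ ^ n * ‖(f x : ℂ)‖) :=
      fun n _ => by
        refine (hi n).norm.congr (.of_forall fun x => ?_)
        simp
    refine ⟨Real.contDiff_fourier hi', ?_⟩
    let I : ℕ → ℝ := fun k => ∫ x : ℝ, ‖(-2 * Real.pi * Complex.I * x) ^ k • (f x : ℂ)‖
    refine ⟨∑ k ∈ Finset.range 4, I k, fun k hk x => ?_⟩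
    rw [norm_iteratedFDeriv_eq_norm_iteratedDeriv,
      Real.iteratedDeriv_fourier (N := 3) (fun n _ => hi n) (by exact_mod_cast hk)]
    refine (VectorFourier.norm_fourierIntegral_le_integral_norm _ _ _ _ _).trans ?_
    exact Finset.single_le_sum (f := I) (fun i _ => integral_nonneg fun _ => norm_nonneg _)
      (Finset.mem_range.2 (by omega))
  have := hB.comp_clm ((2 * Real.pi)⁻¹ • ContinuousLinearMap.id ℝ ℝ)
  refine (funext fun ω => ?_ : _ = fourierHat f) ▸ this
  rw [fourierHat_eq]
  simp

lemma boundedC3_bispectrum : BoundedC3 (bispectrum f) := by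
  have h := boundedC3_fourierHat hf hρ
  let p : Fin 2 → Plane →L[ℝ] ℝ := fun i => EuclideanSpace.proj i
  have := ((h.comp_clm (p 0)).mul (h.comp_clm (-p 1))).mul (h.comp_clm (p 1 - p 0))
  refine (funext fun ω => ?_ : _ = bispectrum f) ▸ this
  simp [bispectrum, tripleProduct, p, fourierHat_neg]

lemma memLp_fourierHat : MemLp (fourierHat f) 2 volume := by
  have h1 : Integrable (fun x => (f x : ℂ)) := (integrable_signal hf hρ).ofReal
  have h := memLp_two_fourier h1 hf.ofReal
  have hc : (2 * Real.pi)⁻¹ ≠ 0 := by positivity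
  have hi := (memLp_two_iff_integrable_sq_norm h.1).1 h
  have hcont : Continuous (fourierHat f) := (boundedC3_fourierHat hf hρ).1.continuous
  refine (memLp_two_iff_integrable_sq_norm hcont.aestronglyMeasurable).2 ?_
  have := hi.comp_mul_left' hc
  refine this.congr (.of_forall fun ω => ?_)
  simp only [fourierHat_eq]

end Signal

/-! ### The smoothing kernel -/

section Kernel

/-- `4 (G ∗ φ_L) + r ∂_r (G ∗ φ_L)`. -/
noncomputable def smoothDeriv (L : ℝ) (G : Plane → ℂ) (ζ : Plane) : ℂ :=
  4 * smoothing L G ζ + rDeriv (smoothing L G) ζ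

/-- The kernel of `G ↦ 4 (G ∗ φ_L) + r ∂_r (G ∗ φ_L)`. -/
noncomputable def testKernel (L : ℝ) (ζ u : Plane) : ℝ :=
  gaussianFilter L (ζ - u) * (4 - inner ℝ ζ (ζ - u) / L ^ 2)

/-- A Gaussian of larger variance than `gaussianFilter L`, which absorbs polynomial factors. -/
noncomputable def wideGaussian (L : ℝ) (v : Plane) : ℝ :=
  (2 * Real.pi * L ^ 2)⁻¹ * Real.exp (-(4 * L ^ 2)⁻¹ * ‖v‖ ^ 2)

/-- The Gaussian weight in the integrability condition for smoothing. -/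
noncomputable def gaussianWeight (L : ℝ) (u : Plane) : ℝ :=
  Real.exp (-(8 * L ^ 2)⁻¹ * ‖u‖ ^ 2)

variable {L : ℝ} (hL : 0 < L)
include hL

omit hL in
lemma gaussianFilter_nonneg (v : Plane) : 0 ≤ gaussianFilter L v := by
  unfold gaussianFilter; positivity

omit hL in
lemma continuous_gaussianFilter : Continuous (gaussianFilter L) := by
  unfold gaussianFilter; fun_prop

omit hL in
lemma continuous_testKernel : Continuous (fun p : Plane × Plane => testKernel L p.1 p.2) := by
  unfold testKernel
  have := continuous_gaussianFilter (L := L)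
  fun_prop

lemma sq_norm_le_exp (v : Plane) :
    ‖v‖ ^ 2 ≤ 9 * L ^ 2 * Real.exp ((4 * L ^ 2)⁻¹ * ‖v‖ ^ 2) := by
  have h := Real.add_one_le_exp ((4 * L ^ 2)⁻¹ * ‖v‖ ^ 2)
  have e : ‖v‖ ^ 2 = 4 * L ^ 2 * ((4 * L ^ 2)⁻¹ * ‖v‖ ^ 2) := by field_simp
  have hy : 0 ≤ (4 * L ^ 2)⁻¹ * ‖v‖ ^ 2 := by positivity
  calc ‖v‖ ^ 2 = 4 * L ^ 2 * ((4 * L ^ 2)⁻¹ * ‖v‖ ^ 2) := e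
    _ ≤ 9 * L ^ 2 * Real.exp ((4 * L ^ 2)⁻¹ * ‖v‖ ^ 2) := by
      have hL2 : 0 ≤ L ^ 2 := by positivity
      gcongr <;> linarith

lemma gaussianFilter_eq (v : Plane) :
    gaussianFilter L v = wideGaussian L v * Real.exp (-(4 * L ^ 2)⁻¹ * ‖v‖ ^ 2) := by
  rw [gaussianFilter, wideGaussian, mul_assoc _ (Real.exp _), ← Real.exp_add]
  congr 2
  field_simp
  ring

lemma gaussianFilter_mul_sq_le (v : Plane) :
    gaussianFilter L v * ‖v‖ ^ 2 ≤ 9 * L ^ 2 * wideGaussian L v := by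
  have h0 : 0 ≤ wideGaussian L v := by unfold wideGaussian; positivity
  calc gaussianFilter L v * ‖v‖ ^ 2
      ≤ wideGaussian L v * Real.exp (-(4 * L ^ 2)⁻¹ * ‖v‖ ^ 2)
          * (9 * L ^ 2 * Real.exp ((4 * L ^ 2)⁻¹ * ‖v‖ ^ 2)) := by
        rw [gaussianFilter_eq hL]
        gcongr
        exact sq_norm_le_exp hL v
    _ = 9 * L ^ 2 * wideGaussian L v
          * (Real.exp (-(4 * L ^ 2)⁻¹ * ‖v‖ ^ 2) * Real.exp ((4 * L ^ 2)⁻¹ * ‖v‖ ^ 2)) := by ring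
    _ = 9 * L ^ 2 * wideGaussian L v := by
        rw [← Real.exp_add, neg_mul, neg_add_cancel, Real.exp_zero, mul_one]

lemma gaussianFilter_le_wideGaussian (v : Plane) : gaussianFilter L v ≤ wideGaussian L v := by
  have h0 : 0 ≤ wideGaussian L v := by unfold wideGaussian; positivity
  rw [gaussianFilter_eq hL]
  refine mul_le_of_le_one_right h0 (Real.exp_le_one_iff.2 ?_)
  rw [neg_mul, neg_nonpos]; positivity

lemma gaussianFilter_mul_norm_le (v : Plane) :
    gaussianFilter L v * (‖v‖ / L ^ 2) ≤ 5 / L * wideGaussian L v := by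
  have h1 := gaussianFilter_mul_sq_le hL v
  have h2 := gaussianFilter_le_wideGaussian hL v
  have h3 := gaussianFilter_nonneg (L := L) v
  -- `2 L ‖v‖ ≤ L² + ‖v‖²`
  have h4 : ‖v‖ / L ^ 2 ≤ (1 / (2 * L)) + ‖v‖ ^ 2 * (1 / (2 * L ^ 3)) := by
    have : 0 ≤ (L - ‖v‖) ^ 2 / (2 * L ^ 3) := by positivity
    have e : (1 / (2 * L)) + ‖v‖ ^ 2 * (1 / (2 * L ^ 3)) - ‖v‖ / L ^ 2
        = (L - ‖v‖) ^ 2 / (2 * L ^ 3) := by field_simp; ring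
    linarith
  calc gaussianFilter L v * (‖v‖ / L ^ 2)
      ≤ gaussianFilter L v * ((1 / (2 * L)) + ‖v‖ ^ 2 * (1 / (2 * L ^ 3))) := by gcongr
    _ = gaussianFilter L v * (1 / (2 * L)) + gaussianFilter L v * ‖v‖ ^ 2 * (1 / (2 * L ^ 3)) := by
        ring
    _ ≤ wideGaussian L v * (1 / (2 * L)) + 9 * L ^ 2 * wideGaussian L v * (1 / (2 * L ^ 3)) := by
        gcongr
    _ = 5 / L * wideGaussian L v := by field_simp; ring

lemma wideGaussian_le_weight {R : ℝ} {ζ : Plane} (hζ : ‖ζ‖ ≤ R) (u : Plane) :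
    wideGaussian L (ζ - u)
      ≤ (2 * Real.pi * L ^ 2)⁻¹ * Real.exp ((4 * L ^ 2)⁻¹ * R ^ 2) * gaussianWeight L u := by
  rw [wideGaussian, gaussianWeight, mul_assoc _ (Real.exp _), ← Real.exp_add]
  gcongr
  have h1 : ‖u‖ ≤ ‖ζ‖ + ‖ζ - u‖ := by
    have := norm_sub_le ζ (ζ - u); simpa using this
  have h2 : ‖u‖ ^ 2 ≤ 2 * ‖ζ - u‖ ^ 2 + 2 * R ^ 2 := by
    nlinarith [sq_nonneg (‖ζ‖ - ‖ζ - u‖), norm_nonneg u, norm_nonneg ζ, norm_nonneg (ζ - u)]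
  have e : (8 * L ^ 2)⁻¹ = (4 * L ^ 2)⁻¹ / 2 := by field_simp; norm_num
  have h3 : 0 ≤ (4 * L ^ 2)⁻¹ := by positivity
  rw [e]
  nlinarith [mul_le_mul_of_nonneg_left h2 h3]

lemma abs_testKernel_le {R : ℝ} {ζ : Plane} (hζ : ‖ζ‖ ≤ R) (u : Plane) :
    |testKernel L ζ u| ≤ (4 + 5 * R / L) * wideGaussian L (ζ - u) := by
  have h0 := gaussianFilter_nonneg (L := L) (ζ - u)
  have h0' : 0 ≤ wideGaussian L (ζ - u) := by unfold wideGaussian; positivity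
  have hR : 0 ≤ R := (norm_nonneg _).trans hζ
  have h1 : |inner ℝ ζ (ζ - u) / L ^ 2| ≤ R * (‖ζ - u‖ / L ^ 2) := by
    rw [abs_div, abs_of_pos (a := L ^ 2) (by positivity), ← mul_div_assoc]
    gcongr
    exact (abs_real_inner_le_norm _ _).trans (by gcongr)
  calc |testKernel L ζ u| = gaussianFilter L (ζ - u) * |4 - inner ℝ ζ (ζ - u) / L ^ 2| := by
        rw [testKernel, abs_mul, abs_of_nonneg h0]
    _ ≤ gaussianFilter L (ζ - u) * (4 + R * (‖ζ - u‖ / L ^ 2)) := by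
        gcongr
        refine (abs_sub _ _).trans ?_
        rw [abs_of_pos (by norm_num : (0 : ℝ) < 4)]
        gcongr
    _ = 4 * gaussianFilter L (ζ - u) + R * (gaussianFilter L (ζ - u) * (‖ζ - u‖ / L ^ 2)) := by
        ring
    _ ≤ 4 * wideGaussian L (ζ - u) + R * (5 / L * wideGaussian L (ζ - u)) := by
        exact add_le_add
          (mul_le_mul_of_nonneg_left (gaussianFilter_le_wideGaussian hL _) (by norm_num))
          (mul_le_mul_of_nonneg_left (gaussianFilter_mul_norm_le hL _) hR)
    _ = (4 + 5 * R / L) * wideGaussian L (ζ - u) := by ring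

lemma integrable_wideGaussian : Integrable (wideGaussian L) := by
  unfold wideGaussian
  refine Integrable.const_mul ?_ _
  have h := GaussianFourier.integrable_cexp_neg_mul_sq_norm_add (V := Plane)
    (b := ((4 * L ^ 2)⁻¹ : ℝ)) (by rw [Complex.ofReal_re]; positivity) 0 0
  refine (h.norm).congr (.of_forall fun v => ?_)
  simp only [inner_zero_left, Complex.ofReal_zero, mul_zero, add_zero]
  rw [Complex.norm_exp]
  congr 1
  rw [← Complex.ofReal_neg, ← Complex.ofReal_pow, ← Complex.ofReal_mul, Complex.ofReal_re]

lemma integral_wideGaussian : ∫ v, wideGaussian L v = 2 := by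
  unfold wideGaussian
  rw [integral_const_mul, GaussianFourier.integral_rexp_neg_mul_sq_norm (by positivity)]
  simp only [finrank_euclideanSpace, Fintype.card_fin]
  norm_num
  field_simp
  norm_num

lemma integrable_gaussianFilter : Integrable (gaussianFilter L) :=
  (integrable_wideGaussian hL).mono' continuous_gaussianFilter.aestronglyMeasurable
    (.of_forall fun v => by
      rw [Real.norm_of_nonneg (gaussianFilter_nonneg v)]
      exact gaussianFilter_le_wideGaussian hL v)

lemma integral_gaussianFilter : ∫ v, gaussianFilter L v = 1 := by
  have e : gaussianFilter L
      = fun v => (2 * Real.pi * L ^ 2)⁻¹ * Real.exp (-(2 * L ^ 2)⁻¹ * ‖v‖ ^ 2) := by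
    ext v
    rw [gaussianFilter]
    congr 2
    field_simp
  rw [e, integral_const_mul, GaussianFourier.integral_rexp_neg_mul_sq_norm (by positivity)]
  simp only [finrank_euclideanSpace, Fintype.card_fin]
  norm_num
  field_simp

lemma integrable_mul_testKernel {G : Plane → ℂ} (hGm : AEStronglyMeasurable G)
    (hG : Integrable (fun u => ‖G u‖ * gaussianWeight L u)) (ζ : Plane) :
    Integrable (fun u => G u * (testKernel L ζ u : ℂ)) := by
  have hc' : Continuous fun u => testKernel L ζ u :=
    (continuous_testKernel (L := L)).comp (g := fun p : Plane × Plane => testKernel L p.1 p.2)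
      (f := fun u => (ζ, u)) (by fun_prop)
  have hc : Continuous fun u => (testKernel L ζ u : ℂ) := Complex.continuous_ofReal.comp hc'
  refine (hG.const_mul ((4 + 5 * ‖ζ‖ / L) * ((2 * Real.pi * L ^ 2)⁻¹
    * Real.exp ((4 * L ^ 2)⁻¹ * ‖ζ‖ ^ 2)))).mono'
    (hGm.mul hc.aestronglyMeasurable) (.of_forall fun u => ?_)
  rw [norm_mul, Complex.norm_real, Real.norm_eq_abs]
  calc ‖G u‖ * |testKernel L ζ u| ≤ ‖G u‖ * ((4 + 5 * ‖ζ‖ / L) * ((2 * Real.pi * L ^ 2)⁻¹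
        * Real.exp ((4 * L ^ 2)⁻¹ * ‖ζ‖ ^ 2) * gaussianWeight L u)) := by
        gcongr
        exact (abs_testKernel_le hL le_rfl u).trans
          (mul_le_mul_of_nonneg_left (wideGaussian_le_weight hL le_rfl u) (by positivity))
    _ = _ := by ring

/-- Smoothing followed by `4 + r ∂_r` is integration against the kernel `testKernel L`. -/
lemma smoothDeriv_eq {G : Plane → ℂ} (hGm : AEStronglyMeasurable G)
    (hG : Integrable (fun u => ‖G u‖ * gaussianWeight L u)) (ζ : Plane) :
    smoothDeriv L G ζ = ∫ u, G u * (testKernel L ζ u : ℂ) := by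
  have hsm : ∀ ω, smoothing L G ω = ∫ u, G u * (gaussianFilter L (ω - u) : ℂ) := fun ω => by
    rw [smoothing, ← integral_sub_left_eq_self _ volume ω]
    simp
  have hφ : ∀ (u : Plane) (x : ℝ), HasDerivAt (fun x : ℝ => gaussianFilter L (x • ζ - u))
      (gaussianFilter L (x • ζ - u) * (-(inner ℝ ζ (x • ζ - u) / L ^ 2))) x := fun u x => by
    have h1 : HasDerivAt (fun x : ℝ => x • ζ - u) ζ x := by
      simpa using ((hasDerivAt_id x).smul_const ζ).sub_const u
    have h2 := h1.norm_sq
    have h3 := ((h2.fun_neg.div_const (2 * L ^ 2)).exp).const_mul ((2 * Real.pi * L ^ 2)⁻¹)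
    refine h3.congr_deriv ?_
    rw [gaussianFilter, real_inner_comm ζ]
    field_simp
  have hint : ∀ ξ : Plane, Integrable (fun u => G u * (gaussianFilter L (ξ - u) : ℂ)) := fun ξ => by
    refine (hG.const_mul ((2 * Real.pi * L ^ 2)⁻¹
      * Real.exp ((4 * L ^ 2)⁻¹ * ‖ξ‖ ^ 2))).mono' (hGm.mul (Complex.continuous_ofReal.comp
      (continuous_gaussianFilter.comp (continuous_const.sub continuous_id))).aestronglyMeasurable)
      (.of_forall fun u => ?_)
    rw [norm_mul, Complex.norm_real, Real.norm_of_nonneg (gaussianFilter_nonneg _)]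
    calc ‖G u‖ * gaussianFilter L (ξ - u) ≤ ‖G u‖ * ((2 * Real.pi * L ^ 2)⁻¹
          * Real.exp ((4 * L ^ 2)⁻¹ * ‖ξ‖ ^ 2) * gaussianWeight L u) := by
          gcongr
          exact (gaussianFilter_le_wideGaussian hL _).trans (wideGaussian_le_weight hL le_rfl u)
      _ = _ := by ring
  have hcd : ∀ x : ℝ, Continuous fun u : Plane =>
      gaussianFilter L (x • ζ - u) * (-(inner ℝ ζ (x • ζ - u) / L ^ 2)) := fun x => by
    have := continuous_gaussianFilter (L := L)
    fun_prop
  have hderiv := hasDerivAt_integral_of_dominated_loc_of_deriv_le (μ := volume)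
    (F := fun (x : ℝ) u => G u * (gaussianFilter L (x • ζ - u) : ℂ))
    (F' := fun (x : ℝ) u => G u
      * ((gaussianFilter L (x • ζ - u) * (-(inner ℝ ζ (x • ζ - u) / L ^ 2)) : ℝ) : ℂ))
    (x₀ := 1) (s := Metric.ball 1 1)
    (bound := fun u => ‖ζ‖ * (5 / L * ((2 * Real.pi * L ^ 2)⁻¹
      * Real.exp ((4 * L ^ 2)⁻¹ * (2 * ‖ζ‖) ^ 2))) * (‖G u‖ * gaussianWeight L u))
    (Metric.ball_mem_nhds _ one_pos) (.of_forall fun x => (hint _).1) (hint _)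
    (hGm.mul (Complex.continuous_ofReal.comp (hcd 1)).aestronglyMeasurable)
    (.of_forall fun u x hx => ?_) (hG.const_mul _)
    (.of_forall fun u x _ => ((hφ u x).ofReal_comp).const_mul (G u))
  · have hr : rDeriv (smoothing L G) ζ = ∫ u, G u * ((gaussianFilter L ((1 : ℝ) • ζ - u)
        * (-(inner ℝ ζ ((1 : ℝ) • ζ - u) / L ^ 2)) : ℝ) : ℂ) := by
      rw [rDeriv]
      simp_rw [hsm]
      exact hderiv.2.deriv
    rw [smoothDeriv, hr, hsm, ← integral_const_mul, ← integral_add ((hint ζ).const_mul 4) hderiv.1]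
    refine integral_congr_ae (.of_forall fun u => ?_)
    simp only [one_smul, testKernel]
    push_cast
    ring
  · have hx2 : |x| ≤ 2 := by
      rw [Metric.mem_ball, Real.dist_eq, abs_lt] at hx
      rw [abs_le]; constructor <;> linarith [hx.1, hx.2]
    have hxζ : ‖x • ζ‖ ≤ 2 * ‖ζ‖ := by
      rw [norm_smul, Real.norm_eq_abs]; gcongr
    have h0 := gaussianFilter_nonneg (L := L) (x • ζ - u)
    rw [norm_mul, Complex.norm_real, norm_mul, norm_neg, Real.norm_of_nonneg h0, norm_div,
      Real.norm_of_nonneg (by positivity : 0 ≤ L ^ 2)]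
    calc ‖G u‖ * (gaussianFilter L (x • ζ - u) * (‖inner ℝ ζ (x • ζ - u)‖ / L ^ 2))
        ≤ ‖G u‖ * (gaussianFilter L (x • ζ - u) * (‖ζ‖ * ‖x • ζ - u‖ / L ^ 2)) := by
          gcongr
          exact norm_inner_le_norm _ _
      _ = ‖G u‖ * (‖ζ‖ * (gaussianFilter L (x • ζ - u) * (‖x • ζ - u‖ / L ^ 2))) := by ring
      _ ≤ ‖G u‖ * (‖ζ‖ * (5 / L * ((2 * Real.pi * L ^ 2)⁻¹
          * Real.exp ((4 * L ^ 2)⁻¹ * (2 * ‖ζ‖) ^ 2) * gaussianWeight L u))) := by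
          refine mul_le_mul_of_nonneg_left (mul_le_mul_of_nonneg_left ?_ (norm_nonneg _))
            (norm_nonneg _)
          exact (gaussianFilter_mul_norm_le hL _).trans
            (mul_le_mul_of_nonneg_left (wideGaussian_le_weight hL hxζ u) (by positivity))
      _ = _ := by ring

end Kernel

/-! ### Smoothing bias and dilation unbiasing -/

section SecondDifference

variable {E F : Type*} [NormedAddCommGroup E] [NormedSpace ℝ E] [NormedAddCommGroup F]
  [NormedSpace ℝ F]

lemma norm_fderiv_fderiv (G : E → F) (x : E) :
    ‖fderiv ℝ (fderiv ℝ G) x‖ = ‖iteratedFDeriv ℝ 2 G x‖ := by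
  rw [← norm_iteratedFDeriv_one, norm_iteratedFDeriv_fderiv]

lemma norm_second_difference_le {G : E → F} (hG : ContDiff ℝ 2 G) {K : ℝ}
    (hK : ∀ x, ‖iteratedFDeriv ℝ 2 G x‖ ≤ K) (x v : E) :
    ‖G (x + v) + G (x - v) - (2 : ℝ) • G x‖ ≤ 2 * K * ‖v‖ ^ 2 := by
  have hdiff : Differentiable ℝ G := hG.differentiable (by norm_num)
  have hdiff' : Differentiable ℝ (fderiv ℝ G) :=
    (hG.fderiv_right (m := 1) (by norm_num)).differentiable (by norm_num)
  have hK0 : 0 ≤ K := (norm_nonneg _).trans (hK x)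
  have hlip : ∀ y z, ‖fderiv ℝ G z - fderiv ℝ G y‖ ≤ K * ‖z - y‖ := fun y z =>
    convex_univ.norm_image_sub_le_of_norm_fderiv_le (fun w _ => hdiff' w)
      (fun w _ => (norm_fderiv_fderiv G w).le.trans (hK w)) (Set.mem_univ _) (Set.mem_univ _)
  have hr : ∀ y, HasFDerivAt (fun y => G (x + y) + G (x - y))
      (fderiv ℝ G (x + y) - fderiv ℝ G (x - y)) y := fun y => by
    have h1 : HasFDerivAt (fun y => G (x + y)) (fderiv ℝ G (x + y)) y := by
      have := (hdiff (x + y)).hasFDerivAt.comp y ((hasFDerivAt_id y).const_add x)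
      exact this.congr_fderiv (ContinuousLinearMap.comp_id _)
    have h2 : HasFDerivAt (fun y => G (x - y)) (-fderiv ℝ G (x - y)) y := by
      have := (hdiff (x - y)).hasFDerivAt.comp y ((hasFDerivAt_id y).const_sub x)
      refine this.congr_fderiv ?_
      ext w; simp
    exact (h1.add h2).congr_fderiv (sub_eq_add_neg _ _).symm
  have h := (convex_closedBall (0 : E) ‖v‖).norm_image_sub_le_of_norm_hasFDerivWithin_le
    (C := 2 * K * ‖v‖) (fun y _ => (hr y).hasFDerivWithinAt) (fun y hy => ?_)
    (Metric.mem_closedBall_self (norm_nonneg v)) (mem_closedBall_zero_iff.2 le_rfl)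
  · rw [add_zero, sub_zero, sub_zero, ← two_smul ℝ (G x)] at h
    rw [pow_two, ← mul_assoc]
    exact h
  · refine (hlip _ _).trans ?_
    have e : x + y - (x - y) = (2 : ℝ) • y := by rw [two_smul]; abel
    rw [e, norm_smul, Real.norm_ofNat]
    have := mem_closedBall_zero_iff.1 hy
    nlinarith

end SecondDifference

section Bias

variable {B : Plane → ℂ}

/-- The function `s ↦ ∂_s (s⁴ B(sζ)) = (4 + r∂_r) [s³ B(s ·)] (ζ)`. -/
noncomputable def dilationProfile (B : Plane → ℂ) (ζ : Plane) (s : ℝ) : ℂ :=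
  (s : ℂ) ^ 3 * (4 * B (s • ζ) + s * fderiv ℝ B (s • ζ) ζ)

lemma hasDerivAt_comp_smul {F : Type*} [NormedAddCommGroup F] [NormedSpace ℝ F] {G : Plane → F}
    (hG : Differentiable ℝ G) (ζ : Plane) (s : ℝ) :
    HasDerivAt (fun s : ℝ => G (s • ζ)) (fderiv ℝ G (s • ζ) ζ) s := by
  have h1 : HasDerivAt (fun s : ℝ => s • ζ) ζ s := by
    simpa using (hasDerivAt_id s).smul_const ζ
  exact (hG _).hasFDerivAt.comp_hasDerivAt s h1

lemma hasDerivAt_dilationProfile (hB : Differentiable ℝ B) (ζ : Plane) (s : ℝ) :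
    HasDerivAt (fun s : ℝ => (s : ℂ) ^ 4 * B (s • ζ)) (dilationProfile B ζ s) s := by
  have h1 : HasDerivAt (fun s : ℝ => (s : ℂ) ^ 4) (4 * (s : ℂ) ^ 3) s := by
    have := (hasDerivAt_pow 4 (s : ℂ)).comp_ofReal
    simpa using this
  refine (h1.mul (hasDerivAt_comp_smul hB ζ s)).congr_deriv ?_
  rw [dilationProfile]
  ring

lemma BoundedC3.norm_le (hB : BoundedC3 B) :
    ∃ C : ℝ, 0 ≤ C ∧ (∀ x, ‖B x‖ ≤ C) ∧ (∀ x, ‖fderiv ℝ B x‖ ≤ C)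
      ∧ (∀ x, ‖iteratedFDeriv ℝ 2 B x‖ ≤ C)
      ∧ ∀ x, ‖iteratedFDeriv ℝ 2 (fderiv ℝ B) x‖ ≤ C := by
  obtain ⟨-, C, hC⟩ := hB
  refine ⟨C, (norm_nonneg _).trans (hC 0 (by norm_num) 0), fun x => ?_, fun x => ?_,
    hC 2 (by norm_num), fun x => ?_⟩
  · rw [← norm_iteratedFDeriv_zero (𝕜 := ℝ) (f := B)]
    exact hC 0 (by norm_num) x
  · rw [← norm_iteratedFDeriv_one]
    exact hC 1 (by norm_num) x
  · rw [norm_iteratedFDeriv_fderiv]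
    exact hC 3 (by norm_num) x

lemma continuous_dilationProfile (hB : BoundedC3 B) :
    Continuous fun p : Plane × ℝ => dilationProfile B p.1 p.2 := by
  have h1 := hB.1.continuous
  have h2 : Continuous (fderiv ℝ B) := hB.1.continuous_fderiv (by norm_num)
  unfold dilationProfile
  fun_prop

/-- The profile `s ↦ ∂_s (s⁴ B(sζ))` is Lipschitz, uniformly for `ζ` in a ball. -/
lemma exists_lipschitz_dilationProfile (hB : BoundedC3 B) (R : ℝ) :
    ∃ K : ℝ, 0 ≤ K ∧ ∀ ζ : Plane, ‖ζ‖ ≤ R → ∀ s ∈ Set.Icc (1 / 2 : ℝ) (3 / 2),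
      ∀ s' ∈ Set.Icc (1 / 2 : ℝ) (3 / 2),
        ‖dilationProfile B ζ s - dilationProfile B ζ s'‖ ≤ K * |s - s'| := by
  obtain ⟨C, hC0, c0, c1, c2, -⟩ := hB.norm_le
  have hd1 : Differentiable ℝ B := hB.1.differentiable (by norm_num)
  have hd2 : Differentiable ℝ (fderiv ℝ B) :=
    (hB.1.fderiv_right (m := 2) (by norm_num)).differentiable (by norm_num)
  refine ⟨128 * C * (1 + |R|) ^ 2, by positivity, fun ζ hζ s hs s' hs' => ?_⟩
  have hζ' : ‖ζ‖ ≤ |R| := hζ.trans (le_abs_self R)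
  have hder : ∀ x : ℝ, HasDerivAt (dilationProfile B ζ)
      (3 * (x : ℂ) ^ 2 * (4 * B (x • ζ) + x * fderiv ℝ B (x • ζ) ζ) + (x : ℂ) ^ 3
        * (4 * fderiv ℝ B (x • ζ) ζ + (fderiv ℝ B (x • ζ) ζ
          + x * fderiv ℝ (fderiv ℝ B) (x • ζ) ζ ζ))) x := fun x => by
    have h1 : HasDerivAt (fun s : ℝ => (s : ℂ) ^ 3) (3 * (x : ℂ) ^ 2) x := by
      have := (hasDerivAt_pow 3 (x : ℂ)).comp_ofReal
      simpa using this
    have h2 := hasDerivAt_comp_smul hd1 ζ x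
    have h3 : HasDerivAt (fun s : ℝ => fderiv ℝ B (s • ζ) ζ)
        (fderiv ℝ (fderiv ℝ B) (x • ζ) ζ ζ) x := by
      have := (hasDerivAt_comp_smul hd2 ζ x).clm_apply (hasDerivAt_const x ζ)
      simpa using this
    have h4 : HasDerivAt (fun s : ℝ => (s : ℂ)) 1 x := (hasDerivAt_id (x : ℂ)).comp_ofReal
    exact (h1.mul ((h2.const_mul 4).add (h4.mul h3))).congr_deriv (by simp)
  rw [← Real.norm_eq_abs]
  refine (convex_Icc (1 / 2 : ℝ) (3 / 2)).norm_image_sub_le_of_norm_hasDerivWithin_le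
    (fun x _ => (hder x).hasDerivWithinAt) (fun x hx => ?_) hs' hs
  have hx0 : 0 ≤ x := by linarith [hx.1]
  have hx2 : x ≤ 3 / 2 := hx.2
  set r := 1 + |R| with hr
  have hr1 : 1 ≤ r := by simp [hr]
  have hζr : ‖ζ‖ ≤ r := by linarith
  have b1 : ‖fderiv ℝ B (x • ζ) ζ‖ ≤ C * r :=
    (ContinuousLinearMap.le_opNorm _ _).trans (mul_le_mul (c1 _) hζr (norm_nonneg _) hC0)
  have b2 : ‖fderiv ℝ (fderiv ℝ B) (x • ζ) ζ ζ‖ ≤ C * r * r := by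
    refine (ContinuousLinearMap.le_opNorm _ _).trans
      (mul_le_mul ?_ hζr (norm_nonneg _) (by positivity))
    refine (ContinuousLinearMap.le_opNorm _ _).trans (mul_le_mul ?_ hζr (norm_nonneg _) hC0)
    exact (norm_fderiv_fderiv B _).le.trans (c2 _)
  have nx : ‖(x : ℂ)‖ = x := by rw [Complex.norm_real, Real.norm_of_nonneg hx0]
  have n4 : ‖(4 : ℂ)‖ = 4 := by simp
  have n3 : ‖(3 : ℂ)‖ = 3 := by simp
  have hCr : C ≤ C * r ^ 2 := le_mul_of_one_le_right hC0 (one_le_pow₀ hr1)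
  have hCr' : C * r ≤ C * r ^ 2 := by
    rw [pow_two, ← mul_assoc]; exact le_mul_of_one_le_right (by positivity) hr1
  calc _ ≤ 3 * x ^ 2 * (4 * C + x * (C * r)) + x ^ 3 * (4 * (C * r) + (C * r + x * (C * r * r))) := by
        refine (norm_add_le _ _).trans (add_le_add ?_ ?_)
        · rw [norm_mul, norm_mul, norm_pow, nx, n3]
          refine mul_le_mul_of_nonneg_left ((norm_add_le _ _).trans (add_le_add ?_ ?_))
            (by positivity)
          · rw [norm_mul, n4]; exact mul_le_mul_of_nonneg_left (c0 _) (by norm_num)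
          · rw [norm_mul, nx]; exact mul_le_mul_of_nonneg_left b1 hx0
        · rw [norm_mul, norm_pow, nx]
          refine mul_le_mul_of_nonneg_left ((norm_add_le _ _).trans (add_le_add ?_
            ((norm_add_le _ _).trans (add_le_add b1 ?_)))) (by positivity)
          · rw [norm_mul, n4]; exact mul_le_mul_of_nonneg_left b1 (by norm_num)
          · rw [norm_mul, nx]; exact mul_le_mul_of_nonneg_left b2 hx0
    _ ≤ 3 * x ^ 2 * (4 * (C * r ^ 2) + x * (C * r ^ 2))
        + x ^ 3 * (4 * (C * r ^ 2) + (C * r ^ 2 + x * (C * r ^ 2))) := by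
        have e : C * r * r = C * r ^ 2 := by ring
        rw [e]
        gcongr
    _ = (12 * x ^ 2 + 8 * x ^ 3 + x ^ 4) * (C * r ^ 2) := by ring
    _ ≤ (12 * 2 ^ 2 + 8 * 2 ^ 3 + 2 ^ 4) * (C * r ^ 2) := by
        gcongr <;> linarith
    _ = 128 * C * r ^ 2 := by ring

/-- The bias of Gaussian smoothing of width `L` is of order `L²`, because the filter is even. -/
lemma exists_smoothing_bias (hB : BoundedC3 B) (R : ℝ) :
    ∃ K : ℝ, 0 ≤ K ∧ ∀ ζ : Plane, ‖ζ‖ ≤ R → ∀ s ∈ Set.Icc (1 / 2 : ℝ) (3 / 2), ∀ L : ℝ, 0 < L →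
      ‖smoothDeriv L (fun ω => ((s ^ 3 : ℝ) : ℂ) * B (s • ω)) ζ - dilationProfile B ζ s‖
        ≤ K * L ^ 2 := by
  obtain ⟨C, hC0, c0, c1, c2, c3⟩ := hB.norm_le
  have hd1 : Differentiable ℝ B := hB.1.differentiable (by norm_num)
  have hcf : Continuous (fderiv ℝ B) := hB.1.continuous_fderiv (by norm_num)
  have hcB : Continuous B := hB.1.continuous
  refine ⟨9 * 256 * C * (1 + |R|), by positivity, fun ζ hζ s hs L hL => ?_⟩
  have hζ' : ‖ζ‖ ≤ |R| := hζ.trans (le_abs_self R)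
  have hs0 : 0 ≤ s := by linarith [hs.1]
  have hs2 : s ≤ 2 := by linarith [hs.2]
  have ns : ‖(s : ℂ)‖ = s := by rw [Complex.norm_real, Real.norm_of_nonneg hs0]
  have n4 : ‖(4 : ℂ)‖ = 4 := by simp
  let q : Plane → ℂ := fun v =>
    (s : ℂ) ^ 3 * (4 * B (s • (ζ - v)) + s * fderiv ℝ B (s • (ζ - v)) ζ)
  have hqc : Continuous q := by fun_prop
  have hφ := integrable_gaussianFilter hL
  have hφc := continuous_gaussianFilter (L := L)
  have hφC : Integrable fun v => (gaussianFilter L v : ℂ) := hφ.ofReal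
  have hbdd : ∀ {g : Plane → ℂ} (_ : Continuous g) {K : ℝ} (_ : ∀ v, ‖g v‖ ≤ K),
      Integrable fun v => g v * (gaussianFilter L v : ℂ) := fun hg K hK =>
    hφC.bdd_mul hg.aestronglyMeasurable (.of_forall hK)
  have hB3 : ∀ ξ : Plane, Integrable fun v =>
      ((s ^ 3 : ℝ) : ℂ) * B (s • (ξ - v)) * (gaussianFilter L v : ℂ) := fun ξ => by
    refine hbdd (g := fun v => ((s ^ 3 : ℝ) : ℂ) * B (s • (ξ - v))) (by fun_prop)
      (K := ‖((s ^ 3 : ℝ) : ℂ)‖ * C) fun v => ?_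
    rw [norm_mul]; gcongr; exact c0 _
  have hqb : ∀ v, ‖q v‖ ≤ s ^ 3 * (4 * C + s * (C * ‖ζ‖)) := fun v => by
    simp only [q]
    rw [norm_mul, norm_pow, ns]
    refine mul_le_mul_of_nonneg_left ((norm_add_le _ _).trans (add_le_add ?_ ?_)) (by positivity)
    · rw [norm_mul, n4]; exact mul_le_mul_of_nonneg_left (c0 _) (by norm_num)
    · rw [norm_mul, ns]
      refine mul_le_mul_of_nonneg_left ?_ hs0
      exact (ContinuousLinearMap.le_opNorm _ _).trans (by gcongr; exact c1 _)
  -- differentiate under the integral sign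
  have hderiv := hasDerivAt_integral_of_dominated_loc_of_deriv_le (μ := volume)
    (F := fun (x : ℝ) v => ((s ^ 3 : ℝ) : ℂ) * B (s • (x • ζ - v)) * (gaussianFilter L v : ℂ))
    (F' := fun (x : ℝ) v => ((s ^ 3 : ℝ) : ℂ) * (s * fderiv ℝ B (s • (x • ζ - v)) ζ)
      * (gaussianFilter L v : ℂ))
    (x₀ := 1) (s := Set.univ)
    (bound := fun v => s ^ 3 * (s * (C * ‖ζ‖)) * gaussianFilter L v)
    Filter.univ_mem (.of_forall fun x => (hB3 _).1) (hB3 _)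
    (by apply Continuous.aestronglyMeasurable; fun_prop)
    (.of_forall fun v x _ => ?_) (hφ.const_mul _)
    (.of_forall fun v x _ => ?_)
  rotate_left
  · rw [norm_mul, norm_mul, norm_mul, ns, Complex.norm_real, Complex.norm_real,
      Real.norm_of_nonneg (gaussianFilter_nonneg v), Real.norm_of_nonneg (pow_nonneg hs0 3)]
    refine mul_le_mul_of_nonneg_right (mul_le_mul_of_nonneg_left
      (mul_le_mul_of_nonneg_left ?_ hs0) (by positivity)) (gaussianFilter_nonneg v)
    exact (ContinuousLinearMap.le_opNorm _ _).trans (by gcongr; exact c1 _)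
  · have h1 : HasDerivAt (fun x : ℝ => s • (x • ζ - v)) (s • ζ) x := by
      simpa using (((hasDerivAt_id x).smul_const ζ).sub_const v).fun_const_smul s
    have h2 := (hd1 _).hasFDerivAt.comp_hasDerivAt x h1
    have h3 := (h2.const_mul ((s ^ 3 : ℝ) : ℂ)).mul_const (gaussianFilter L v : ℂ)
    refine h3.congr_deriv ?_
    rw [map_smul, Complex.real_smul]
  have hsd : smoothDeriv L (fun ω => ((s ^ 3 : ℝ) : ℂ) * B (s • ω)) ζ
      = ∫ v, q v * (gaussianFilter L v : ℂ) := by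
    rw [smoothDeriv, rDeriv]
    simp only [smoothing]
    rw [hderiv.2.deriv, ← integral_const_mul, ← integral_add ((hB3 ζ).const_mul 4) hderiv.1]
    refine integral_congr_ae (.of_forall fun v => ?_)
    simp only [q, one_smul]
    push_cast
    ring
  have hq0 : q 0 = dilationProfile B ζ s := by simp [q, dilationProfile]
  have hI := hbdd hqc hqb
  have hIneg : Integrable fun v => q (-v) * (gaussianFilter L v : ℂ) :=
    hbdd (hqc.comp continuous_neg) fun v => hqb (-v)
  have heven : ∫ v, q (-v) * (gaussianFilter L v : ℂ) = ∫ v, q v * (gaussianFilter L v : ℂ) := by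
    rw [← integral_neg_eq_self (fun v => q v * (gaussianFilter L v : ℂ))]
    simp only [gaussianFilter, norm_neg]
  have hone : ∫ v, q 0 * (gaussianFilter L v : ℂ) = q 0 := by
    rw [integral_const_mul, integral_complex_ofReal, integral_gaussianFilter hL,
      Complex.ofReal_one, mul_one]
  have hsym : smoothDeriv L (fun ω => ((s ^ 3 : ℝ) : ℂ) * B (s • ω)) ζ - dilationProfile B ζ s
      = (1 / 2) * ∫ v, (q v + q (-v) - 2 * q 0) * (gaussianFilter L v : ℂ) := by
    have e : ∀ v, (q v + q (-v) - 2 * q 0) * (gaussianFilter L v : ℂ)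
        = q v * (gaussianFilter L v : ℂ) + q (-v) * (gaussianFilter L v : ℂ)
          - 2 * (q 0 * (gaussianFilter L v : ℂ)) := fun v => by ring
    have hI2 : Integrable fun v => q v * (gaussianFilter L v : ℂ)
        + q (-v) * (gaussianFilter L v : ℂ) := hI.add hIneg
    simp_rw [e]
    rw [integral_sub hI2 ((hφC.const_mul (q 0)).const_mul 2), integral_add hI hIneg, heven,
      integral_const_mul, hone, hsd, hq0]
    ring
  have hdiff : ∀ v, ‖q v + q (-v) - 2 * q 0‖ ≤ 256 * C * (1 + |R|) * ‖v‖ ^ 2 := fun v => by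
    have h1 := norm_second_difference_le (hB.1.of_le (by norm_num)) c2 (s • ζ) (s • v)
    have h2 := norm_second_difference_le (hB.1.fderiv_right (m := 2) (by norm_num)) c3 (s • ζ)
      (s • v)
    rw [norm_smul, Real.norm_of_nonneg hs0] at h1 h2
    have e : q v + q (-v) - 2 * q 0 = (s : ℂ) ^ 3
        * (4 * (B (s • ζ + s • v) + B (s • ζ - s • v) - (2 : ℝ) • B (s • ζ))
          + s * (fderiv ℝ B (s • ζ + s • v) + fderiv ℝ B (s • ζ - s • v)
            - (2 : ℝ) • fderiv ℝ B (s • ζ)) ζ) := by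
      simp only [q, smul_sub, smul_neg, smul_zero, sub_zero, sub_neg_eq_add,
        sub_apply, add_apply, smul_apply, Complex.real_smul]
      push_cast
      ring
    rw [e, norm_mul, norm_pow, ns]
    calc _ ≤ s ^ 3 * (4 * (2 * C * (s * ‖v‖) ^ 2) + s * (2 * C * (s * ‖v‖) ^ 2 * ‖ζ‖)) := by
          refine mul_le_mul_of_nonneg_left ((norm_add_le _ _).trans (add_le_add ?_ ?_))
            (by positivity)
          · rw [norm_mul, n4]; exact mul_le_mul_of_nonneg_left h1 (by norm_num)
          · rw [norm_mul, ns]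
            refine mul_le_mul_of_nonneg_left ?_ hs0
            exact (ContinuousLinearMap.le_opNorm _ _).trans
              (mul_le_mul_of_nonneg_right h2 (norm_nonneg _))
      _ = (8 * s ^ 5 + 2 * s ^ 6 * ‖ζ‖) * (C * ‖v‖ ^ 2) := by ring
      _ ≤ (8 * 2 ^ 5 + 2 * 2 ^ 6 * |R|) * (C * ‖v‖ ^ 2) := by gcongr
      _ ≤ (256 * (1 + |R|)) * (C * ‖v‖ ^ 2) := by
          gcongr
          nlinarith [abs_nonneg R]
      _ = 256 * C * (1 + |R|) * ‖v‖ ^ 2 := by ring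
  rw [hsym, norm_mul]
  have hb : ‖∫ v, (q v + q (-v) - 2 * q 0) * (gaussianFilter L v : ℂ)‖
      ≤ ∫ v, 256 * C * (1 + |R|) * (9 * L ^ 2 * wideGaussian L v) := by
    refine norm_integral_le_of_norm_le (((integrable_wideGaussian hL).const_mul _).const_mul _)
      (.of_forall fun v => ?_)
    rw [norm_mul, Complex.norm_real, Real.norm_of_nonneg (gaussianFilter_nonneg v)]
    calc _ ≤ 256 * C * (1 + |R|) * ‖v‖ ^ 2 * gaussianFilter L v :=
          mul_le_mul_of_nonneg_right (hdiff v) (gaussianFilter_nonneg v)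
      _ = 256 * C * (1 + |R|) * (gaussianFilter L v * ‖v‖ ^ 2) := by ring
      _ ≤ _ := mul_le_mul_of_nonneg_left (gaussianFilter_mul_sq_le hL v) (by positivity)
  rw [integral_const_mul, integral_const_mul, integral_wideGaussian hL] at hb
  have : ‖(1 / 2 : ℂ)‖ = 1 / 2 := by simp
  rw [this]
  nlinarith

end Bias

section Unbiasing

lemma eta_bounds {η : ℝ} (h0 : 0 < η) (h : η ^ 2 ≤ 1 / 12) : 0 < √3 * η ∧ √3 * η ≤ 1 / 2 := by
  have h3 : (0 : ℝ) < √3 := by positivity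
  refine ⟨by positivity, ?_⟩
  refine abs_le_of_sq_le_sq' ?_ (by norm_num) |>.2
  rw [mul_pow, Real.sq_sqrt (by norm_num)]
  linarith

/-- The mean over `s ∈ [1 - √3η, 1 + √3η]` of `dilationProfile B ζ s`. -/
noncomputable def meanProfile (η : ℝ) (B : Plane → ℂ) (ζ : Plane) : ℂ :=
  ((constC1 η : ℝ) : ℂ)⁻¹ * (((1 + √3 * η) ^ 4 : ℝ) * B ((1 + √3 * η) • ζ)
    - ((1 - √3 * η) ^ 4 : ℝ) * B ((1 - √3 * η) • ζ))

variable {η : ℝ} (h0 : 0 < η) (h : η ^ 2 ≤ 1 / 12)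
include h0 h

lemma constC0_bounds : 0 ≤ constC0 η ∧ constC0 η < 1 := by
  obtain ⟨h1, h2⟩ := eta_bounds h0 h
  unfold constC0
  exact ⟨div_nonneg (by linarith) (by linarith), (div_lt_one (by linarith)).2 (by linarith)⟩

lemma constC2_bounds : 0 ≤ constC2 η ∧ constC2 η ≤ 1 := by
  obtain ⟨h1, h2⟩ := eta_bounds h0 h
  unfold constC2
  exact ⟨by positivity, (div_le_one (by linarith)).2 (by linarith)⟩

lemma constC1_pos : 0 < constC1 η := by
  obtain ⟨h1, h2⟩ := eta_bounds h0 h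
  unfold constC1
  nlinarith

/-- The mass of the Neumann series stays bounded as `η → 0`: the small factor `C₁` compensates
`(1 - C₀⁴)⁻¹`. -/
lemma tsum_weights_le :
    ∑' k : ℕ, (constC0 η ^ 4) ^ k * (constC1 η * constC2 η ^ 4) ≤ 2 := by
  obtain ⟨h1, h2⟩ := eta_bounds h0 h
  obtain ⟨a0, a1⟩ := constC0_bounds h0 h
  obtain ⟨b0, b1⟩ := constC2_bounds h0 h
  have h4 : constC0 η ^ 4 < 1 := pow_lt_one₀ a0 a1 (by norm_num)
  rw [tsum_mul_right, tsum_geometric_of_lt_one (by positivity) h4]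
  have e1 : constC0 η ^ 4 ≤ constC0 η := by
    calc constC0 η ^ 4 ≤ constC0 η ^ 1 := pow_le_pow_of_le_one a0 a1.le (by norm_num)
      _ = _ := pow_one _
  have e2 : constC2 η ^ 4 ≤ 1 := pow_le_one₀ b0 b1
  have e3 : constC1 η = (1 + √3 * η) * (1 - constC0 η) := by
    unfold constC1 constC0
    field_simp
    ring
  rw [inv_mul_le_iff₀ (by linarith)]
  have c1 := constC1_pos h0 h
  calc constC1 η * constC2 η ^ 4 ≤ constC1 η * 1 := by gcongr
    _ = (1 + √3 * η) * (1 - constC0 η) := by rw [mul_one, e3]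
    _ ≤ 2 * (1 - constC0 η ^ 4) := mul_le_mul (by linarith) (by linarith) (by linarith) (by norm_num)
    _ = _ := by ring

lemma summable_weights :
    Summable fun k : ℕ => (constC0 η ^ 4) ^ k * (constC1 η * constC2 η ^ 4) := by
  obtain ⟨a0, a1⟩ := constC0_bounds h0 h
  exact (summable_geometric_of_lt_one (by positivity)
    (pow_lt_one₀ a0 a1 (by norm_num))).mul_right _

omit h0 h in
lemma dilationUnbias_term (η : ℝ) (D : Plane → ℂ) (k : ℕ) (ω : Plane) :
    (dilation (constC0 η))^[k] (fun ω => (constC1 η : ℂ) * dilation (constC2 η) D ω) ω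
      = (((constC0 η ^ 4) ^ k * (constC1 η * constC2 η ^ 4) : ℝ) : ℂ)
        * D ((constC2 η * constC0 η ^ k) • ω) := by
  rw [dilation_iterate, dilation, smul_smul]
  push_cast
  ring

/-- Dilation unbiasing recovers the bispectrum from the mean of its dilates. -/
lemma tsum_meanProfile {B : Plane → ℂ} {K : ℝ} (hB : ∀ x, ‖B x‖ ≤ K) (ω : Plane) :
    B ω = ∑' k : ℕ, (((constC0 η ^ 4) ^ k * (constC1 η * constC2 η ^ 4) : ℝ) : ℂ)
      * meanProfile η B ((constC2 η * constC0 η ^ k) • ω) := by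
  obtain ⟨h1, h2⟩ := eta_bounds h0 h
  obtain ⟨a0, a1⟩ := constC0_bounds h0 h
  have c1 := constC1_pos h0 h
  have key := eq_invIdSubDilation a0 a1 (u := B) (ω := ω)
    (G := fun ω => (constC1 η : ℂ) * dilation (constC2 η) (meanProfile η B) ω) (K := K)
    (fun ζ _ => hB ζ) fun ζ _ => by
      have e1 : (1 + √3 * η) * constC2 η = 1 := by
        unfold constC2; field_simp
      have e2 : (1 - √3 * η) * constC2 η = constC0 η := by
        unfold constC2 constC0; field_simp
      have hc : ((constC1 η : ℝ) : ℂ) ≠ 0 := by exact_mod_cast c1.ne'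
      rw [dilation, dilation, meanProfile, smul_smul, smul_smul, e1, e2, one_smul]
      have e3 : ((constC2 η ^ 4 : ℝ) : ℂ) * ((1 + √3 * η) ^ 4 : ℝ) = 1 := by
        rw [← Complex.ofReal_mul, ← mul_pow, mul_comm (constC2 η), e1]; simp
      have e4 : ((constC2 η ^ 4 : ℝ) : ℂ) * ((1 - √3 * η) ^ 4 : ℝ) = ((constC0 η ^ 4 : ℝ) : ℂ) := by
        rw [← Complex.ofReal_mul, ← mul_pow, mul_comm (constC2 η), e2]
      rw [mul_left_comm, mul_inv_cancel_left₀ hc, mul_sub, ← mul_assoc, ← mul_assoc, e3, e4,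
        one_mul]
  rw [key, invIdSubDilation]
  simp_rw [dilationUnbias_term]

omit h0 h in
lemma dilationUnbias_smoothing (η L : ℝ) (G : Plane → ℂ) (ω : Plane) :
    dilationUnbias η (smoothing L G) ω
      = ∑' k : ℕ, (((constC0 η ^ 4) ^ k * (constC1 η * constC2 η ^ 4) : ℝ) : ℂ)
        * smoothDeriv L G ((constC2 η * constC0 η ^ k) • ω) := by
  rw [dilationUnbias, invIdSubDilation]
  simp_rw [dilationUnbias_term]
  rfl

end Unbiasing

/-! ### Integral bounds for the noise covariances -/

section Covariance

open scoped ENNReal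

lemma continuous_freq (i : Fin 3) : Continuous (freq i) := by
  unfold freq
  fin_cases i <;> simp <;> fun_prop

lemma lintegral_plane {Φ : ℝ × ℝ → ℝ≥0∞} (hΦ : Measurable Φ) :
    ∫⁻ ω : Plane, Φ (ω 0, ω 1) = ∫⁻ x, ∫⁻ y, Φ (x, y) := by
  have h1 := (PiLp.volume_preserving_ofLp (Fin 2)).lintegral_comp
    (hΦ.comp (MeasurableEquiv.finTwoArrow (α := ℝ)).measurable)
  have h2 := (volume_preserving_finTwoArrow ℝ).lintegral_comp hΦ
  have h3 : ∫⁻ p, Φ p = ∫⁻ x, ∫⁻ y, Φ (x, y) :=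
    lintegral_prod Φ hΦ.aemeasurable
  rw [← h3, ← h2]
  exact h1

/-- Any two of the three frequencies are unimodular coordinates of the plane. -/
lemma lintegral_freq_mul_freq {g k : ℝ → ℝ≥0∞} (hg : Measurable g) (hk : Measurable k)
    {i j : Fin 3} (hij : i ≠ j) :
    ∫⁻ ω : Plane, g (freq i ω) * k (freq j ω) = (∫⁻ x, g x) * ∫⁻ x, k x := by
  have key : ∀ {g k : ℝ → ℝ≥0∞} (hg : Measurable g) (hk : Measurable k) {i j : Fin 3}, i < j →
      ∫⁻ ω : Plane, g (freq i ω) * k (freq j ω) = (∫⁻ x, g x) * ∫⁻ x, k x := by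
    intro g k hg hk i j hij
    have hlt : (i = 0 ∧ j = 1) ∨ (i = 0 ∧ j = 2) ∨ (i = 1 ∧ j = 2) := by
      revert i j; decide
    obtain ⟨rfl, rfl⟩ | ⟨rfl, rfl⟩ | ⟨rfl, rfl⟩ := hlt
    · have h := lintegral_plane (Φ := fun p => g p.1 * k (-p.2)) (by fun_prop)
      refine Eq.trans h ?_
      have : ∀ x, ∫⁻ y, g x * k (-y) = g x * ∫⁻ y, k y := fun x => by
        rw [lintegral_const_mul _ (by fun_prop), lintegral_neg_eq_self (fun y => k y)]
      simp_rw [this]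
      exact lintegral_mul_const _ hg
    · have h := lintegral_plane (Φ := fun p => g p.1 * k (p.2 - p.1)) (by fun_prop)
      refine Eq.trans h ?_
      have : ∀ x, ∫⁻ y, g x * k (y - x) = g x * ∫⁻ y, k y := fun x => by
        rw [lintegral_const_mul _ (by fun_prop), lintegral_sub_right_eq_self (fun y => k y)]
      simp_rw [this]
      exact lintegral_mul_const _ hg
    · have h := lintegral_plane (Φ := fun p => g (-p.2) * k (p.2 - p.1)) (by fun_prop)
      refine Eq.trans h ?_
      rw [lintegral_lintegral_swap (by fun_prop)]
      have : ∀ y, ∫⁻ x, g (-y) * k (y - x) = g (-y) * ∫⁻ y, k y := fun y => by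
        rw [lintegral_const_mul _ (by fun_prop), lintegral_sub_left_eq_self (fun x => k x)]
      simp_rw [this]
      rw [lintegral_mul_const _ (by fun_prop), lintegral_neg_eq_self (fun y => g y)]
  obtain h | h := lt_or_gt_of_ne hij
  · exact key hg hk h
  · rw [mul_comm, ← key hk hg h]
    simp_rw [mul_comm]

/-- The cube root of the envelope `8 / (1 + |u|)` of `2 sin (u / 2) / u`. -/
noncomputable def sincRoot (u : ℝ) : ℝ := 2 * (1 + |u|) ^ (-(1 / 3) : ℝ)

lemma sincRoot_nonneg (u : ℝ) : 0 ≤ sincRoot u := by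
  unfold sincRoot; positivity

lemma sincRoot_le (u : ℝ) : sincRoot u ≤ 2 := by
  unfold sincRoot
  have : (1 + |u|) ^ (-(1 / 3) : ℝ) ≤ 1 :=
    Real.rpow_le_one_of_one_le_of_nonpos (by linarith [abs_nonneg u]) (by norm_num)
  linarith

lemma measurable_sincRoot : Measurable sincRoot := by
  unfold sincRoot; fun_prop

lemma sincRoot_pow_three (u : ℝ) : sincRoot u ^ 3 = 8 / (1 + |u|) := by
  have h : 0 ≤ 1 + |u| := by positivity
  rw [sincRoot, mul_pow, ← Real.rpow_natCast (_ ^ _), ← Real.rpow_mul h]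
  norm_num
  rw [Real.rpow_neg_one, div_eq_mul_inv]

/-- The total mass of `sincRoot ^ 4`. -/
noncomputable def sincMass : ℝ≥0∞ := ∫⁻ u, ENNReal.ofReal (sincRoot u ^ 4)

lemma sincMass_lt_top : sincMass < ∞ := by
  have h := integrable_one_add_norm (E := ℝ) (μ := volume) (r := 4 / 3) (by simp; norm_num)
  have h2 : Integrable fun u => sincRoot u ^ 4 := by
    refine (h.const_mul 16).congr (.of_forall fun u => ?_)
    have hu : 0 ≤ 1 + |u| := by positivity
    simp only
    rw [sincRoot, mul_pow, ← Real.rpow_natCast (_ ^ _), ← Real.rpow_mul hu, Real.norm_eq_abs]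
    norm_num
  exact h2.lintegral_lt_top

lemma measurable_noiseKernel (σ : ℝ) : Measurable (noiseKernel σ) := by
  unfold noiseKernel
  exact Measurable.ite (measurableSet_eq_fun measurable_id measurable_const) measurable_const
    (by fun_prop)

lemma abs_noiseKernel_le (σ u : ℝ) : |noiseKernel σ u| ≤ σ ^ 2 := by
  unfold noiseKernel
  split_ifs with h
  · rw [abs_of_nonneg (sq_nonneg σ)]
  · rw [abs_mul, abs_mul, abs_of_nonneg (sq_nonneg σ), abs_div]
    have h1 : |Real.sin (u / 2)| ≤ |u / 2| := Real.abs_sin_le_abs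
    have h2 : 0 < |u| := abs_pos.2 h
    have h3 : |Real.sin (u / 2)| / |u| ≤ 1 / 2 := by
      rw [div_le_iff₀ h2]
      rw [abs_div] at h1
      have : |(2 : ℝ)| = 2 := by norm_num
      rw [this] at h1
      linarith
    have : |(2 : ℝ)| = 2 := by norm_num
    rw [this]
    nlinarith [sq_nonneg σ]

lemma abs_noiseKernel_le_sincRoot (σ u : ℝ) : |noiseKernel σ u| ≤ σ ^ 2 * sincRoot u ^ 3 := by
  rw [sincRoot_pow_three]
  have hu : 0 ≤ |u| := abs_nonneg u
  by_cases h1 : |u| ≤ 1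
  · refine (abs_noiseKernel_le σ u).trans (le_mul_of_one_le_right (sq_nonneg σ) ?_)
    rw [le_div_iff₀ (by linarith)]
    linarith
  · have h0 : u ≠ 0 := by rintro rfl; simp at h1
    push Not at h1
    rw [noiseKernel, if_neg h0, abs_mul, abs_mul, abs_of_nonneg (sq_nonneg σ), abs_div]
    have h3 : |Real.sin (u / 2)| / |u| ≤ 2 / (1 + |u|) := by
      rw [div_le_div_iff₀ (by linarith) (by linarith)]
      nlinarith [Real.abs_sin_le_one (u / 2)]
    have : |(2 : ℝ)| = 2 := by norm_num
    rw [this]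
    calc 2 * σ ^ 2 * (|Real.sin (u / 2)| / |u|) ≤ 2 * σ ^ 2 * (2 / (1 + |u|)) := by gcongr
      _ ≤ σ ^ 2 * (8 / (1 + |u|)) := by
        have : 0 ≤ σ ^ 2 / (1 + |u|) := by positivity
        have e1 : 2 * σ ^ 2 * (2 / (1 + |u|)) = 4 * (σ ^ 2 / (1 + |u|)) := by ring
        have e2 : σ ^ 2 * (8 / (1 + |u|)) = 8 * (σ ^ 2 / (1 + |u|)) := by ring
        linarith

/-- A three-factor Young inequality on the plane: one factor in `L²`, two factors decaying like
`1 / |u|`. It rests on `A b³ c³ ≤ A² (b⁴ + c⁴) + b⁴ c⁴`, which only leaves products of two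
integrable factors. -/
lemma lintegral_triple_le {A : ℝ → ℝ} (hA : Measurable A) (hA0 : ∀ x, 0 ≤ A x)
    {i j k : Fin 3} (hij : i ≠ j) (hik : i ≠ k) (hjk : j ≠ k) (c d : ℝ) :
    ∫⁻ ξ : Plane, ENNReal.ofReal (A (freq i ξ) * sincRoot (c - freq j ξ) ^ 3
        * sincRoot (d - freq k ξ) ^ 3)
      ≤ (∫⁻ x, ENNReal.ofReal (A x ^ 2)) * sincMass + (∫⁻ x, ENNReal.ofReal (A x ^ 2)) * sincMass
        + sincMass * sincMass := by
  have hf := fun i => (continuous_freq i).measurable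
  have hs := measurable_sincRoot
  have hpt : ∀ ξ : Plane, ENNReal.ofReal (A (freq i ξ) * sincRoot (c - freq j ξ) ^ 3
        * sincRoot (d - freq k ξ) ^ 3)
      ≤ ENNReal.ofReal (A (freq i ξ) ^ 2) * ENNReal.ofReal (sincRoot (c - freq j ξ) ^ 4)
        + ENNReal.ofReal (A (freq i ξ) ^ 2) * ENNReal.ofReal (sincRoot (d - freq k ξ) ^ 4)
        + ENNReal.ofReal (sincRoot (c - freq j ξ) ^ 4)
          * ENNReal.ofReal (sincRoot (d - freq k ξ) ^ 4) := fun ξ => by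
    set a := A (freq i ξ)
    set b := sincRoot (c - freq j ξ)
    set e := sincRoot (d - freq k ξ)
    have ha : 0 ≤ a := hA0 _
    have hb : 0 ≤ b := sincRoot_nonneg _
    have he : 0 ≤ e := sincRoot_nonneg _
    rw [← ENNReal.ofReal_mul (by positivity), ← ENNReal.ofReal_mul (by positivity),
      ← ENNReal.ofReal_mul (by positivity), ← ENNReal.ofReal_add (by positivity) (by positivity),
      ← ENNReal.ofReal_add (by positivity) (by positivity)]
    refine ENNReal.ofReal_le_ofReal ?_
    have h1 : 2 * (a * b ^ 3 * e ^ 3) ≤ a ^ 2 * (b ^ 2 * e ^ 2) + b ^ 4 * e ^ 4 := by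
      nlinarith [mul_nonneg (sq_nonneg (a - b * e)) (mul_nonneg (sq_nonneg b) (sq_nonneg e)),
        sq_nonneg (a * b * e - b ^ 2 * e ^ 2)]
    have h2 : 2 * (b ^ 2 * e ^ 2) ≤ b ^ 4 + e ^ 4 := by nlinarith [sq_nonneg (b ^ 2 - e ^ 2)]
    have h3 : 0 ≤ b ^ 4 * e ^ 4 := by positivity
    have h4 : 0 ≤ a ^ 2 * (b ^ 4 + e ^ 4) := by positivity
    nlinarith [mul_le_mul_of_nonneg_left h2 (sq_nonneg a)]
  refine (lintegral_mono hpt).trans ?_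
  have sh : ∀ c : ℝ, ∫⁻ x, ENNReal.ofReal (sincRoot (c - x) ^ 4) = sincMass := fun c =>
    lintegral_sub_left_eq_self (fun x => ENNReal.ofReal (sincRoot x ^ 4)) c
  rw [lintegral_add_left (by fun_prop), lintegral_add_left (by fun_prop)]
  have e1 := lintegral_freq_mul_freq (g := fun x => ENNReal.ofReal (A x ^ 2))
    (k := fun x => ENNReal.ofReal (sincRoot (c - x) ^ 4)) (by fun_prop) (by fun_prop) hij
  have e2 := lintegral_freq_mul_freq (g := fun x => ENNReal.ofReal (A x ^ 2))
    (k := fun x => ENNReal.ofReal (sincRoot (d - x) ^ 4)) (by fun_prop) (by fun_prop) hik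
  have e3 := lintegral_freq_mul_freq (g := fun x => ENNReal.ofReal (sincRoot (c - x) ^ 4))
    (k := fun x => ENNReal.ofReal (sincRoot (d - x) ^ 4)) (by fun_prop) (by fun_prop) hjk
  rw [sh] at e1 e2 e3
  rw [sh] at e3
  rw [e1, e2, e3]

end Covariance

section CovWeight

open scoped ENNReal

/-- The size of the covariance of a noise term with signal spectrum `F`, signal factors
included. -/
noncomputable def covWeight (σ : ℝ) (k : NoiseKind) (F : ℝ → ℂ) (ω ξ : Plane) : ℝ :=
  ‖signalTerm k F ω‖ * ‖signalTerm k F ξ‖ * |wickCov σ k ω ξ|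

lemma measurable_wickCov (σ : ℝ) (k : NoiseKind) :
    Measurable fun p : Plane × Plane => wickCov σ k p.1 p.2 := by
  have hn := measurable_noiseKernel σ
  have hf := fun i => (continuous_freq i).measurable
  obtain _ | i | i := k <;> simp only [wickCov] <;> fun_prop

lemma measurable_factor {F : ℝ → ℂ} (hF : Measurable F) (i : Fin 3) : Measurable (factor F i) := by
  unfold factor
  have hc : Measurable (starRingEnd ℂ) := Complex.continuous_conj.measurable
  fin_cases i <;> simp <;> fun_prop

lemma measurable_signalTerm {F : ℝ → ℂ} (hF : Measurable F) (k : NoiseKind) :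
    Measurable (signalTerm k F) := by
  have h := measurable_factor hF
  obtain _ | i | i := k
  · exact measurable_const
  · exact h i
  · exact (h (i + 1)).mul (h (i + 2))

lemma measurable_covWeight {F : ℝ → ℂ} (hF : Measurable F) (σ : ℝ) (k : NoiseKind) :
    Measurable fun p : Plane × Plane => covWeight σ k F p.1 p.2 := by
  have h1 := measurable_signalTerm hF k
  have h2 := measurable_wickCov σ k
  unfold covWeight
  exact (((h1.comp measurable_fst).norm).mul ((h1.comp measurable_snd).norm)).mul h2.abs

lemma sigma_pow_four_le (σ : ℝ) : σ ^ 4 ≤ max (σ ^ 2) (σ ^ 6) := by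
  obtain h | h := le_total (σ ^ 2) 1
  · refine le_max_of_le_left ?_
    nlinarith [sq_nonneg σ]
  · refine le_max_of_le_right ?_
    nlinarith [sq_nonneg (σ ^ 2), sq_nonneg σ]

/-- A product of three noise kernels at the three frequencies, integrated over the plane. -/
lemma lintegral_noiseKernel_triple_le (σ : ℝ) {i j k : Fin 3} (hij : i ≠ j) (hik : i ≠ k)
    (hjk : j ≠ k) (c d e : ℝ) :
    ∫⁻ ξ : Plane, ENNReal.ofReal |noiseKernel σ (c - freq i ξ) * noiseKernel σ (d - freq j ξ)
        * noiseKernel σ (e - freq k ξ)|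
      ≤ ENNReal.ofReal (σ ^ 6) * (9 * (sincMass * sincMass)) := by
  have hs := measurable_sincRoot
  have hf := fun i => (continuous_freq i).measurable
  have h := lintegral_triple_le (A := fun x => sincRoot (c - x) ^ 3) (by fun_prop)
    (fun x => pow_nonneg (sincRoot_nonneg _) 3) hij hik hjk d e
  have h2 : ∫⁻ x, ENNReal.ofReal ((sincRoot (c - x) ^ 3) ^ 2) ≤ 4 * sincMass := by
    rw [lintegral_sub_left_eq_self (fun x => ENNReal.ofReal ((sincRoot x ^ 3) ^ 2)) c, sincMass,
      ← lintegral_const_mul _ (by fun_prop)]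
    refine lintegral_mono fun x => ?_
    rw [← ENNReal.ofReal_ofNat 4, ← ENNReal.ofReal_mul (by norm_num)]
    refine ENNReal.ofReal_le_ofReal ?_
    have h0 := sincRoot_nonneg x
    have h1 := sincRoot_le x
    have : sincRoot x ^ 2 ≤ 4 := by nlinarith
    calc (sincRoot x ^ 3) ^ 2 = sincRoot x ^ 2 * sincRoot x ^ 4 := by ring
      _ ≤ 4 * sincRoot x ^ 4 := by gcongr
  calc _ ≤ ∫⁻ ξ : Plane, ENNReal.ofReal (σ ^ 6) * ENNReal.ofReal (sincRoot (c - freq i ξ) ^ 3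
        * sincRoot (d - freq j ξ) ^ 3 * sincRoot (e - freq k ξ) ^ 3) := by
        refine lintegral_mono fun ξ => ?_
        rw [← ENNReal.ofReal_mul (by positivity)]
        refine ENNReal.ofReal_le_ofReal ?_
        rw [abs_mul, abs_mul]
        have n := fun u => pow_nonneg (sincRoot_nonneg u) 3
        calc _ ≤ (σ ^ 2 * sincRoot (c - freq i ξ) ^ 3) * (σ ^ 2 * sincRoot (d - freq j ξ) ^ 3)
              * (σ ^ 2 * sincRoot (e - freq k ξ) ^ 3) :=
              mul_le_mul (mul_le_mul (abs_noiseKernel_le_sincRoot _ _)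
                (abs_noiseKernel_le_sincRoot _ _) (abs_nonneg _)
                (mul_nonneg (sq_nonneg σ) (n _))) (abs_noiseKernel_le_sincRoot _ _) (abs_nonneg _)
                (mul_nonneg (mul_nonneg (sq_nonneg σ) (n _)) (mul_nonneg (sq_nonneg σ) (n _)))
          _ = _ := by ring
    _ = ENNReal.ofReal (σ ^ 6) * ∫⁻ ξ : Plane, ENNReal.ofReal (sincRoot (c - freq i ξ) ^ 3
        * sincRoot (d - freq j ξ) ^ 3 * sincRoot (e - freq k ξ) ^ 3) :=
        lintegral_const_mul _ (by fun_prop)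
    _ ≤ ENNReal.ofReal (σ ^ 6) * (4 * sincMass * sincMass + 4 * sincMass * sincMass
          + sincMass * sincMass) := by
        gcongr
        refine h.trans ?_
        gcongr
    _ = _ := by ring

/-- A product of two noise kernels and a square-integrable function at the three frequencies,
integrated over the plane. -/
lemma lintegral_noiseKernel_pair_le (σ : ℝ) {A : ℝ → ℝ} (hA : Measurable A) (hA0 : ∀ x, 0 ≤ A x)
    {i j k : Fin 3} (hij : i ≠ j) (hik : i ≠ k) (hjk : j ≠ k) (c d : ℝ) :
    ∫⁻ ξ : Plane, ENNReal.ofReal (A (freq i ξ) * |noiseKernel σ (c - freq j ξ)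
        * noiseKernel σ (d - freq k ξ)|)
      ≤ ENNReal.ofReal (σ ^ 4) * ((∫⁻ x, ENNReal.ofReal (A x ^ 2)) * sincMass
        + (∫⁻ x, ENNReal.ofReal (A x ^ 2)) * sincMass + sincMass * sincMass) := by
  have hs := measurable_sincRoot
  have hf := fun i => (continuous_freq i).measurable
  refine le_trans ?_ (mul_le_mul_right (lintegral_triple_le hA hA0 hij hik hjk c d)
    (ENNReal.ofReal (σ ^ 4)))
  rw [← lintegral_const_mul _ (by fun_prop)]
  refine lintegral_mono fun ξ => ?_
  rw [← ENNReal.ofReal_mul (by positivity)]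
  refine ENNReal.ofReal_le_ofReal ?_
  rw [abs_mul]
  have n := fun u => pow_nonneg (sincRoot_nonneg u) 3
  calc _ ≤ A (freq i ξ) * ((σ ^ 2 * sincRoot (c - freq j ξ) ^ 3)
        * (σ ^ 2 * sincRoot (d - freq k ξ) ^ 3)) :=
        mul_le_mul_of_nonneg_left (mul_le_mul (abs_noiseKernel_le_sincRoot _ _)
          (abs_noiseKernel_le_sincRoot _ _) (abs_nonneg _)
          (mul_nonneg (sq_nonneg σ) (n _))) (hA0 _)
    _ = _ := by ring

variable {F : ℝ → ℂ} (hF : Measurable F) (hneg : ∀ a, F (-a) = conj (F a)) {K : ℝ} (hK1 : 1 ≤ K)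
  (hK : ∀ a, ‖F a‖ ≤ K)

include hneg in
lemma norm_factor (i : Fin 3) (ω : Plane) : ‖factor F i ω‖ = ‖F (freq i ω)‖ := by
  fin_cases i <;> simp [factor, freq, hneg]

include hK1 hK hneg in
lemma norm_signalTerm_le (k : NoiseKind) (ω : Plane) : ‖signalTerm k F ω‖ ≤ K ^ 2 := by
  have h1 : 1 ≤ K ^ 2 := one_le_pow₀ hK1
  obtain _ | i | i := k
  · simpa [signalTerm] using h1
  · simp only [signalTerm, norm_factor hneg]
    exact (hK _).trans (le_self_pow₀ hK1 (by norm_num))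
  · simp only [signalTerm, norm_mul, norm_factor hneg]
    rw [pow_two]
    exact mul_le_mul (hK _) (hK _) (norm_nonneg _) (by linarith)

lemma abs_wickCov_le (σ : ℝ) (k : NoiseKind) (ω ξ : Plane) :
    |wickCov σ k ω ξ| ≤ 6 * max (σ ^ 2) (σ ^ 6) := by
  have hn := abs_noiseKernel_le σ
  have hs : 0 ≤ σ ^ 2 := sq_nonneg σ
  have h2 : ∀ u v, |noiseKernel σ u * noiseKernel σ v| ≤ σ ^ 4 := fun u v => by
    rw [abs_mul]
    calc _ ≤ σ ^ 2 * σ ^ 2 := mul_le_mul (hn _) (hn _) (abs_nonneg _) hs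
      _ = σ ^ 4 := by ring
  have h3 : ∀ u v w, |noiseKernel σ u * noiseKernel σ v * noiseKernel σ w| ≤ σ ^ 6 :=
    fun u v w => by
      rw [abs_mul]
      calc _ ≤ σ ^ 4 * σ ^ 2 := mul_le_mul (h2 _ _) (hn _) (abs_nonneg _) (by positivity)
        _ = σ ^ 6 := by ring
  have m1 : σ ^ 2 ≤ max (σ ^ 2) (σ ^ 6) := le_max_left _ _
  have m2 := sigma_pow_four_le σ
  have m3 : σ ^ 6 ≤ max (σ ^ 2) (σ ^ 6) := le_max_right _ _
  obtain _ | i | i := k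
  · simp only [wickCov]
    refine (abs_add_le _ _).trans ?_
    refine (add_le_add_left ((abs_add_le _ _).trans (add_le_add_left ((abs_add_le _ _).trans
      (add_le_add_left ((abs_add_le _ _).trans (add_le_add_left (abs_add_le _ _) _)) _)) _)) _).trans
      ?_
    linarith [h3 (freq 0 ω - freq 0 ξ) (freq 1 ω - freq 1 ξ) (freq 2 ω - freq 2 ξ),
      h3 (freq 0 ω - freq 0 ξ) (freq 1 ω - freq 2 ξ) (freq 2 ω - freq 1 ξ),
      h3 (freq 0 ω - freq 1 ξ) (freq 1 ω - freq 0 ξ) (freq 2 ω - freq 2 ξ),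
      h3 (freq 0 ω - freq 1 ξ) (freq 1 ω - freq 2 ξ) (freq 2 ω - freq 0 ξ),
      h3 (freq 0 ω - freq 2 ξ) (freq 1 ω - freq 0 ξ) (freq 2 ω - freq 1 ξ),
      h3 (freq 0 ω - freq 2 ξ) (freq 1 ω - freq 1 ξ) (freq 2 ω - freq 0 ξ)]
  · simp only [wickCov]
    refine (abs_add_le _ _).trans ?_
    linarith [h2 (freq (i + 1) ω - freq (i + 1) ξ) (freq (i + 2) ω - freq (i + 2) ξ),
      h2 (freq (i + 1) ω - freq (i + 2) ξ) (freq (i + 2) ω - freq (i + 1) ξ)]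
  · simp only [wickCov]
    linarith [hn (freq i ω - freq i ξ)]

include hK1 hK hneg in
lemma covWeight_le (σ : ℝ) (k : NoiseKind) (ω ξ : Plane) :
    covWeight σ k F ω ξ ≤ max (σ ^ 2) (σ ^ 6) * (6 * K ^ 4) := by
  have h1 := norm_signalTerm_le hneg hK1 hK k
  calc covWeight σ k F ω ξ ≤ K ^ 2 * K ^ 2 * (6 * max (σ ^ 2) (σ ^ 6)) :=
        mul_le_mul (mul_le_mul (h1 _) (h1 _) (norm_nonneg _) (by positivity))
          (abs_wickCov_le σ k ω ξ) (abs_nonneg _) (by positivity)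
    _ = _ := by ring

/-- The constant in the covariance bounds. -/
noncomputable def covConst (K : ℝ) (Φ : ℝ≥0∞) : ℝ≥0∞ :=
  54 * (sincMass * sincMass)
    + ENNReal.ofReal K * (2 * (Φ * sincMass + Φ * sincMass + sincMass * sincMass)) + Φ * Φ

lemma covConst_lt_top (K : ℝ) {Φ : ℝ≥0∞} (hΦ : Φ < ∞) : covConst K Φ < ∞ := by
  have := sincMass_lt_top
  unfold covConst
  finiteness

variable {Φ : ℝ≥0∞} (hΦ : ∫⁻ x, ENNReal.ofReal (‖F x‖ ^ 2) ≤ Φ)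

/-- If the kernel `κ` has bounded row integrals, the corresponding quadratic form is bounded in
terms of the `L¹` and `L^∞` norms of the test function. -/
lemma lintegral_lintegral_schur {ψ : Plane → ℝ≥0∞} (hψ : Measurable ψ) {b : ℝ≥0∞}
    (hb : ∀ ω, ψ ω ≤ b) {κ : Plane → Plane → ℝ≥0∞}
    (hκ : Measurable fun p : Plane × Plane => κ p.1 p.2) {c : ℝ≥0∞}
    (hc : ∀ ω, ∫⁻ ξ, κ ω ξ ≤ c) :
    ∫⁻ ω, ∫⁻ ξ, ψ ω * ψ ξ * κ ω ξ ≤ b * (∫⁻ ω, ψ ω) * c := by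
  have hκ' : ∀ ω, Measurable (κ ω) := fun ω => hκ.comp measurable_prodMk_left
  calc ∫⁻ ω, ∫⁻ ξ, ψ ω * ψ ξ * κ ω ξ ≤ ∫⁻ ω, ψ ω * (b * c) := by
        refine lintegral_mono fun ω => ?_
        calc ∫⁻ ξ, ψ ω * ψ ξ * κ ω ξ ≤ ∫⁻ ξ, ψ ω * b * κ ω ξ := by
              refine lintegral_mono fun ξ => ?_
              gcongr
              exact hb ξ
          _ = ψ ω * b * ∫⁻ ξ, κ ω ξ := lintegral_const_mul _ (hκ' ω)
          _ ≤ ψ ω * b * c := by gcongr; exact hc ω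
          _ = ψ ω * (b * c) := mul_assoc _ _ _
    _ = b * (∫⁻ ω, ψ ω) * c := by rw [lintegral_mul_const _ hψ]; ring

include hF hneg hK1 hK hΦ in
/-- The quadratic form of the covariance of each noise term is controlled by `‖ψ‖₁ ‖ψ‖_∞`. For the
cubic and quadratic terms the covariance is integrable over the plane; for the linear ones, whose
covariance depends on one frequency only, the two signal factors are square-integrable. -/
lemma lintegral_covWeight_le (σ : ℝ) (k : NoiseKind) {ψ : Plane → ℝ≥0∞} (hψ : Measurable ψ)
    {b : ℝ≥0∞} (hb : ∀ ω, ψ ω ≤ b) :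
    ∫⁻ ω, ∫⁻ ξ, ψ ω * ψ ξ * ENNReal.ofReal (covWeight σ k F ω ξ)
      ≤ b * (∫⁻ ω, ψ ω) * (ENNReal.ofReal (max (σ ^ 2) (σ ^ 6)) * covConst K Φ) := by
  have hn := measurable_noiseKernel σ
  have hf := fun i => (continuous_freq i).measurable
  have hκ : Measurable fun p : Plane × Plane => ENNReal.ofReal (covWeight σ k F p.1 p.2) :=
    (measurable_covWeight hF σ k).ennreal_ofReal
  have m3 : ENNReal.ofReal (σ ^ 6) ≤ ENNReal.ofReal (max (σ ^ 2) (σ ^ 6)) :=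
    ENNReal.ofReal_le_ofReal (le_max_right _ _)
  have m2 : ENNReal.ofReal (σ ^ 4) ≤ ENNReal.ofReal (max (σ ^ 2) (σ ^ 6)) :=
    ENNReal.ofReal_le_ofReal (sigma_pow_four_le σ)
  have m1 : ENNReal.ofReal (σ ^ 2) ≤ ENNReal.ofReal (max (σ ^ 2) (σ ^ 6)) :=
    ENNReal.ofReal_le_ofReal (le_max_left _ _)
  have hrow : (∀ ω, ∫⁻ ξ, ENNReal.ofReal (covWeight σ k F ω ξ)
        ≤ ENNReal.ofReal (max (σ ^ 2) (σ ^ 6)) * covConst K Φ) →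
      ∫⁻ ω, ∫⁻ ξ, ψ ω * ψ ξ * ENNReal.ofReal (covWeight σ k F ω ξ)
        ≤ b * (∫⁻ ω, ψ ω) * (ENNReal.ofReal (max (σ ^ 2) (σ ^ 6)) * covConst K Φ) :=
    lintegral_lintegral_schur hψ hb hκ
  obtain _ | i | i := k
  · refine hrow fun ω => ?_
    have h := fun {i j k : Fin 3} (hij : i ≠ j) (hik : i ≠ k) (hjk : j ≠ k) =>
      lintegral_noiseKernel_triple_le σ hij hik hjk (freq 0 ω) (freq 1 ω) (freq 2 ω)
    let T : Fin 3 → Fin 3 → Fin 3 → Plane → ℝ≥0∞ := fun i j k ξ =>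
      ENNReal.ofReal |noiseKernel σ (freq 0 ω - freq i ξ) * noiseKernel σ (freq 1 ω - freq j ξ)
        * noiseKernel σ (freq 2 ω - freq k ξ)|
    have hT : ∀ i j k, Measurable (T i j k) := fun i j k => by fun_prop
    calc ∫⁻ ξ, ENNReal.ofReal (covWeight σ (.inl ()) F ω ξ)
        ≤ ∫⁻ ξ, (T 0 1 2 ξ + T 0 2 1 ξ + T 1 0 2 ξ + T 1 2 0 ξ + T 2 0 1 ξ + T 2 1 0 ξ) := by
          refine lintegral_mono fun ξ => ?_
          simp only [T]
          rw [← ENNReal.ofReal_add (by positivity) (by positivity),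
            ← ENNReal.ofReal_add (by positivity) (by positivity),
            ← ENNReal.ofReal_add (by positivity) (by positivity),
            ← ENNReal.ofReal_add (by positivity) (by positivity),
            ← ENNReal.ofReal_add (by positivity) (by positivity)]
          refine ENNReal.ofReal_le_ofReal ?_
          simp only [covWeight, signalTerm, wickCov, norm_one, one_mul]
          exact (abs_add_le _ _).trans (add_le_add_left ((abs_add_le _ _).trans (add_le_add_left
            ((abs_add_le _ _).trans (add_le_add_left ((abs_add_le _ _).trans
              (add_le_add_left (abs_add_le _ _) _)) _)) _)) _)
      _ = (∫⁻ ξ, T 0 1 2 ξ) + (∫⁻ ξ, T 0 2 1 ξ) + (∫⁻ ξ, T 1 0 2 ξ) + (∫⁻ ξ, T 1 2 0 ξ)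
          + (∫⁻ ξ, T 2 0 1 ξ) + ∫⁻ ξ, T 2 1 0 ξ := by
          rw [lintegral_add_left (by fun_prop), lintegral_add_left (by fun_prop),
            lintegral_add_left (by fun_prop), lintegral_add_left (by fun_prop),
            lintegral_add_left (by fun_prop)]
      _ ≤ ENNReal.ofReal (σ ^ 6) * (9 * (sincMass * sincMass))
          + ENNReal.ofReal (σ ^ 6) * (9 * (sincMass * sincMass))
          + ENNReal.ofReal (σ ^ 6) * (9 * (sincMass * sincMass))
          + ENNReal.ofReal (σ ^ 6) * (9 * (sincMass * sincMass))
          + ENNReal.ofReal (σ ^ 6) * (9 * (sincMass * sincMass))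
          + ENNReal.ofReal (σ ^ 6) * (9 * (sincMass * sincMass)) := by
          gcongr
          · exact h (by decide) (by decide) (by decide)
          · exact h (by decide) (by decide) (by decide)
          · exact h (by decide) (by decide) (by decide)
          · exact h (by decide) (by decide) (by decide)
          · exact h (by decide) (by decide) (by decide)
          · exact h (by decide) (by decide) (by decide)
      _ = ENNReal.ofReal (σ ^ 6) * (54 * (sincMass * sincMass)) := by ring
      _ ≤ _ := by
          refine mul_le_mul' m3 ?_
          unfold covConst
          exact le_add_right (le_add_right le_rfl)
  · refine hrow fun ω => ?_
    have d1 : i ≠ i + 1 := (by decide : ∀ i : Fin 3, i ≠ i + 1) i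
    have d2 : i ≠ i + 2 := (by decide : ∀ i : Fin 3, i ≠ i + 2) i
    have d3 : i + 1 ≠ i + 2 := (by decide : ∀ i : Fin 3, i + 1 ≠ i + 2) i
    have hFn : Measurable fun x => ‖F x‖ := hF.norm
    have h1 := lintegral_noiseKernel_pair_le σ hFn (fun x => norm_nonneg (F x)) d1 d2 d3
      (freq (i + 1) ω) (freq (i + 2) ω)
    have h2 := lintegral_noiseKernel_pair_le σ hFn (fun x => norm_nonneg (F x)) d2 d1 d3.symm
      (freq (i + 1) ω) (freq (i + 2) ω)
    have hle : ENNReal.ofReal (σ ^ 4) * ((∫⁻ x, ENNReal.ofReal (‖F x‖ ^ 2)) * sincMass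
        + (∫⁻ x, ENNReal.ofReal (‖F x‖ ^ 2)) * sincMass + sincMass * sincMass)
        ≤ ENNReal.ofReal (σ ^ 4) * (Φ * sincMass + Φ * sincMass + sincMass * sincMass) := by
      gcongr
    let T : Fin 3 → Fin 3 → Plane → ℝ≥0∞ := fun j k ξ =>
      ENNReal.ofReal (‖F (freq i ξ)‖ * |noiseKernel σ (freq (i + 1) ω - freq j ξ)
        * noiseKernel σ (freq (i + 2) ω - freq k ξ)|)
    have hT : ∀ j k, Measurable (T j k) := fun j k => by fun_prop
    calc ∫⁻ ξ, ENNReal.ofReal (covWeight σ (.inr (.inl i)) F ω ξ)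
        ≤ ∫⁻ ξ, ENNReal.ofReal K * (T (i + 1) (i + 2) ξ + T (i + 2) (i + 1) ξ) := by
          refine lintegral_mono fun ξ => ?_
          simp only [T]
          rw [← ENNReal.ofReal_add (by positivity) (by positivity),
            ← ENNReal.ofReal_mul (by linarith)]
          refine ENNReal.ofReal_le_ofReal ?_
          simp only [covWeight, signalTerm, wickCov, norm_factor hneg]
          rw [← mul_add, ← mul_assoc]
          exact mul_le_mul (mul_le_mul_of_nonneg_right (hK _) (norm_nonneg _)) (abs_add_le _ _)
            (abs_nonneg _) (mul_nonneg (by linarith) (norm_nonneg _))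
      _ = ENNReal.ofReal K * ((∫⁻ ξ, T (i + 1) (i + 2) ξ) + ∫⁻ ξ, T (i + 2) (i + 1) ξ) := by
          rw [lintegral_const_mul _ (by fun_prop), lintegral_add_left (by fun_prop)]
      _ ≤ ENNReal.ofReal K * (ENNReal.ofReal (σ ^ 4)
            * (Φ * sincMass + Φ * sincMass + sincMass * sincMass) + ENNReal.ofReal (σ ^ 4)
            * (Φ * sincMass + Φ * sincMass + sincMass * sincMass)) := by
          gcongr
          · exact h1.trans hle
          · exact h2.trans hle
      _ = ENNReal.ofReal (σ ^ 4) * (ENNReal.ofReal K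
            * (2 * (Φ * sincMass + Φ * sincMass + sincMass * sincMass))) := by ring
      _ ≤ _ := by
          refine mul_le_mul' m2 ?_
          unfold covConst
          exact le_add_right le_add_self
  · -- bound the covariance by `σ²` and use `A ω * A ξ ≤ (A ω ^ 2 + A ξ ^ 2) / 2`
    have d3 : i + 1 ≠ i + 2 := (by decide : ∀ i : Fin 3, i + 1 ≠ i + 2) i
    let A : Plane → ℝ := fun ω => ‖signalTerm (.inr (.inr i)) F ω‖
    have hA : Measurable A := (measurable_signalTerm hF _).norm
    have hA2 : ∫⁻ ω, ENNReal.ofReal (A ω ^ 2) ≤ Φ * Φ := by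
      have h := lintegral_freq_mul_freq (g := fun x => ENNReal.ofReal (‖F x‖ ^ 2))
        (k := fun x => ENNReal.ofReal (‖F x‖ ^ 2)) (by fun_prop) (by fun_prop) d3
      have e : ∀ ω, ENNReal.ofReal (A ω ^ 2) = ENNReal.ofReal (‖F (freq (i + 1) ω)‖ ^ 2)
          * ENNReal.ofReal (‖F (freq (i + 2) ω)‖ ^ 2) := fun ω => by
        rw [← ENNReal.ofReal_mul (by positivity), ← mul_pow]
        simp only [A, signalTerm, norm_mul, norm_factor hneg]
      simp_rw [e]
      rw [h]
      exact mul_le_mul' hΦ hΦ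
    have hpt : ∀ ω ξ, ψ ω * ψ ξ * ENNReal.ofReal (covWeight σ (.inr (.inr i)) F ω ξ)
        ≤ ENNReal.ofReal (σ ^ 2) * ENNReal.ofReal (1 / 2) * (ψ ξ * (ψ ω * ENNReal.ofReal (A ω ^ 2)))
          + ENNReal.ofReal (σ ^ 2) * ENNReal.ofReal (1 / 2)
            * (ψ ω * (ψ ξ * ENNReal.ofReal (A ξ ^ 2))) := fun ω ξ => by
      have h1 : covWeight σ (.inr (.inr i)) F ω ξ
          ≤ σ ^ 2 * (1 / 2) * A ω ^ 2 + σ ^ 2 * (1 / 2) * A ξ ^ 2 := by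
        have h2 : covWeight σ (.inr (.inr i)) F ω ξ ≤ A ω * A ξ * σ ^ 2 :=
          mul_le_mul_of_nonneg_left (abs_noiseKernel_le _ _)
            (mul_nonneg (norm_nonneg _) (norm_nonneg _))
        nlinarith [mul_nonneg (sq_nonneg (A ω - A ξ)) (sq_nonneg σ)]
      calc _ ≤ ψ ω * ψ ξ * (ENNReal.ofReal (σ ^ 2 * (1 / 2) * A ω ^ 2)
            + ENNReal.ofReal (σ ^ 2 * (1 / 2) * A ξ ^ 2)) := by
            gcongr
            rw [← ENNReal.ofReal_add (by positivity) (by positivity)]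
            exact ENNReal.ofReal_le_ofReal h1
        _ = _ := by
            have e : ∀ x : ℝ, ENNReal.ofReal (σ ^ 2 * (1 / 2) * x ^ 2) = ENNReal.ofReal (σ ^ 2)
                * ENNReal.ofReal (1 / 2) * ENNReal.ofReal (x ^ 2) := fun x => by
              rw [ENNReal.ofReal_mul (by positivity), ENNReal.ofReal_mul (by positivity)]
            rw [e, e]
            ring
    have hψA : Measurable fun ω => ψ ω * ENNReal.ofReal (A ω ^ 2) := by fun_prop
    have hI : ∫⁻ ω, ψ ω * ENNReal.ofReal (A ω ^ 2) ≤ b * (Φ * Φ) := by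
      calc _ ≤ ∫⁻ ω, b * ENNReal.ofReal (A ω ^ 2) := by
            refine lintegral_mono fun ω => ?_
            gcongr
            exact hb ω
        _ = b * ∫⁻ ω, ENNReal.ofReal (A ω ^ 2) := lintegral_const_mul _ (by fun_prop)
        _ ≤ _ := by gcongr
    set I := ∫⁻ ω, ψ ω * ENNReal.ofReal (A ω ^ 2)
    set J := ∫⁻ ω, ψ ω
    have hhalf : ENNReal.ofReal (1 / 2) + ENNReal.ofReal (1 / 2) = 1 := by
      rw [← ENNReal.ofReal_add (by norm_num) (by norm_num)]; norm_num
    calc _ ≤ ∫⁻ ω, ∫⁻ ξ, (ENNReal.ofReal (σ ^ 2) * ENNReal.ofReal (1 / 2)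
              * (ψ ξ * (ψ ω * ENNReal.ofReal (A ω ^ 2)))
            + ENNReal.ofReal (σ ^ 2) * ENNReal.ofReal (1 / 2)
              * (ψ ω * (ψ ξ * ENNReal.ofReal (A ξ ^ 2)))) :=
          lintegral_mono fun ω => lintegral_mono fun ξ => hpt ω ξ
      _ = ∫⁻ ω, (ENNReal.ofReal (σ ^ 2) * ENNReal.ofReal (1 / 2)
              * (J * (ψ ω * ENNReal.ofReal (A ω ^ 2)))
            + ENNReal.ofReal (σ ^ 2) * ENNReal.ofReal (1 / 2) * (ψ ω * I)) := by
          refine lintegral_congr fun ω => ?_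
          rw [lintegral_add_left (by fun_prop), lintegral_const_mul _ (by fun_prop),
            lintegral_mul_const _ hψ, lintegral_const_mul _ (by fun_prop),
            lintegral_const_mul _ hψA]
      _ = ENNReal.ofReal (σ ^ 2) * (J * I)
            * (ENNReal.ofReal (1 / 2) + ENNReal.ofReal (1 / 2)) := by
          rw [lintegral_add_left (by fun_prop), lintegral_const_mul _ (by fun_prop),
            lintegral_const_mul _ hψA, lintegral_const_mul _ (by fun_prop),
            lintegral_mul_const _ hψ]
          ring
      _ = ENNReal.ofReal (σ ^ 2) * (J * I) := by rw [hhalf, mul_one]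
      _ ≤ ENNReal.ofReal (max (σ ^ 2) (σ ^ 6)) * (J * (b * (Φ * Φ))) := by gcongr
      _ = b * J * (ENNReal.ofReal (max (σ ^ 2) (σ ^ 6)) * (Φ * Φ)) := by ring
      _ ≤ _ := by
          gcongr
          unfold covConst
          exact le_add_self

end CovWeight

/-! ### Integrals of decorrelated random fields -/

section Fields

open scoped ENNReal

variable {S : Type*} [MeasurableSpace S] {P : Measure S}

lemma enorm_sq_eq_ofReal (z : ℂ) : ‖z‖ₑ ^ 2 = ENNReal.ofReal (‖z‖ ^ 2) := by
  rw [ENNReal.ofReal_pow (norm_nonneg _), ofReal_norm]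

/-- Pythagoras for orthogonal random variables. -/
lemma lintegral_enorm_sum_sq {ι : Type*} [Fintype ι] {I : ι → S → ℂ}
    (hI : ∀ i, MemLp (I i) 2 P) (horth : ∀ i j, i ≠ j → ∫ s, I i s * conj (I j s) ∂P = 0) :
    ∫⁻ s, ‖∑ i, I i s‖ₑ ^ 2 ∂P = ∑ i, ∫⁻ s, ‖I i s‖ₑ ^ 2 ∂P := by
  classical
  have hsum : MemLp (fun s => ∑ i, I i s) 2 P := memLp_finsetSum _ fun i _ => hI i
  have hint : ∀ i j, Integrable (fun s => I i s * conj (I j s)) P := fun i j =>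
    (hI i).integrable_mul (hI j).star
  have key : ∀ {J : S → ℂ}, MemLp J 2 P →
      ∫⁻ s, ‖J s‖ₑ ^ 2 ∂P = ENNReal.ofReal (∫ s, ‖J s‖ ^ 2 ∂P) := fun {J} hJ => by
    rw [ofReal_integral_eq_lintegral_ofReal (hJ.integrable_norm_pow two_ne_zero)
      (.of_forall fun s => by positivity)]
    simp_rw [enorm_sq_eq_ofReal]
  rw [key hsum, Finset.sum_congr rfl fun i _ => key (hI i),
    ← ENNReal.ofReal_sum_of_nonneg fun i _ => integral_nonneg fun s => by positivity]
  congr 1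
  have h : ((∫ s, ‖∑ i, I i s‖ ^ 2 ∂P : ℝ) : ℂ) = ((∑ i, ∫ s, ‖I i s‖ ^ 2 ∂P : ℝ) : ℂ) := by
    push_cast
    simp_rw [← integral_complex_ofReal, Complex.ofReal_pow, ← Complex.mul_conj', map_sum,
      Finset.sum_mul_sum]
    rw [integral_finsetSum _ fun i _ => integrable_finsetSum _ fun j _ => hint i j]
    refine Finset.sum_congr rfl fun i _ => ?_
    rw [integral_finsetSum _ fun j _ => hint i j, Finset.sum_eq_single i
      (fun j _ hj => horth i j hj.symm) (by simp)]
  exact_mod_cast h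

lemma mul_le_sq_add_sq (a b : ℝ≥0∞) : a * b ≤ a ^ 2 + b ^ 2 := by
  obtain h | h := le_total a b
  · exact (mul_le_mul_left h b).trans (by rw [← sq]; exact le_add_self)
  · exact (mul_le_mul_right h a).trans (by rw [← sq]; exact le_add_right le_rfl)

variable [IsProbabilityMeasure P] {X : Type*} [MeasurableSpace X] {μ : Measure X}

lemma integrable_field {p c : X → S → ℂ} {q : X → ℝ} {V : ℝ≥0∞}
    (hp : Measurable (Function.uncurry p)) (hc : Measurable (Function.uncurry c))
    (hq : Integrable q μ) (hpq : ∀ x s, ‖p x s‖ ≤ q x)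
    (hV : ∀ x, ∫⁻ s, ‖c x s‖ₑ ^ 2 ∂P ≤ V) (hVtop : V ≠ ∞) :
    Integrable (fun z : X × S => p z.1 z.2 * c z.1 z.2) (μ.prod P) := by
  have hm : Measurable fun z : X × S => p z.1 z.2 * c z.1 z.2 := hp.mul hc
  refine ⟨hm.aestronglyMeasurable, ?_⟩
  rw [HasFiniteIntegral, lintegral_prod _ hm.enorm.aemeasurable]
  calc ∫⁻ x, ∫⁻ s, ‖p x s * c x s‖ₑ ∂P ∂μ ≤ ∫⁻ x, ‖q x‖ₑ * (V + 1) ∂μ := by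
        refine lintegral_mono fun x => ?_
        have hcx : Measurable (c x) := hc.comp measurable_prodMk_left
        calc ∫⁻ s, ‖p x s * c x s‖ₑ ∂P ≤ ∫⁻ s, ‖q x‖ₑ * (‖c x s‖ₑ ^ 2 + 1) ∂P := by
              refine lintegral_mono fun s => ?_
              rw [enorm_mul]
              refine mul_le_mul' (enorm_le_iff_norm_le.2 ((hpq x s).trans (le_abs_self _))) ?_
              simpa using mul_le_sq_add_sq ‖c x s‖ₑ 1
          _ = ‖q x‖ₑ * (∫⁻ s, ‖c x s‖ₑ ^ 2 ∂P + 1) := by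
              rw [lintegral_const_mul _ (by fun_prop), lintegral_add_right _ measurable_const]
              simp
          _ ≤ _ := by gcongr; exact hV x
    _ < ∞ := by
        rw [lintegral_mul_const'' _ hq.aestronglyMeasurable.enorm]
        exact ENNReal.mul_lt_top hq.hasFiniteIntegral (by finiteness)

variable [SFinite μ] {p₁ c₁ p₂ c₂ : X → S → ℂ} {q : X → ℝ} {V : ℝ≥0∞}
  (hp₁ : Measurable (Function.uncurry p₁)) (hc₁ : Measurable (Function.uncurry c₁))
  (hp₂ : Measurable (Function.uncurry p₂)) (hc₂ : Measurable (Function.uncurry c₂))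
  (hq : Integrable q μ) (hpq₁ : ∀ x s, ‖p₁ x s‖ ≤ q x) (hpq₂ : ∀ x s, ‖p₂ x s‖ ≤ q x)
  (hV₁ : ∀ x, ∫⁻ s, ‖c₁ x s‖ₑ ^ 2 ∂P ≤ V) (hV₂ : ∀ x, ∫⁻ s, ‖c₂ x s‖ₑ ^ 2 ∂P ≤ V) (hVtop : V ≠ ∞)

include hp₁ hc₁ hp₂ hc₂ hq hpq₁ hpq₂ hV₁ hV₂ hVtop

lemma integrable_field_mul_conj :
    Integrable (fun z : S × X × X => p₁ z.2.1 z.1 * c₁ z.2.1 z.1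
      * conj (p₂ z.2.2 z.1 * c₂ z.2.2 z.1)) (P.prod (μ.prod μ)) := by
  have m1 : Measurable fun z : S × X × X => p₁ z.2.1 z.1 * c₁ z.2.1 z.1 :=
    (hp₁.comp (f := fun z : S × X × X => (z.2.1, z.1)) (by fun_prop)).mul
      (hc₁.comp (f := fun z : S × X × X => (z.2.1, z.1)) (by fun_prop))
  have m2 : Measurable fun z : S × X × X => p₂ z.2.2 z.1 * c₂ z.2.2 z.1 :=
    (hp₂.comp (f := fun z : S × X × X => (z.2.2, z.1)) (by fun_prop)).mul
      (hc₂.comp (f := fun z : S × X × X => (z.2.2, z.1)) (by fun_prop))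
  have hm : Measurable fun z : S × X × X => p₁ z.2.1 z.1 * c₁ z.2.1 z.1
      * conj (p₂ z.2.2 z.1 * c₂ z.2.2 z.1) := m1.mul (Complex.continuous_conj.measurable.comp m2)
  refine ⟨hm.aestronglyMeasurable, ?_⟩
  rw [HasFiniteIntegral, lintegral_prod_symm _ hm.enorm.aemeasurable]
  calc ∫⁻ z : X × X, ∫⁻ s, ‖p₁ z.1 s * c₁ z.1 s * conj (p₂ z.2 s * c₂ z.2 s)‖ₑ ∂P ∂(μ.prod μ)
      ≤ ∫⁻ z : X × X, ‖q z.1‖ₑ * ‖q z.2‖ₑ * (V + V) ∂(μ.prod μ) := by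
        refine lintegral_mono fun z => ?_
        have hcx : Measurable (c₁ z.1) := hc₁.comp measurable_prodMk_left
        have hcy : Measurable (c₂ z.2) := hc₂.comp measurable_prodMk_left
        calc ∫⁻ s, ‖p₁ z.1 s * c₁ z.1 s * conj (p₂ z.2 s * c₂ z.2 s)‖ₑ ∂P
            ≤ ∫⁻ s, ‖q z.1‖ₑ * ‖q z.2‖ₑ * (‖c₁ z.1 s‖ₑ ^ 2 + ‖c₂ z.2 s‖ₑ ^ 2) ∂P := by
              refine lintegral_mono fun s => ?_
              rw [enorm_mul, RCLike.enorm_conj, enorm_mul, enorm_mul, mul_mul_mul_comm]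
              exact mul_le_mul' (mul_le_mul'
                (enorm_le_iff_norm_le.2 ((hpq₁ _ s).trans (le_abs_self _)))
                (enorm_le_iff_norm_le.2 ((hpq₂ _ s).trans (le_abs_self _))))
                (mul_le_sq_add_sq _ _)
          _ = ‖q z.1‖ₑ * ‖q z.2‖ₑ * (∫⁻ s, ‖c₁ z.1 s‖ₑ ^ 2 ∂P + ∫⁻ s, ‖c₂ z.2 s‖ₑ ^ 2 ∂P) := by
              rw [lintegral_const_mul _ (by fun_prop), lintegral_add_right _ (by fun_prop)]
          _ ≤ _ := by gcongr; exacts [hV₁ _, hV₂ _]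
    _ < ∞ := by
        rw [lintegral_mul_const' _ _ (by finiteness), lintegral_prod_mul
          hq.aestronglyMeasurable.enorm hq.aestronglyMeasurable.enorm]
        have := hq.hasFiniteIntegral
        rw [HasFiniteIntegral] at this
        finiteness

/-- The mixed second moment of two integrals of random fields `p c` in which the factors `p` are
independent of the factors `c`. -/
lemma integral_field_mul_conj
    (hind : ∀ x y, IndepFun (fun s => p₁ x s * conj (p₂ y s)) (fun s => c₁ x s * conj (c₂ y s)) P) :
    Integrable (fun s => (∫ x, p₁ x s * c₁ x s ∂μ) * conj (∫ x, p₂ x s * c₂ x s ∂μ)) P ∧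
    ∫ s, (∫ x, p₁ x s * c₁ x s ∂μ) * conj (∫ x, p₂ x s * c₂ x s ∂μ) ∂P
      = ∫ z : X × X, (∫ s, p₁ z.1 s * conj (p₂ z.2 s) ∂P) * ∫ s, c₁ z.1 s * conj (c₂ z.2 s) ∂P
        ∂(μ.prod μ) := by
  have hi := integrable_field_mul_conj hp₁ hc₁ hp₂ hc₂ hq hpq₁ hpq₂ hV₁ hV₂ hVtop (P := P) (μ := μ)
  have e : ∀ s, (∫ x, p₁ x s * c₁ x s ∂μ) * conj (∫ x, p₂ x s * c₂ x s ∂μ)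
      = ∫ z : X × X, p₁ z.1 s * c₁ z.1 s * conj (p₂ z.2 s * c₂ z.2 s) ∂(μ.prod μ) := fun s => by
    rw [← integral_conj, ← integral_prod_mul]
  simp_rw [e]
  refine ⟨hi.integral_prod_left, ?_⟩
  rw [integral_integral_swap hi]
  refine integral_congr_ae (.of_forall fun z => ?_)
  have hcx : Measurable (c₁ z.1) := hc₁.comp measurable_prodMk_left
  have hcy : Measurable (c₂ z.2) := hc₂.comp measurable_prodMk_left
  have hpx : Measurable (p₁ z.1) := hp₁.comp measurable_prodMk_left
  have hpy : Measurable (p₂ z.2) := hp₂.comp measurable_prodMk_left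
  have hconj := Complex.continuous_conj.measurable
  beta_reduce
  rw [← (hind z.1 z.2).integral_fun_mul_eq_mul_integral
    (hpx.mul (hconj.comp hpy)).aestronglyMeasurable (hcx.mul (hconj.comp hcy)).aestronglyMeasurable]
  refine integral_congr_ae (.of_forall fun s => ?_)
  simp only [map_mul]
  ring

end Fields

/-! ### The noise terms of the centred bispectrum, tested against a function -/

section Signals

open scoped ENNReal

/-- The dilation parameter, restricted to `[-1/2, 1/2]`. In the model it takes almost surely no
other values; the restriction makes bounds on the signals hold everywhere. -/
noncomputable def clampDilation (τ : ℝ) : ℝ := max (-(1 / 2)) (min τ (1 / 2))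

lemma clampDilation_eq {τ : ℝ} (h : |τ| ≤ 1 / 2) : clampDilation τ = τ := by
  obtain ⟨h1, h2⟩ := abs_le.1 h
  rw [clampDilation, min_eq_left h2, max_eq_right h1]

lemma abs_clampDilation_le (τ : ℝ) : |clampDilation τ| ≤ 1 / 2 :=
  abs_le.2 ⟨le_max_left _ _, max_le (by norm_num) (min_le_right _ _)⟩

lemma continuous_clampDilation : Continuous clampDilation := by unfold clampDilation; fun_prop

/-- The Fourier transform of the signal with translation `p.1` and dilation `p.2`. -/
noncomputable def signalFourier (f : ℝ → ℝ) (p : ℝ × ℝ) : ℝ → ℂ :=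
  fourierHat (dilatedSignal f p.1 (clampDilation p.2))

variable {f : ℝ → ℝ}

lemma signalFourier_eq (f : ℝ → ℝ) (p : ℝ × ℝ) (a : ℝ) :
    signalFourier f p a = ((1 - clampDilation p.2 : ℝ) : ℂ) * Complex.exp (-(Complex.I * a * p.1))
      * fourierHat f ((1 - clampDilation p.2) * a) :=
  fourierHat_dilatedSignal f p.1 (by linarith [(abs_le.1 (abs_clampDilation_le p.2)).2]) a

lemma signalFourier_neg (f : ℝ → ℝ) (p : ℝ × ℝ) (a : ℝ) :
    signalFourier f p (-a) = conj (signalFourier f p a) := fourierHat_neg _ _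

lemma norm_signalFourier (f : ℝ → ℝ) (p : ℝ × ℝ) (a : ℝ) :
    ‖signalFourier f p a‖
      = (1 - clampDilation p.2) * ‖fourierHat f ((1 - clampDilation p.2) * a)‖ := by
  have h : 0 ≤ 1 - clampDilation p.2 := by linarith [(abs_le.1 (abs_clampDilation_le p.2)).2]
  have e : -(Complex.I * a * p.1) = ((-(a * p.1) : ℝ) : ℂ) * Complex.I := by push_cast; ring
  rw [signalFourier_eq, norm_mul, norm_mul, Complex.norm_real, Real.norm_of_nonneg h, e,
    Complex.norm_exp_ofReal_mul_I, mul_one]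

lemma norm_signalFourier_le {K : ℝ} (hK : ∀ a, ‖fourierHat f a‖ ≤ K) (p : ℝ × ℝ) (a : ℝ) :
    ‖signalFourier f p a‖ ≤ 2 * K + 1 := by
  obtain ⟨h1, h2⟩ := abs_le.1 (abs_clampDilation_le p.2)
  rw [norm_signalFourier]
  have h3 := hK ((1 - clampDilation p.2) * a)
  have h4 := norm_nonneg (fourierHat f ((1 - clampDilation p.2) * a))
  nlinarith

lemma continuous_signalFourier (hf : Continuous (fourierHat f)) :
    Continuous fun z : (ℝ × ℝ) × ℝ => signalFourier f z.1 z.2 := by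
  have h := continuous_clampDilation
  simp_rw [signalFourier_eq]
  fun_prop

lemma lintegral_signalFourier_le (hf : Continuous (fourierHat f)) (p : ℝ × ℝ) :
    ∫⁻ a, ENNReal.ofReal (‖signalFourier f p a‖ ^ 2)
      ≤ 2 * ∫⁻ a, ENNReal.ofReal (‖fourierHat f a‖ ^ 2) := by
  obtain ⟨h1, h2⟩ := abs_le.1 (abs_clampDilation_le p.2)
  set c := 1 - clampDilation p.2 with hc
  have hc0 : 0 < c := by linarith
  simp_rw [norm_signalFourier, ← hc, mul_pow]
  have e : ∀ a, ENNReal.ofReal (c ^ 2 * ‖fourierHat f (c * a)‖ ^ 2)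
      = ENNReal.ofReal (c ^ 2) * ENNReal.ofReal (‖fourierHat f (c * a)‖ ^ 2) := fun a =>
    ENNReal.ofReal_mul (by positivity)
  simp_rw [e]
  rw [lintegral_const_mul' _ _ ENNReal.ofReal_ne_top,
    ← lintegral_map (f := fun a => ENNReal.ofReal (‖fourierHat f a‖ ^ 2)) (by fun_prop)
      (measurable_const_mul c), Real.map_volume_mul_left hc0.ne', lintegral_smul_measure,
    smul_eq_mul, ← mul_assoc, ← ENNReal.ofReal_mul (by positivity), abs_of_pos (by positivity)]
  gcongr
  rw [show c ^ 2 * c⁻¹ = c by field_simp]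
  exact (ENNReal.ofReal_le_ofReal (by linarith : c ≤ 2)).trans_eq (by simp)

end Signals

section Noise

open scoped ENNReal

variable {S : Type*} [MeasurableSpace S] {P : Measure S} [IsProbabilityMeasure P]
  {f : ℝ → ℝ} {η σ : ℝ} {M : ℕ} {t τ : Fin M → S → ℝ} {W : Fin M → L2Window → S → ℝ}
  {E : Fin M → ℝ → S → ℂ}

lemma measurable_functionalFourier (a : ℝ) : Measurable fun w : L2Window → ℝ =>
    functionalFourier w a := by
  unfold functionalFourier
  fun_prop

lemma measurable_wickTerm_functionalFourier (σ : ℝ) (k : NoiseKind) (ω : Plane) :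
    Measurable fun w : L2Window → ℝ => wickTerm σ k (functionalFourier w) ω := by
  have h := measurable_functionalFourier
  have hc : Measurable (starRingEnd ℂ) := Complex.continuous_conj.measurable
  have hf : ∀ i : Fin 3, Measurable fun w : L2Window → ℝ => factor (functionalFourier w) i ω := by
    intro i
    unfold factor
    fin_cases i <;> simp <;> fun_prop
  obtain _ | i | i := k <;> simp only [wickTerm] <;> fun_prop

omit [IsProbabilityMeasure P] in
lemma wickTerm_noise_ae {W : L2Window → S → ℝ} {E : ℝ → S → ℂ} (h : IsNoiseFourier P W E) (σ : ℝ)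
    (k : NoiseKind) (ω : Plane) :
    ∀ᵐ s ∂P, wickTerm σ k (fun a => E a s) ω
      = wickTerm σ k (functionalFourier fun φ => W φ s) ω := by
  filter_upwards [h.version (ω 0), h.version (ω 1), h.version (ω 1 - ω 0)] with s h0 h1 h2
  have hf : ∀ i : Fin 3, factor (fun a => E a s) i ω
      = factor (functionalFourier fun φ => W φ s) i ω := fun i => by
    simp only [factor, functionalFourier, h0, h1, h2]
  obtain _ | i | i := k <;> simp only [wickTerm, hf]

lemma measurable_factor_uncurry {Z : Type*} [MeasurableSpace Z] {G : Z → ℝ → ℂ}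
    (hG : Measurable (Function.uncurry G)) (i : Fin 3) :
    Measurable fun z : Plane × Z => factor (G z.2) i z.1 := by
  have hc : Measurable (starRingEnd ℂ) := Complex.continuous_conj.measurable
  have hE : ∀ {g : Plane × Z → ℝ}, Measurable g → Measurable fun z => G z.2 (g z) := fun hg =>
    hG.comp (measurable_snd.prodMk hg)
  have h0 : Measurable fun z : Plane × Z => z.1 0 := by fun_prop
  have h1 : Measurable fun z : Plane × Z => z.1 1 := by fun_prop
  unfold factor
  fin_cases i
  · exact hE h0
  · exact hc.comp (hE h1)
  · exact hE (h1.sub h0)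

lemma measurable_wickTerm {E : ℝ → S → ℂ} (h : Measurable (Function.uncurry E)) (σ : ℝ)
    (k : NoiseKind) : Measurable fun z : Plane × S => wickTerm σ k (fun a => E a z.2) z.1 := by
  have hn := measurable_noiseKernel σ
  have hfr := fun i => (continuous_freq i).measurable
  have hf := measurable_factor_uncurry (G := fun s a => E a s) (h.comp measurable_swap)
  obtain _ | i | i := k <;> simp only [wickTerm] <;> fun_prop

lemma measurable_signalTerm_uncurry {Z : Type*} [MeasurableSpace Z] {G : Z → ℝ → ℂ}
    (hG : Measurable (Function.uncurry G)) (k : NoiseKind) :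
    Measurable fun z : Plane × Z => signalTerm k (G z.2) z.1 := by
  have hf := measurable_factor_uncurry hG
  obtain _ | i | i := k <;> simp only [signalTerm] <;> fun_prop

lemma measurable_signalTerm_signalFourier (hf : Continuous (fourierHat f)) (k : NoiseKind) :
    Measurable fun z : Plane × ℝ × ℝ => signalTerm k (signalFourier f z.2) z.1 :=
  measurable_signalTerm_uncurry (G := signalFourier f) (continuous_signalFourier hf).measurable k

lemma lintegral_wickTerm_sq_le {W : L2Window → S → ℝ} {E : ℝ → S → ℂ} (hW : IsWhiteNoise P σ W)
    (h : IsNoiseFourier P W E) (k : NoiseKind) (ω : Plane) :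
    ∫⁻ s, ‖wickTerm σ k (fun a => E a s) ω‖ₑ ^ 2 ∂P
      ≤ ENNReal.ofReal (6 * max (σ ^ 2) (σ ^ 6)) := by
  rw [lintegral_congr_ae (g := fun s => ENNReal.ofReal
    (‖wickTerm σ k (functionalFourier fun φ => W φ s) ω‖ ^ 2))
    ((wickTerm_noise_ae h σ k ω).mono fun s hs => by beta_reduce; rw [hs, enorm_sq_eq_ofReal]),
    ← ofReal_integral_eq_lintegral_ofReal
      ((memLp_wickTerm hW k ω).integrable_norm_pow two_ne_zero)
      (.of_forall fun s => by positivity)]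
  refine ENNReal.ofReal_le_ofReal ?_
  have e := integral_wickTerm_mul_conj hW k ω ω
  simp_rw [Complex.mul_conj', ← Complex.ofReal_pow, integral_complex_ofReal] at e
  rw [Complex.ofReal_inj.1 e]
  exact (le_abs_self _).trans (abs_wickCov_le σ k ω ω)

variable (hf : Continuous (fourierHat f)) {K : ℝ} (hK1 : 1 ≤ K)
  (hK : ∀ p a, ‖signalFourier f p a‖ ≤ K)
  (hmodel : NoisyDilationModel P f η σ M t τ W E) {ψ : Plane → ℝ} (hψm : Measurable ψ)
  (hψ : Integrable ψ)

/-- A noise term of the centred bispectrum of the `j`-th observation, tested against `ψ`. -/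
noncomputable def testedNoise (f : ℝ → ℝ) (σ : ℝ) (t τ : Fin M → S → ℝ) (E : Fin M → ℝ → S → ℂ)
    (ψ : Plane → ℝ) (k : NoiseKind) (j : Fin M) (s : S) : ℂ :=
  ∫ ω : Plane, (ψ ω * signalTerm k (signalFourier f (t j s, τ j s)) ω)
    * wickTerm σ k (fun a => E j a s) ω

include hf hmodel hψm in
omit [IsProbabilityMeasure P] in
lemma measurable_testedNoise_factor (k : NoiseKind) (j : Fin M) :
    Measurable (Function.uncurry fun ω s =>
      ((ψ ω : ℂ) * signalTerm k (signalFourier f (t j s, τ j s)) ω)) := by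
  have h1 := hmodel.measurable_t j
  have h2 := hmodel.measurable_τ j
  have h3 := (measurable_signalTerm_signalFourier hf k).comp
    (f := fun z : Plane × S => (z.1, t j z.2, τ j z.2)) (by fun_prop)
  have h4 : Measurable fun z : Plane × S => (ψ z.1 : ℂ) := by fun_prop
  exact h4.mul h3

include hf hK1 hK hmodel hψm hψ

/-- The signal factors depend on translations and dilations only, which are independent of the
noises, so second moments of tested noise terms factor pointwise. -/
lemma integral_testedNoise (k : NoiseKind) (i j : Fin M) :
    Integrable (fun s => testedNoise f σ t τ E ψ k i s * conj (testedNoise f σ t τ E ψ k j s)) P ∧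
    ∫ s, testedNoise f σ t τ E ψ k i s * conj (testedNoise f σ t τ E ψ k j s) ∂P
      = ∫ z : Plane × Plane, (∫ s, (ψ z.1 * signalTerm k (signalFourier f (t i s, τ i s)) z.1)
            * conj (ψ z.2 * signalTerm k (signalFourier f (t j s, τ j s)) z.2) ∂P)
          * ∫ s, wickTerm σ k (fun a => E i a s) z.1
            * conj (wickTerm σ k (fun a => E j a s) z.2) ∂P := by
  have hc : Measurable (starRingEnd ℂ) := Complex.continuous_conj.measurable
  have hq : ∀ j x s, ‖(ψ x : ℂ) * signalTerm k (signalFourier f (t j s, τ j s)) x‖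
      ≤ ‖ψ x‖ * K ^ 2 := fun j x s => by
    rw [norm_mul, Complex.norm_real]
    gcongr
    exact norm_signalTerm_le (signalFourier_neg f _) hK1 (hK _) k x
  have hA : ∀ (j : Fin M) (x : Plane), Measurable fun T : Fin M → ℝ × ℝ =>
      (ψ x : ℂ) * signalTerm k (signalFourier f (T j)) x := fun j x =>
    measurable_const.mul ((measurable_signalTerm_signalFourier hf k).comp
      (f := fun T : Fin M → ℝ × ℝ => (x, T j)) (by fun_prop))
  have hB : ∀ (j : Fin M) (x : Plane), Measurable fun N : Fin M → L2Window → ℝ =>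
      wickTerm σ k (functionalFourier (N j)) x := fun j x =>
    (measurable_wickTerm_functionalFourier σ k x).comp (measurable_pi_apply j)
  have hind : ∀ x y, IndepFun
      (fun s => (ψ x * signalTerm k (signalFourier f (t i s, τ i s)) x)
        * conj (ψ y * signalTerm k (signalFourier f (t j s, τ j s)) y))
      (fun s => wickTerm σ k (fun a => E i a s) x * conj (wickTerm σ k (fun a => E j a s) y)) P := by
    intro x y
    have h := hmodel.indep_transform_noise.comp ((hA i x).mul (hc.comp (hA j y)))
      ((hB i x).mul (hc.comp (hB j y)))
    refine h.congr (.of_forall fun s => rfl) ?_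
    filter_upwards [wickTerm_noise_ae (hmodel.noiseFourier i) σ k x,
      wickTerm_noise_ae (hmodel.noiseFourier j) σ k y] with s h1 h2
    simp only [h1, h2, Function.comp_apply, Pi.mul_apply]
  unfold testedNoise
  exact integral_field_mul_conj
    (p₁ := fun x s => ψ x * signalTerm k (signalFourier f (t i s, τ i s)) x)
    (p₂ := fun x s => ψ x * signalTerm k (signalFourier f (t j s, τ j s)) x)
    (c₁ := fun x s => wickTerm σ k (fun a => E i a s) x)
    (c₂ := fun x s => wickTerm σ k (fun a => E j a s) x) (q := fun x => ‖ψ x‖ * K ^ 2)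
    (V := ENNReal.ofReal (6 * max (σ ^ 2) (σ ^ 6)))
    (measurable_testedNoise_factor hf hmodel hψm k i)
    (measurable_wickTerm (hmodel.noiseFourier i).measurable σ k)
    (measurable_testedNoise_factor hf hmodel hψm k j)
    (measurable_wickTerm (hmodel.noiseFourier j).measurable σ k) (hψ.norm.mul_const _)
    (hq i) (hq j) (lintegral_wickTerm_sq_le (hmodel.whiteNoise i) (hmodel.noiseFourier i) k)
    (lintegral_wickTerm_sq_le (hmodel.whiteNoise j) (hmodel.noiseFourier j) k)
    ENNReal.ofReal_ne_top hind

lemma memLp_testedNoise (k : NoiseKind) (j : Fin M) : MemLp (testedNoise f σ t τ E ψ k j) 2 P := by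
  have hm : StronglyMeasurable (testedNoise f σ t τ E ψ k j) :=
    ((measurable_testedNoise_factor hf hmodel hψm k j).mul
      (measurable_wickTerm (hmodel.noiseFourier j).measurable σ
        k)).stronglyMeasurable.integral_prod_left'
  rw [memLp_two_iff_integrable_sq_norm hm.aestronglyMeasurable]
  refine (integral_testedNoise hf hK1 hK hmodel hψm hψ k j j).1.norm.congr (.of_forall fun s => ?_)
  simp [sq]

lemma integral_testedNoise_of_ne (k : NoiseKind) {i j : Fin M} (hij : i ≠ j) :
    ∫ s, testedNoise f σ t τ E ψ k i s * conj (testedNoise f σ t τ E ψ k j s) ∂P = 0 := by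
  have hc : Measurable (starRingEnd ℂ) := Complex.continuous_conj.measurable
  rw [(integral_testedNoise hf hK1 hK hmodel hψm hψ k i j).2]
  refine integral_eq_zero_of_ae (.of_forall fun z => ?_)
  have hw := measurable_wickTerm_functionalFourier σ k
  have hind := (hmodel.indep_noise.indepFun hij).comp (hw z.1) (hc.comp (hw z.2))
  have h0 := integral_wickTerm (hmodel.whiteNoise i) k z.1
  have e : ∫ s, wickTerm σ k (fun a => E i a s) z.1
      * conj (wickTerm σ k (fun a => E j a s) z.2) ∂P = 0 := by
    rw [integral_congr_ae (g := fun s => wickTerm σ k (functionalFourier fun φ => W i φ s) z.1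
      * conj (wickTerm σ k (functionalFourier fun φ => W j φ s) z.2))]
    · have h := hind.integral_fun_mul_eq_mul_integral
        (memLp_wickTerm (hmodel.whiteNoise i) k z.1).1
        (memLp_wickTerm (hmodel.whiteNoise j) k z.2).star.1
      refine h.trans ?_
      rw [show ∫ s, ((fun w => wickTerm σ k (functionalFourier w) z.1) ∘ fun s φ => W i φ s) s ∂P
        = 0 from h0, zero_mul]
    · filter_upwards [wickTerm_noise_ae (hmodel.noiseFourier i) σ k z.1,
        wickTerm_noise_ae (hmodel.noiseFourier j) σ k z.2] with s h1 h2
      rw [h1, h2]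
  simp only [e, mul_zero, Pi.zero_apply]

/-- The second moment of a tested noise term is at most the largest value of the quadratic form of
its covariance over all translations and dilations. -/
lemma lintegral_testedNoise_le (k : NoiseKind) (j : Fin M) {b : ℝ≥0∞}
    (hb : ∀ p, ∫⁻ ω, ∫⁻ ξ, ‖ψ ω‖ₑ * ‖ψ ξ‖ₑ
      * ENNReal.ofReal (covWeight σ k (signalFourier f p) ω ξ) ≤ b) :
    ∫⁻ s, ‖testedNoise f σ t τ E ψ k j s‖ₑ ^ 2 ∂P ≤ b := by
  have hL := memLp_testedNoise hf hK1 hK hmodel hψm hψ k j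
  have hp := measurable_testedNoise_factor hf hmodel hψm k j
  have h := (integral_testedNoise hf hK1 hK hmodel hψm hψ k j j).2
  simp_rw [enorm_sq_eq_ofReal]
  rw [← ofReal_integral_eq_lintegral_ofReal (hL.integrable_norm_pow two_ne_zero)
    (.of_forall fun s => by positivity)]
  have e : ENNReal.ofReal (∫ s, ‖testedNoise f σ t τ E ψ k j s‖ ^ 2 ∂P)
      = ‖∫ s, testedNoise f σ t τ E ψ k j s * conj (testedNoise f σ t τ E ψ k j s) ∂P‖ₑ := by
    simp_rw [Complex.mul_conj', ← Complex.ofReal_pow, integral_complex_ofReal]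
    rw [← ofReal_norm, Complex.norm_real,
      Real.norm_of_nonneg (integral_nonneg fun s => by positivity)]
  rw [e, h]
  have hcov : ∀ z : Plane × Plane, ∫ s, wickTerm σ k (fun a => E j a s) z.1
      * conj (wickTerm σ k (fun a => E j a s) z.2) ∂P = (wickCov σ k z.1 z.2 : ℂ) := fun z => by
    rw [← integral_wickTerm_mul_conj (hmodel.whiteNoise j) k]
    refine integral_congr_ae ?_
    filter_upwards [wickTerm_noise_ae (hmodel.noiseFourier j) σ k z.1,
      wickTerm_noise_ae (hmodel.noiseFourier j) σ k z.2] with s h1 h2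
    rw [h1, h2]
  simp_rw [hcov]
  have hcw : Measurable fun x : S × Plane × Plane => ‖ψ x.2.1‖ₑ * ‖ψ x.2.2‖ₑ
      * ENNReal.ofReal (covWeight σ k (signalFourier f (t j x.1, τ j x.1)) x.2.1 x.2.2) := by
    have h1 := hmodel.measurable_t j
    have h2 := hmodel.measurable_τ j
    have h3 := (measurable_signalTerm_signalFourier hf k).comp
      (f := fun x : S × Plane × Plane => (x.2.1, t j x.1, τ j x.1)) (by fun_prop)
    have h4 := (measurable_signalTerm_signalFourier hf k).comp
      (f := fun x : S × Plane × Plane => (x.2.2, t j x.1, τ j x.1)) (by fun_prop)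
    have h5 := (measurable_wickCov σ k).comp (measurable_snd : Measurable fun x : S × _ => x.2)
    unfold covWeight
    exact (by fun_prop : Measurable fun x : S × Plane × Plane => ‖ψ x.2.1‖ₑ * ‖ψ x.2.2‖ₑ).mul
      ((h3.norm.mul h4.norm).mul h5.abs).ennreal_ofReal
  calc _ ≤ ∫⁻ z : Plane × Plane, ‖(∫ s, (ψ z.1 * signalTerm k (signalFourier f (t j s, τ j s)) z.1)
            * conj (ψ z.2 * signalTerm k (signalFourier f (t j s, τ j s)) z.2) ∂P)
          * (wickCov σ k z.1 z.2 : ℂ)‖ₑ := enorm_integral_le_lintegral_enorm _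
    _ ≤ ∫⁻ z : Plane × Plane, ∫⁻ s, ‖ψ z.1‖ₑ * ‖ψ z.2‖ₑ
          * ENNReal.ofReal (covWeight σ k (signalFourier f (t j s, τ j s)) z.1 z.2) ∂P := by
        refine lintegral_mono fun z => ?_
        rw [enorm_mul]
        refine (mul_le_mul_left (enorm_integral_le_lintegral_enorm _) _).trans ?_
        rw [← lintegral_mul_const' _ _ (by finiteness)]
        refine lintegral_mono fun s => le_of_eq ?_
        rw [enorm_mul, RCLike.enorm_conj, enorm_mul, enorm_mul, covWeight,
          ENNReal.ofReal_mul (by positivity), ENNReal.ofReal_mul (by positivity), ofReal_norm,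
          ofReal_norm, ← Real.norm_eq_abs, ofReal_norm]
        simp only [← ofReal_norm, Complex.norm_real]
        ring
    _ = ∫⁻ s, (∫⁻ ω : Plane, ∫⁻ ξ : Plane, ‖ψ ω‖ₑ * ‖ψ ξ‖ₑ
          * ENNReal.ofReal (covWeight σ k (signalFourier f (t j s, τ j s)) ω ξ)) ∂P := by
        rw [← lintegral_prod_symm _ hcw.aemeasurable, lintegral_prod _ hcw.aemeasurable]
        refine lintegral_congr fun s => ?_
        have hcs := hcw.comp (measurable_prodMk_left (x := s))
        rw [Measure.volume_eq_prod]
        exact lintegral_prod _ hcs.aemeasurable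
    _ ≤ ∫⁻ _, b ∂P := lintegral_mono fun s => hb _
    _ = b := by simp

/-- The noise terms of different observations are uncorrelated, so that averaging over `M`
observations reduces the variance by the factor `M`. -/
lemma lintegral_sum_testedNoise_le (k : NoiseKind) {b : ℝ≥0∞}
    (hb : ∀ p, ∫⁻ ω, ∫⁻ ξ, ‖ψ ω‖ₑ * ‖ψ ξ‖ₑ
      * ENNReal.ofReal (covWeight σ k (signalFourier f p) ω ξ) ≤ b) :
    ∫⁻ s, ‖∑ j, testedNoise f σ t τ E ψ k j s‖ₑ ^ 2 ∂P ≤ M * b := by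
  rw [lintegral_enorm_sum_sq (memLp_testedNoise hf hK1 hK hmodel hψm hψ k) fun i j hij =>
    integral_testedNoise_of_ne hf hK1 hK hmodel hψm hψ k hij]
  refine (Finset.sum_le_card_nsmul _ _ b fun j _ =>
    lintegral_testedNoise_le hf hK1 hK hmodel hψm hψ k j hb).trans ?_
  simp

/-- The sum of all noise terms, averaged over the observations. -/
lemma lintegral_mean_testedNoise_le {b : ℝ≥0∞}
    (hb : ∀ k p, ∫⁻ ω, ∫⁻ ξ, ‖ψ ω‖ₑ * ‖ψ ξ‖ₑ
      * ENNReal.ofReal (covWeight σ k (signalFourier f p) ω ξ) ≤ b) :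
    ∫⁻ s, ‖(M : ℂ)⁻¹ * ∑ j, ∑ k, testedNoise f σ t τ E ψ k j s‖ₑ ^ 2 ∂P ≤ 49 * b / M := by
  obtain rfl | hM := Nat.eq_zero_or_pos M
  · simp
  -- there are seven kinds of noise terms
  have hsq : ∀ Z : NoiseKind → ℂ, ‖∑ k, Z k‖ₑ ^ 2 ≤ 7 * ∑ k, ‖Z k‖ₑ ^ 2 := fun Z => by
    simp_rw [enorm_sq_eq_ofReal]
    rw [← ENNReal.ofReal_sum_of_nonneg fun i _ => by positivity,
      show (7 : ℝ≥0∞) = ENNReal.ofReal 7 by simp, ← ENNReal.ofReal_mul (by norm_num)]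
    refine ENNReal.ofReal_le_ofReal ?_
    calc ‖∑ k, Z k‖ ^ 2 ≤ (∑ k, ‖Z k‖) ^ 2 := by gcongr; exact norm_sum_le _ _
      _ ≤ (Finset.univ : Finset NoiseKind).card * ∑ k, ‖Z k‖ ^ 2 := sq_sum_le_card_mul_sum_sq
      _ = 7 * ∑ k, ‖Z k‖ ^ 2 := by simp
  have hm : ∀ k, AEMeasurable (fun s => ‖∑ j, testedNoise f σ t τ E ψ k j s‖ₑ ^ 2) P := fun k =>
    (Finset.aestronglyMeasurable_fun_sum _ fun j _ =>
      (memLp_testedNoise hf hK1 hK hmodel hψm hψ k j).1).enorm.pow_const 2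
  have hMe : ‖(M : ℂ)⁻¹‖ₑ = (M : ℝ≥0∞)⁻¹ := by
    rw [enorm_inv (by exact_mod_cast hM.ne')]
    simp [← ofReal_norm]
  have hM0 : (M : ℝ≥0∞) ≠ 0 := by exact_mod_cast hM.ne'
  calc _ ≤ ∫⁻ s, (M : ℝ≥0∞)⁻¹ ^ 2 * (7 * ∑ k, ‖∑ j, testedNoise f σ t τ E ψ k j s‖ₑ ^ 2) ∂P := by
        refine lintegral_mono fun s => ?_
        rw [enorm_mul, mul_pow, hMe, Finset.sum_comm]
        gcongr
        exact hsq _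
    _ = (M : ℝ≥0∞)⁻¹ ^ 2 * (7 * ∑ k, ∫⁻ s, ‖∑ j, testedNoise f σ t τ E ψ k j s‖ₑ ^ 2 ∂P) := by
        rw [lintegral_const_mul' _ _ (by finiteness), lintegral_const_mul' _ _ (by finiteness),
          lintegral_finsetSum' _ fun k _ => hm k]
    _ ≤ (M : ℝ≥0∞)⁻¹ ^ 2 * (7 * ∑ _k : NoiseKind, M * b) := by
        gcongr with k
        exact lintegral_sum_testedNoise_le hf hK1 hK hmodel hψm hψ k (hb k)
    _ = (M : ℝ≥0∞)⁻¹ * M * (49 * b * (M : ℝ≥0∞)⁻¹) := by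
        simp only [Finset.sum_const, Finset.card_univ, nsmul_eq_mul]
        simp
        ring
    _ = 49 * b / M := by
        rw [ENNReal.inv_mul_cancel hM0 (by finiteness), one_mul, div_eq_mul_inv]

end Noise

/-! ### The variance of the smoothed noise -/

section KernelVariance

open scoped ENNReal

variable {L : ℝ}

lemma wideGaussian_nonneg (L : ℝ) (v : Plane) : 0 ≤ wideGaussian L v := by
  unfold wideGaussian; positivity

lemma wideGaussian_le (L : ℝ) (v : Plane) : wideGaussian L v ≤ (2 * Real.pi * L ^ 2)⁻¹ := by
  unfold wideGaussian
  refine mul_le_of_le_one_right (by positivity) (Real.exp_le_one_iff.2 ?_)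
  rw [neg_mul, neg_nonpos]; positivity

lemma continuous_testKernel_right (L : ℝ) (ζ : Plane) : Continuous (testKernel L ζ) :=
  (continuous_testKernel (L := L)).comp (g := fun p : Plane × Plane => testKernel L p.1 p.2)
    (f := fun u => (ζ, u)) (by fun_prop)

lemma lintegral_testKernel_le (hL : 0 < L) {R : ℝ} {ζ : Plane} (hζ : ‖ζ‖ ≤ R) :
    ∫⁻ u, ‖testKernel L ζ u‖ₑ ≤ ENNReal.ofReal ((4 + 5 * R / L) * 2) := by
  have hR : 0 ≤ R := (norm_nonneg _).trans hζ
  have hi : Integrable fun u => (4 + 5 * R / L) * wideGaussian L (ζ - u) :=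
    ((integrable_wideGaussian hL).comp_sub_left ζ).const_mul _
  calc ∫⁻ u, ‖testKernel L ζ u‖ₑ
      ≤ ∫⁻ u, ENNReal.ofReal ((4 + 5 * R / L) * wideGaussian L (ζ - u)) := by
        refine lintegral_mono fun u => ?_
        rw [← ofReal_norm]
        exact ENNReal.ofReal_le_ofReal (abs_testKernel_le hL hζ u)
    _ = ENNReal.ofReal ((4 + 5 * R / L) * 2) := by
        rw [← ofReal_integral_eq_lintegral_ofReal hi (.of_forall fun u =>
          mul_nonneg (by positivity) (wideGaussian_nonneg L _)), integral_const_mul,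
          integral_sub_left_eq_self (wideGaussian L) volume ζ, integral_wideGaussian hL]

lemma enorm_testKernel_le (hL : 0 < L) {R : ℝ} {ζ : Plane} (hζ : ‖ζ‖ ≤ R) (u : Plane) :
    ‖testKernel L ζ u‖ₑ ≤ ENNReal.ofReal ((4 + 5 * R / L) * (2 * Real.pi * L ^ 2)⁻¹) := by
  have hR : 0 ≤ R := (norm_nonneg _).trans hζ
  rw [← ofReal_norm]
  refine ENNReal.ofReal_le_ofReal ((abs_testKernel_le hL hζ u).trans ?_)
  gcongr
  exact wideGaussian_le L _

lemma integrable_testKernel (hL : 0 < L) (ζ : Plane) : Integrable (testKernel L ζ) :=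
  ⟨(continuous_testKernel_right L ζ).aestronglyMeasurable,
    (lintegral_testKernel_le hL le_rfl).trans_lt ENNReal.ofReal_lt_top⟩

/-- The quadratic form of the noise covariances at the kernel of the estimator. For `L ≥ 1` this
uses the decay of the covariances in frequency; for `L ≤ 1` their boundedness is enough. -/
lemma exists_testKernel_covWeight_bound {K : ℝ} (hK1 : 1 ≤ K) {Φ : ℝ≥0∞} (hΦ : Φ < ∞) (R : ℝ) :
    ∃ C : ℝ, 0 ≤ C ∧ ∀ (F : ℝ → ℂ), Measurable F → (∀ a, F (-a) = conj (F a)) →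
      (∀ a, ‖F a‖ ≤ K) → ∫⁻ x, ENNReal.ofReal (‖F x‖ ^ 2) ≤ Φ →
      ∀ (σ L : ℝ), 0 < L → ∀ ζ : Plane, ‖ζ‖ ≤ R → ∀ k : NoiseKind,
        ∫⁻ ω, ∫⁻ ξ, ‖testKernel L ζ ω‖ₑ * ‖testKernel L ζ ξ‖ₑ
          * ENNReal.ofReal (covWeight σ k F ω ξ)
          ≤ ENNReal.ofReal (C * (max (σ ^ 2) (σ ^ 6) / L ^ 2)) := by
  set Q := (covConst K Φ).toReal with hQ
  have hQ0 : 0 ≤ Q := ENNReal.toReal_nonneg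
  refine ⟨(4 + 5 * |R|) ^ 2 * (24 * K ^ 4 + Q), by positivity,
    fun F hF hneg hK hΦF σ L hL ζ hζ k => ?_⟩
  have hζ' : ‖ζ‖ ≤ |R| := hζ.trans (le_abs_self R)
  set m := max (σ ^ 2) (σ ^ 6) with hm
  have hm0 : 0 ≤ m := le_max_of_le_left (sq_nonneg σ)
  have hψm : Measurable fun u => ‖testKernel L ζ u‖ₑ :=
    (continuous_testKernel_right L ζ).measurable.enorm
  have hI := lintegral_testKernel_le hL hζ'
  obtain hL1 | hL1 := le_total L 1
  · have hc : 4 + 5 * |R| / L ≤ (4 + 5 * |R|) / L := by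
      rw [add_div]
      gcongr
      rw [le_div_iff₀ hL]
      linarith
    calc ∫⁻ ω, ∫⁻ ξ, ‖testKernel L ζ ω‖ₑ * ‖testKernel L ζ ξ‖ₑ
          * ENNReal.ofReal (covWeight σ k F ω ξ)
        ≤ ∫⁻ ω, ∫⁻ ξ, ‖testKernel L ζ ω‖ₑ * ‖testKernel L ζ ξ‖ₑ
          * ENNReal.ofReal (m * (6 * K ^ 4)) := by
          refine lintegral_mono fun ω => lintegral_mono fun ξ => ?_
          gcongr
          exact covWeight_le hneg hK1 hK σ k ω ξ
      _ = (∫⁻ ω, ‖testKernel L ζ ω‖ₑ) * (∫⁻ ω, ‖testKernel L ζ ω‖ₑ)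
            * ENNReal.ofReal (m * (6 * K ^ 4)) := by
          simp_rw [lintegral_mul_const' _ _ (ENNReal.ofReal_ne_top (r := m * (6 * K ^ 4)))]
          congr 1
          simp_rw [lintegral_const_mul _ hψm]
          rw [lintegral_mul_const _ hψm]
      _ ≤ ENNReal.ofReal ((4 + 5 * |R|) / L * 2) * ENNReal.ofReal ((4 + 5 * |R|) / L * 2)
            * ENNReal.ofReal (m * (6 * K ^ 4)) := by
          have h : ENNReal.ofReal ((4 + 5 * |R| / L) * 2)
              ≤ ENNReal.ofReal ((4 + 5 * |R|) / L * 2) := by gcongr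
          gcongr <;> exact hI.trans h
      _ = ENNReal.ofReal ((4 + 5 * |R|) ^ 2 * (24 * K ^ 4) * (m / L ^ 2)) := by
          rw [← ENNReal.ofReal_mul (by positivity), ← ENNReal.ofReal_mul (by positivity)]
          congr 1
          field_simp
          ring
      _ ≤ _ := by
          gcongr
          linarith
  · have hc : 4 + 5 * |R| / L ≤ 4 + 5 * |R| := by
      gcongr
      exact div_le_self (by positivity) hL1
    have hpi : (2 * Real.pi * L ^ 2)⁻¹ * 2 ≤ 1 / L ^ 2 := by
      rw [mul_inv, mul_right_comm, one_div]
      refine mul_le_of_le_one_left (by positivity) ?_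
      rw [inv_mul_le_iff₀ (by positivity)]
      linarith [Real.pi_gt_three]
    calc _ ≤ ENNReal.ofReal ((4 + 5 * |R| / L) * (2 * Real.pi * L ^ 2)⁻¹)
            * (∫⁻ ω, ‖testKernel L ζ ω‖ₑ) * (ENNReal.ofReal m * covConst K Φ) :=
          lintegral_covWeight_le hF hneg hK1 hK hΦF σ k hψm (enorm_testKernel_le hL hζ')
      _ ≤ ENNReal.ofReal ((4 + 5 * |R| / L) * (2 * Real.pi * L ^ 2)⁻¹)
            * ENNReal.ofReal ((4 + 5 * |R| / L) * 2) * (ENNReal.ofReal m * ENNReal.ofReal Q) := by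
          rw [hQ, ENNReal.ofReal_toReal (covConst_lt_top K hΦ).ne]
          gcongr
      _ = ENNReal.ofReal ((4 + 5 * |R| / L) ^ 2 * Q * (((2 * Real.pi * L ^ 2)⁻¹ * 2) * m)) := by
          rw [← ENNReal.ofReal_mul (by positivity), ← ENNReal.ofReal_mul (by positivity),
            ← ENNReal.ofReal_mul (by positivity)]
          congr 1
          ring
      _ ≤ ENNReal.ofReal ((4 + 5 * |R|) ^ 2 * (24 * K ^ 4 + Q) * (1 / L ^ 2 * m)) := by
          gcongr
          have : 0 ≤ K ^ 4 := by positivity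
          linarith
      _ = _ := by rw [one_div_mul_eq_div]

end KernelVariance

/-! ### The law of the dilations -/

section Uniform

open scoped ENNReal

variable {S : Type*} [MeasurableSpace S] {P : Measure S}

lemma map_of_isUniform {X : S → ℝ} {a b : ℝ} (hX : pdf.IsUniform X (Set.Icc a b) P volume) :
    Measure.map X P = (ENNReal.ofReal (b - a))⁻¹ • volume.restrict (Set.Icc a b) := by
  rw [hX, ProbabilityTheory.cond, Real.volume_Icc]

lemma integral_of_isUniform {X : S → ℝ} {a b : ℝ} (hm : Measurable X)
    (hX : pdf.IsUniform X (Set.Icc a b) P volume) (hab : a < b) {V : Type*} [NormedAddCommGroup V]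
    [NormedSpace ℝ V] [SecondCountableTopologyEither ℝ V] {g : ℝ → V} (hg : Continuous g) :
    ∫ s, g (X s) ∂P = (b - a)⁻¹ • ∫ x in a..b, g x := by
  rw [← integral_map hm.aemeasurable hg.aestronglyMeasurable, map_of_isUniform hX,
    integral_smul_measure, integral_Icc_eq_integral_Ioc,
    intervalIntegral.integral_of_le hab.le, ENNReal.toReal_inv,
    ENNReal.toReal_ofReal (by linarith)]

lemma mem_Icc_of_isUniform {X : S → ℝ} {a b : ℝ} (hm : Measurable X)
    (hX : pdf.IsUniform X (Set.Icc a b) P volume) : ∀ᵐ s ∂P, X s ∈ Set.Icc a b := by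
  refine ae_of_ae_map hm.aemeasurable ?_
  rw [map_of_isUniform hX]
  exact Measure.ae_smul_measure (ae_restrict_mem measurableSet_Icc) _

variable [IsProbabilityMeasure P]

omit [IsProbabilityMeasure P] in
/-- A centred uniform variable of variance `η²` is uniform on `[-√3 η, √3 η]`. -/
lemma isUniform_endpoints {X : S → ℝ} {a b η : ℝ} (hm : Measurable X)
    (hX : pdf.IsUniform X (Set.Icc a b) P volume) (hab : a < b) (hη : 0 < η)
    (hmean : ∫ s, X s ∂P = 0) (hvar : variance X P = η ^ 2) : a = -(√3 * η) ∧ b = √3 * η := by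
  have hba : b - a ≠ 0 := by linarith
  have h1 := integral_of_isUniform hm hX hab continuous_id
  simp only [id] at h1
  rw [hmean, integral_id, smul_eq_mul] at h1
  have ha : a = -b := by
    have h : (b ^ 2 - a ^ 2) / 2 = 0 := by
      have := h1.symm
      rw [mul_eq_zero] at this
      exact this.resolve_left (inv_ne_zero hba)
    have h' : (b - a) * (b + a) = 0 := by linarith
    have := (mul_eq_zero.1 h').resolve_left hba
    linarith
  have h2 := integral_of_isUniform hm hX hab (continuous_pow 2)
  rw [variance_eq_integral hm.aemeasurable, hmean] at hvar
  simp only [sub_zero] at hvar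
  rw [hvar, integral_pow, smul_eq_mul, ha] at h2
  have hb : 0 < b := by linarith
  have hb2 : b ^ 2 = 3 * η ^ 2 := by
    norm_num at h2
    field_simp at h2
    ring_nf at h2 ⊢
    nlinarith
  have hb3 : b = √3 * η := by
    rw [← abs_of_pos hb, ← abs_of_pos (by positivity : 0 < √3 * η), ← sq_eq_sq_iff_abs_eq_abs,
      mul_pow, Real.sq_sqrt (by norm_num), hb2]
  exact ⟨by rw [ha, hb3], hb3⟩

end Uniform

section Model

open scoped ENNReal

variable {S : Type*} [MeasurableSpace S] {P : Measure S} [IsProbabilityMeasure P]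
  {f : ℝ → ℝ} {η σ : ℝ} {M : ℕ} {t τ : Fin M → S → ℝ} {W : Fin M → L2Window → S → ℝ}
  {E : Fin M → ℝ → S → ℂ} (hmodel : NoisyDilationModel P f η σ M t τ W E) (hη : 0 < η)
include hmodel hη

omit [IsProbabilityMeasure P] in
lemma isUniform_dilation (j : Fin M) :
    pdf.IsUniform (τ j) (Set.Icc (-(√3 * η)) (√3 * η)) P volume := by
  obtain ⟨a, b, hab, h⟩ := hmodel.uniform_τ j
  obtain ⟨ha, hb⟩ := isUniform_endpoints (hmodel.measurable_τ j) h hab hη (hmodel.mean_τ j)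
    (hmodel.var_τ j)
  rwa [ha, hb] at h

omit [IsProbabilityMeasure P] in
lemma abs_dilation_le : ∀ᵐ s ∂P, ∀ j, |τ j s| ≤ √3 * η := by
  refine ae_all_iff.2 fun j => ?_
  filter_upwards [mem_Icc_of_isUniform (hmodel.measurable_τ j) (isUniform_dilation hmodel hη j)]
    with s hs
  exact abs_le.2 hs

variable {B : Plane → ℂ} (hB : BoundedC3 B)
include hB

omit [IsProbabilityMeasure P] in
/-- The fundamental theorem of calculus, as the profile is a derivative in `s = 1 - τ`. -/
lemma integral_dilationProfile (j : Fin M) (ζ : Plane) :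
    ∫ s, dilationProfile B ζ (1 - τ j s) ∂P = meanProfile η B ζ := by
  have hc : 0 < √3 * η := by positivity
  have hcont : Continuous (dilationProfile B ζ) :=
    (continuous_dilationProfile hB).comp (g := fun p : Plane × ℝ => dilationProfile B p.1 p.2)
      (f := fun x => (ζ, x)) (by fun_prop)
  have h := integral_of_isUniform (hmodel.measurable_τ j) (isUniform_dilation hmodel hη j)
    (by linarith) (g := fun x => dilationProfile B ζ (1 - x)) (by fun_prop)
  rw [h, intervalIntegral.integral_comp_sub_left (dilationProfile B ζ),
    intervalIntegral.integral_eq_sub_of_hasDerivAt (fun x _ => hasDerivAt_dilationProfile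
      (hB.1.differentiable (by norm_num)) ζ x) (hcont.intervalIntegrable _ _), meanProfile,
    constC1, Complex.real_smul]
  have e : √3 * η - -(√3 * η) = 2 * √3 * η := by ring
  rw [e]
  push_cast
  simp only [sub_neg_eq_add]

/-- Averaging over `M` independent dilations. -/
lemma lintegral_mean_dilationProfile_le (hη2 : η ^ 2 ≤ 1 / 12) {ζ : Plane} {K : ℝ} (hK0 : 0 ≤ K)
    (hK : ∀ s ∈ Set.Icc (1 / 2 : ℝ) (3 / 2), ∀ s' ∈ Set.Icc (1 / 2 : ℝ) (3 / 2),
        ‖dilationProfile B ζ s - dilationProfile B ζ s'‖ ≤ K * |s - s'|) (hM : 1 ≤ M) :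
    ∫⁻ s, ‖meanProfile η B ζ - (M : ℂ)⁻¹ * ∑ j, dilationProfile B ζ (1 - τ j s)‖ₑ ^ 2 ∂P
      ≤ ENNReal.ofReal (12 * K ^ 2 * (η ^ 2 / M)) := by
  obtain ⟨hc, hc2⟩ := eta_bounds hη hη2
  have hcont : Continuous (dilationProfile B ζ) :=
    (continuous_dilationProfile hB).comp (g := fun p : Plane × ℝ => dilationProfile B p.1 p.2)
      (f := fun x => (ζ, x)) (by fun_prop)
  have hcm : Measurable fun p : ℝ × ℝ => dilationProfile B ζ (1 - p.2) := by fun_prop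
  have hconj : Measurable (starRingEnd ℂ) := Complex.continuous_conj.measurable
  set m := meanProfile η B ζ with hm
  have hτ := hmodel.measurable_τ
  have hZm : ∀ j, Measurable fun s => dilationProfile B ζ (1 - τ j s) := fun j =>
    hcont.measurable.comp (by fun_prop)
  -- distance to the undilated profile
  have hd1 : ∀ᵐ s ∂P, ∀ j, ‖dilationProfile B ζ (1 - τ j s) - dilationProfile B ζ 1‖
      ≤ K * (√3 * η) := by
    filter_upwards [abs_dilation_le hmodel hη] with s hs j
    obtain ⟨h1, h2⟩ := abs_le.1 (hs j)
    refine (hK _ ⟨by linarith, by linarith⟩ 1 ⟨by norm_num, by norm_num⟩).trans ?_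
    gcongr
    rw [sub_sub_cancel_left, abs_neg]
    exact hs j
  have hint : ∀ j, Integrable (fun s => dilationProfile B ζ (1 - τ j s)) P := fun j => by
    refine Integrable.of_bound (hZm j).aestronglyMeasurable
      (‖dilationProfile B ζ 1‖ + K * (√3 * η)) ?_
    filter_upwards [hd1] with s hs
    have := norm_sub_norm_le (dilationProfile B ζ (1 - τ j s)) (dilationProfile B ζ 1)
    linarith [hs j]
  have hmean : ∀ j, ∫ s, (m - dilationProfile B ζ (1 - τ j s)) ∂P = 0 := fun j => by
    rw [integral_sub (integrable_const _) (hint j), integral_dilationProfile hmodel hη hB j ζ]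
    simp [hm]
  have hm1 : ‖m - dilationProfile B ζ 1‖ ≤ K * (√3 * η) := by
    have j : Fin M := ⟨0, hM⟩
    have e : m - dilationProfile B ζ 1
        = ∫ s, (dilationProfile B ζ (1 - τ j s) - dilationProfile B ζ 1) ∂P := by
      rw [integral_sub (hint j) (integrable_const _), integral_dilationProfile hmodel hη hB j ζ]
      simp [hm]
    rw [e]
    refine (norm_integral_le_of_norm_le_const (C := K * (√3 * η)) ?_).trans (by simp)
    filter_upwards [hd1] with s hs using hs j
  have hd : ∀ j, ∀ᵐ s ∂P, ‖m - dilationProfile B ζ (1 - τ j s)‖ ≤ 2 * (K * (√3 * η)) := fun j => by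
    filter_upwards [hd1] with s hs
    rw [← sub_sub_sub_cancel_right m _ (dilationProfile B ζ 1)]
    exact (norm_sub_le _ _).trans (by linarith [hs j])
  have hL2 : ∀ j, MemLp (fun s => m - dilationProfile B ζ (1 - τ j s)) 2 P := fun j =>
    MemLp.of_bound (measurable_const.sub (hZm j)).aestronglyMeasurable _ (hd j)
  have horth : ∀ i j, i ≠ j → ∫ s, (m - dilationProfile B ζ (1 - τ i s))
      * conj (m - dilationProfile B ζ (1 - τ j s)) ∂P = 0 := fun i j hij => by
    have h := ((hmodel.indep_transform.indepFun hij).comp (measurable_const.sub hcm)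
      (hconj.comp (measurable_const.sub hcm))).integral_fun_mul_eq_mul_integral (hL2 i).1
      (hL2 j).star.1
    refine h.trans ?_
    refine mul_eq_zero_of_left ?_ _
    exact hmean i
  have hM0 : (M : ℂ) ≠ 0 := by exact_mod_cast (by omega : M ≠ 0)
  have hMr : (0 : ℝ) < M := by exact_mod_cast hM
  have e : ∀ s, m - (M : ℂ)⁻¹ * ∑ j, dilationProfile B ζ (1 - τ j s)
      = (M : ℂ)⁻¹ * ∑ j, (m - dilationProfile B ζ (1 - τ j s)) := fun s => by
    rw [Finset.sum_sub_distrib, mul_sub]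
    simp [hM0]
  have hMe : ‖(M : ℂ)⁻¹‖ₑ ^ 2 = ENNReal.ofReal ((M : ℝ)⁻¹ ^ 2) := by
    rw [enorm_sq_eq_ofReal]
    simp
  simp_rw [e, enorm_mul, mul_pow]
  rw [lintegral_const_mul' _ _ (by finiteness), lintegral_enorm_sum_sq hL2 horth, hMe]
  calc _ ≤ ENNReal.ofReal ((M : ℝ)⁻¹ ^ 2) * ∑ _j : Fin M, ENNReal.ofReal (12 * K ^ 2 * η ^ 2) := by
        gcongr with j
        calc _ ≤ ∫⁻ _, ENNReal.ofReal (12 * K ^ 2 * η ^ 2) ∂P := by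
              refine lintegral_mono_ae ?_
              filter_upwards [hd j] with s hs
              rw [enorm_sq_eq_ofReal]
              refine ENNReal.ofReal_le_ofReal ?_
              calc _ ≤ (2 * (K * (√3 * η))) ^ 2 := by gcongr
                _ = 4 * K ^ 2 * √3 ^ 2 * η ^ 2 := by ring
                _ = _ := by rw [Real.sq_sqrt (by norm_num)]; ring
          _ = _ := by simp
    _ = _ := by
        rw [Finset.sum_const, Finset.card_univ, Fintype.card_fin, nsmul_eq_mul,
          ← ENNReal.ofReal_natCast, ← ENNReal.ofReal_mul (by positivity),
          ← ENNReal.ofReal_mul (by positivity)]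
        congr 1
        field_simp

end Model

/-! ### Signal part and noise part of the smoothed centred bispectrum -/

section Decomposition

variable {M : ℕ}

lemma noiseCentering_eq (σ : ℝ) (Y : Fin M → ℝ → ℂ) (u : Plane) :
    noiseCentering σ Y u
      = (M : ℂ)⁻¹ * ∑ j, ∑ i, noiseKernel σ (freq i u) * factor (Y j) i u := by
  simp only [noiseCentering, empiricalMean, Fin.sum_univ_three, Finset.sum_add_distrib, freq,
    factor, Matrix.cons_val_zero, Matrix.cons_val_one, Matrix.cons_val, noiseKernel_neg, map_mul,
    map_inv₀, Complex.conj_natCast, map_sum, ← Finset.mul_sum]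
  ring

/-- The centred bispectrum of signal plus noise: clean bispectra plus Wick monomials. -/
lemma centeredBispectrum_add (σ : ℝ) (F Y : Fin M → ℝ → ℂ) (u : Plane) :
    centeredBispectrum σ (fun j a => F j a + Y j a) u
      = (M : ℂ)⁻¹ * ∑ j, (tripleProduct (F j) u
          + ∑ k, signalTerm k (F j) u * wickTerm σ k (Y j) u) := by
  rw [centeredBispectrum, noiseCentering_eq, ← mul_sub, ← Finset.sum_sub_distrib]
  simp only [tripleProduct_add_sub]

lemma gaussianWeight_nonneg (L : ℝ) (u : Plane) : 0 ≤ gaussianWeight L u := (Real.exp_pos _).le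

lemma continuous_gaussianWeight (L : ℝ) : Continuous (gaussianWeight L) := by
  unfold gaussianWeight; fun_prop

lemma integrable_gaussianWeight {L : ℝ} (hL : 0 < L) : Integrable (gaussianWeight L) := by
  have h := (integrable_wideGaussian (L := √2 * L) (by positivity)).const_mul
    (2 * Real.pi * (√2 * L) ^ 2)
  refine h.congr (.of_forall fun u => ?_)
  have e : 4 * (√2 * L) ^ 2 = 8 * L ^ 2 := by
    rw [mul_pow, Real.sq_sqrt (by norm_num)]; ring
  simp only [wideGaussian, gaussianWeight]
  rw [e]
  field_simp

/-- Smoothing a function of controlled growth gives a locally bounded function. -/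
lemma exists_smoothDeriv_bound {L : ℝ} (hL : 0 < L) {G : Plane → ℂ}
    (hGm : AEStronglyMeasurable G) (hG : Integrable (fun u => ‖G u‖ * gaussianWeight L u))
    (R : ℝ) : ∃ K : ℝ, ∀ ζ : Plane, ‖ζ‖ ≤ R → ‖smoothDeriv L G ζ‖ ≤ K := by
  set c := (4 + 5 * |R| / L) * ((2 * Real.pi * L ^ 2)⁻¹ * Real.exp ((4 * L ^ 2)⁻¹ * |R| ^ 2))
  refine ⟨∫ u, c * (‖G u‖ * gaussianWeight L u), fun ζ hζ => ?_⟩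
  have hζ' : ‖ζ‖ ≤ |R| := hζ.trans (le_abs_self R)
  rw [smoothDeriv_eq hL hGm hG]
  refine norm_integral_le_of_norm_le (hG.const_mul c) (.of_forall fun u => ?_)
  rw [norm_mul, Complex.norm_real, Real.norm_eq_abs]
  calc ‖G u‖ * |testKernel L ζ u| ≤ ‖G u‖ * ((4 + 5 * |R| / L) * ((2 * Real.pi * L ^ 2)⁻¹
        * Real.exp ((4 * L ^ 2)⁻¹ * |R| ^ 2) * gaussianWeight L u)) := by
        gcongr
        exact (abs_testKernel_le hL hζ' u).trans
          (mul_le_mul_of_nonneg_left (wideGaussian_le_weight hL hζ' u) (by positivity))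
    _ = _ := by ring

end Decomposition

section Model

open scoped ENNReal

variable {S : Type*} [MeasurableSpace S] {P : Measure S} [IsProbabilityMeasure P]
  {f : ℝ → ℝ} {η σ L : ℝ} {M : ℕ} {t τ : Fin M → S → ℝ} {W : Fin M → L2Window → S → ℝ}
  {E : Fin M → ℝ → S → ℂ}

/-- Samples for which the dilations are at most `1/2` and the noise terms are integrable against a
Gaussian weight, so that smoothing is given by absolutely convergent integrals. They have
probability one. -/
structure IsRegularSample (f : ℝ → ℝ) (σ L : ℝ) (t τ : Fin M → S → ℝ) (E : Fin M → ℝ → S → ℂ)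
    (s : S) : Prop where
  abs_dilation_le : ∀ j, |τ j s| ≤ 1 / 2
  integrable : ∀ j k, Integrable fun u : Plane => ‖signalTerm k (signalFourier f (t j s, τ j s)) u
    * wickTerm σ k (fun a => E j a s) u‖ * gaussianWeight L u

/-- The centred bispectrum of the observations. -/
noncomputable def sampleBispectrum (f : ℝ → ℝ) (σ : ℝ) (t τ : Fin M → S → ℝ)
    (E : Fin M → ℝ → S → ℂ) (s : S) : Plane → ℂ :=
  centeredBispectrum σ (fun j => obsFourier f (t j s) (τ j s) (fun ω => E j ω s))

lemma ae_isRegularSample (hf : Continuous (fourierHat f)) {K : ℝ} (hK1 : 1 ≤ K)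
    (hK : ∀ p a, ‖signalFourier f p a‖ ≤ K) (hη : 0 < η) (hη2 : η ^ 2 ≤ 1 / 12) (hL : 0 < L)
    (hmodel : NoisyDilationModel P f η σ M t τ W E) :
    ∀ᵐ s ∂P, IsRegularSample f σ L t τ E s := by
  have hw := continuous_gaussianWeight L
  have h2 : ∀ᵐ s ∂P, ∀ j k, Integrable fun u : Plane =>
      gaussianWeight L u * signalTerm k (signalFourier f (t j s, τ j s)) u
        * wickTerm σ k (fun a => E j a s) u := by
    refine ae_all_iff.2 fun j => ae_all_iff.2 fun k => ?_
    have h := integrable_field (P := P) (μ := (volume : Measure Plane))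
      (p := fun u s => gaussianWeight L u * signalTerm k (signalFourier f (t j s, τ j s)) u)
      (c := fun u s => wickTerm σ k (fun a => E j a s) u) (q := fun u => gaussianWeight L u * K ^ 2)
      (measurable_testedNoise_factor hf hmodel hw.measurable k j)
      (measurable_wickTerm (hmodel.noiseFourier j).measurable σ k)
      ((integrable_gaussianWeight hL).mul_const _) (fun u s => ?_)
      (lintegral_wickTerm_sq_le (hmodel.whiteNoise j) (hmodel.noiseFourier j) k)
      ENNReal.ofReal_ne_top
    · exact h.prod_left_ae
    · rw [norm_mul, Complex.norm_real, Real.norm_of_nonneg (gaussianWeight_nonneg L u)]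
      exact mul_le_mul_of_nonneg_left (norm_signalTerm_le (signalFourier_neg f _) hK1 (hK _) k u)
        (gaussianWeight_nonneg L u)
  filter_upwards [abs_dilation_le hmodel hη, h2] with s h1 h2
  refine ⟨fun j => (h1 j).trans (eta_bounds hη hη2).2, fun j k => (h2 j k).norm.congr
    (.of_forall fun u => ?_)⟩
  simp only [norm_mul, Complex.norm_real, Real.norm_of_nonneg (gaussianWeight_nonneg L u)]
  ring

omit [MeasurableSpace S] in
lemma sampleBispectrum_eq {s : S} (hs : ∀ j, |τ j s| ≤ 1 / 2) (u : Plane) :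
    sampleBispectrum f σ t τ E s u
      = (M : ℂ)⁻¹ * ∑ j, ((((1 - τ j s) ^ 3 : ℝ) : ℂ) * bispectrum f ((1 - τ j s) • u)
          + ∑ k, signalTerm k (signalFourier f (t j s, τ j s)) u
            * wickTerm σ k (fun a => E j a s) u) := by
  have e : (fun j => obsFourier f (t j s) (τ j s) (fun ω => E j ω s))
      = fun j a => signalFourier f (t j s, τ j s) a + E j a s := by
    ext j a
    simp only [obsFourier, signalFourier, clampDilation_eq (hs j)]
  rw [sampleBispectrum, e, centeredBispectrum_add]
  refine congrArg _ (Finset.sum_congr rfl fun j _ => ?_)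
  rw [← tripleProduct_dilatedSignal f (t j s) (by linarith [(abs_le.1 (hs j)).2]), signalFourier,
    clampDilation_eq (hs j)]

omit [IsProbabilityMeasure P] in
lemma measurable_noise_terms (hf : Continuous (fourierHat f))
    (hmodel : NoisyDilationModel P f η σ M t τ W E) (j : Fin M) (k : NoiseKind) :
    Measurable fun z : Plane × S => signalTerm k (signalFourier f (t j z.2, τ j z.2)) z.1
      * wickTerm σ k (fun a => E j a z.2) z.1 := by
  have h := measurable_testedNoise_factor hf hmodel (ψ := fun _ => 1) measurable_const k j
  simp only [Complex.ofReal_one, one_mul] at h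
  exact h.mul (measurable_wickTerm (hmodel.noiseFourier j).measurable σ k)

omit [IsProbabilityMeasure P] in
/-- On a regular sample, the smoothed centred bispectrum splits into smoothed dilates of the
bispectrum and tested noise terms. -/
lemma smoothDeriv_sampleBispectrum (hf : Continuous (fourierHat f)) (hL : 0 < L)
    (hB : BoundedC3 (bispectrum f)) (hmodel : NoisyDilationModel P f η σ M t τ W E) {s : S}
    (hs : IsRegularSample f σ L t τ E s) :
    AEStronglyMeasurable (sampleBispectrum f σ t τ E s) ∧
    Integrable (fun u => ‖sampleBispectrum f σ t τ E s u‖ * gaussianWeight L u) ∧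
    ∀ ζ, smoothDeriv L (sampleBispectrum f σ t τ E s) ζ
      = (M : ℂ)⁻¹ * ∑ j, smoothDeriv L (fun ω => (((1 - τ j s) ^ 3 : ℝ) : ℂ)
            * bispectrum f ((1 - τ j s) • ω)) ζ
        + (M : ℂ)⁻¹ * ∑ j, ∑ k, testedNoise f σ t τ E (testKernel L ζ) k j s := by
  obtain ⟨C, hC0, hC, -⟩ := hB.norm_le
  have hBc := hB.1.continuous
  have hwc := continuous_gaussianWeight L
  have hA : ∀ j, Continuous fun ω => (((1 - τ j s) ^ 3 : ℝ) : ℂ)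
      * bispectrum f ((1 - τ j s) • ω) := fun j => by fun_prop
  have hAi : ∀ j, Integrable fun u => ‖(((1 - τ j s) ^ 3 : ℝ) : ℂ)
      * bispectrum f ((1 - τ j s) • u)‖ * gaussianWeight L u := fun j => by
    refine (integrable_gaussianWeight hL).bdd_mul (hA j).norm.aestronglyMeasurable
      (c := ‖(((1 - τ j s) ^ 3 : ℝ) : ℂ)‖ * C) (.of_forall fun u => ?_)
    rw [norm_norm, norm_mul]
    gcongr
    exact hC _
  have hN : ∀ j k, AEStronglyMeasurable fun u => signalTerm k (signalFourier f (t j s, τ j s)) u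
      * wickTerm σ k (fun a => E j a s) u := fun j k =>
    ((measurable_noise_terms hf hmodel j k).comp measurable_prodMk_right).aestronglyMeasurable
  have e : sampleBispectrum f σ t τ E s = fun u =>
      (M : ℂ)⁻¹ * ∑ j, ((((1 - τ j s) ^ 3 : ℝ) : ℂ) * bispectrum f ((1 - τ j s) • u)
          + ∑ k, signalTerm k (signalFourier f (t j s, τ j s)) u
            * wickTerm σ k (fun a => E j a s) u) :=
    funext fun u => sampleBispectrum_eq hs.abs_dilation_le u
  have hm : AEStronglyMeasurable (sampleBispectrum f σ t τ E s) := by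
    rw [e]
    exact aestronglyMeasurable_const.mul (Finset.aestronglyMeasurable_fun_sum _ fun j _ =>
      (hA j).aestronglyMeasurable.add (Finset.aestronglyMeasurable_fun_sum _ fun k _ => hN j k))
  have hi : Integrable (fun u => ‖sampleBispectrum f σ t τ E s u‖ * gaussianWeight L u) := by
    have hb : Integrable fun u => ‖(M : ℂ)⁻¹‖ * ∑ j, (‖(((1 - τ j s) ^ 3 : ℝ) : ℂ)
          * bispectrum f ((1 - τ j s) • u)‖ * gaussianWeight L u
        + ∑ k, ‖signalTerm k (signalFourier f (t j s, τ j s)) u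
            * wickTerm σ k (fun a => E j a s) u‖ * gaussianWeight L u) :=
      (integrable_finsetSum _ fun j _ => (hAi j).add
        (integrable_finsetSum _ fun k _ => hs.integrable j k)).const_mul _
    refine hb.mono' (hm.norm.mul hwc.aestronglyMeasurable) (.of_forall fun u => ?_)
    rw [norm_mul, norm_norm, Real.norm_of_nonneg (gaussianWeight_nonneg L u), e, norm_mul, mul_assoc]
    refine mul_le_mul_of_nonneg_left ?_ (norm_nonneg _)
    simp_rw [← Finset.sum_mul, ← add_mul]
    rw [← Finset.sum_mul]
    refine mul_le_mul_of_nonneg_right ?_ (gaussianWeight_nonneg L u)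
    exact (norm_sum_le _ _).trans (Finset.sum_le_sum fun j _ => (norm_add_le _ _).trans
      (add_le_add_right (norm_sum_le _ _) _))
  refine ⟨hm, hi, fun ζ => ?_⟩
  rw [smoothDeriv_eq hL hm hi]
  have i1 := fun j => integrable_mul_testKernel hL (hA j).aestronglyMeasurable (hAi j) ζ
  have i2 := fun j k => integrable_mul_testKernel hL (hN j k) (hs.integrable j k) ζ
  have i3 := fun j => integrable_finsetSum Finset.univ fun k _ => i2 j k
  have i4 : ∀ j, Integrable fun u => (((1 - τ j s) ^ 3 : ℝ) : ℂ) * bispectrum f ((1 - τ j s) • u)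
        * (testKernel L ζ u : ℂ)
      + ∑ k, signalTerm k (signalFourier f (t j s, τ j s)) u * wickTerm σ k (fun a => E j a s) u
        * (testKernel L ζ u : ℂ) := fun j => (i1 j).add (i3 j)
  simp_rw [fun j => smoothDeriv_eq hL (hA j).aestronglyMeasurable (hAi j) ζ]
  rw [← mul_add, ← Finset.sum_add_distrib]
  calc ∫ u, sampleBispectrum f σ t τ E s u * (testKernel L ζ u : ℂ)
      = ∫ u, (M : ℂ)⁻¹ * ∑ j, ((((1 - τ j s) ^ 3 : ℝ) : ℂ) * bispectrum f ((1 - τ j s) • u)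
            * (testKernel L ζ u : ℂ)
          + ∑ k, signalTerm k (signalFourier f (t j s, τ j s)) u
            * wickTerm σ k (fun a => E j a s) u * (testKernel L ζ u : ℂ)) := by
        refine integral_congr_ae (.of_forall fun u => ?_)
        simp only [e, mul_assoc, Finset.sum_mul, add_mul]
    _ = _ := by
        rw [integral_const_mul, integral_finsetSum _ fun j _ => i4 j]
        refine congrArg _ (Finset.sum_congr rfl fun j _ => ?_)
        rw [integral_add (i1 j) (i3 j), integral_finsetSum _ fun k _ => i2 j k]
        refine congrArg _ (Finset.sum_congr rfl fun k _ => ?_)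
        rw [testedNoise]
        refine integral_congr_ae (.of_forall fun u => ?_)
        ring

end Model

/-! ### The mean squared error of the estimator -/

section Error

open scoped ENNReal

/-- A Cauchy-Schwarz inequality, up to a factor `2`. -/
lemma tsum_mul_sq_le (w x : ℕ → ℝ≥0∞) :
    (∑' k, w k * x k) ^ 2 ≤ 2 * ((∑' k, w k) * ∑' k, w k * x k ^ 2) := by
  have h : ∀ k l, w k * x k * (w l * x l) ≤ w k * x k ^ 2 * w l + w k * (w l * x l ^ 2) :=
    fun k l => by
      calc w k * x k * (w l * x l) = w k * w l * (x k * x l) := by ring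
        _ ≤ w k * w l * (x k ^ 2 + x l ^ 2) := by gcongr; exact mul_le_sq_add_sq _ _
        _ = _ := by ring
  calc (∑' k, w k * x k) ^ 2 = ∑' k, ∑' l, w k * x k * (w l * x l) := by
        simp_rw [ENNReal.tsum_mul_left, ENNReal.tsum_mul_right, sq]
    _ ≤ ∑' k, ∑' l, (w k * x k ^ 2 * w l + w k * (w l * x l ^ 2)) :=
        ENNReal.tsum_le_tsum fun k => ENNReal.tsum_le_tsum fun l => h k l
    _ = 2 * ((∑' k, w k) * ∑' k, w k * x k ^ 2) := by
        simp_rw [ENNReal.tsum_add, ENNReal.tsum_mul_left, ENNReal.tsum_mul_right]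
        ring

lemma enorm_add_sub_sq_le (a b c : ℂ) :
    ‖a + b - c‖ₑ ^ 2 ≤ 3 * ‖a‖ₑ ^ 2 + (3 * ‖b‖ₑ ^ 2 + 3 * ‖c‖ₑ ^ 2) := by
  simp_rw [enorm_sq_eq_ofReal]
  rw [show (3 : ℝ≥0∞) = ENNReal.ofReal 3 by simp, ← ENNReal.ofReal_mul (by norm_num),
    ← ENNReal.ofReal_mul (by norm_num), ← ENNReal.ofReal_mul (by norm_num),
    ← ENNReal.ofReal_add (by positivity) (by positivity),
    ← ENNReal.ofReal_add (by positivity) (by positivity)]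
  refine ENNReal.ofReal_le_ofReal ?_
  have h : ‖a + b - c‖ ≤ ‖a‖ + ‖b‖ + ‖c‖ := (norm_sub_le _ _).trans (by
    gcongr; exact norm_add_le _ _)
  have h2 : ‖a + b - c‖ ^ 2 ≤ (‖a‖ + ‖b‖ + ‖c‖) ^ 2 := by gcongr
  nlinarith [sq_nonneg (‖a‖ - ‖b‖), sq_nonneg (‖b‖ - ‖c‖), sq_nonneg (‖a‖ - ‖c‖)]

variable {S : Type*} [MeasurableSpace S] {P : Measure S} [IsProbabilityMeasure P]
  {f : ℝ → ℝ} {η σ L : ℝ} {M : ℕ} {t τ : Fin M → S → ℝ} {W : Fin M → L2Window → S → ℝ}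
  {E : Fin M → ℝ → S → ℂ}
  (hf : Continuous (fourierHat f)) (hB : BoundedC3 (bispectrum f))
  (hη : 0 < η) (hη2 : η ^ 2 ≤ 1 / 12) (hL : 0 < L) (hM : 1 ≤ M)
  (hmodel : NoisyDilationModel P f η σ M t τ W E)

include hf hL hmodel hB in
omit [IsProbabilityMeasure P] in
/-- A jointly measurable version of the smoothed centred bispectrum. -/
lemma exists_measurable_smoothDeriv : ∃ Φ : S × Plane → ℂ, Measurable Φ ∧
    ∀ s, IsRegularSample f σ L t τ E s → ∀ ζ,
      smoothDeriv L (sampleBispectrum f σ t τ E s) ζ = Φ (s, ζ) := by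
  let G : S → Plane → ℂ := fun s u =>
    (M : ℂ)⁻¹ * ∑ j, ((((1 - τ j s) ^ 3 : ℝ) : ℂ) * bispectrum f ((1 - τ j s) • u)
          + ∑ k, signalTerm k (signalFourier f (t j s, τ j s)) u
            * wickTerm σ k (fun a => E j a s) u)
  have hBc := hB.1.continuous.measurable
  have hτ := hmodel.measurable_τ
  have hN := fun j k => (measurable_noise_terms hf hmodel j k).comp
    (f := fun z : (S × Plane) × Plane => (z.2, z.1.1)) (by fun_prop)
  have hG : Measurable fun z : (S × Plane) × Plane => G z.1.1 z.2 := by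
    refine measurable_const.mul (Finset.measurable_fun_sum _ fun j _ => Measurable.add ?_
      (Finset.measurable_fun_sum _ fun k _ => hN j k))
    have h1 : Measurable fun z : (S × Plane) × Plane => 1 - τ j z.1.1 := by fun_prop
    exact (Complex.measurable_ofReal.comp (h1.pow_const 3)).mul
      (hBc.comp (h1.smul measurable_snd))
  have hT : Measurable fun z : (S × Plane) × Plane => (testKernel L z.1.2 z.2 : ℂ) :=
    Complex.measurable_ofReal.comp ((continuous_testKernel (L := L)).measurable.comp
      (f := fun z : (S × Plane) × Plane => (z.1.2, z.2)) (by fun_prop))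
  refine ⟨fun z => ∫ u, G z.1 u * (testKernel L z.2 u : ℂ),
    ((hG.mul hT).stronglyMeasurable.integral_prod_right').measurable, fun s hs ζ => ?_⟩
  obtain ⟨hm, hi, -⟩ := smoothDeriv_sampleBispectrum hf hL hB hmodel hs
  rw [smoothDeriv_eq hL hm hi]
  refine integral_congr_ae (.of_forall fun u => ?_)
  beta_reduce
  rw [sampleBispectrum_eq hs.abs_dilation_le]

include hf hB hη hη2 hL hM hmodel

/-- Before unbiasing, the error consists of the fluctuation of the dilations, the smoothing bias
and the noise. -/
lemma lintegral_profileError_le {K : ℝ} (hK1 : 1 ≤ K) (hK : ∀ p a, ‖signalFourier f p a‖ ≤ K)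
    {ζ : Plane} {Cd Cs Cn : ℝ} (hCd0 : 0 ≤ Cd) (hCn0 : 0 ≤ Cn)
    (hCd : ∀ s ∈ Set.Icc (1 / 2 : ℝ) (3 / 2), ∀ s' ∈ Set.Icc (1 / 2 : ℝ) (3 / 2),
        ‖dilationProfile (bispectrum f) ζ s - dilationProfile (bispectrum f) ζ s'‖ ≤ Cd * |s - s'|)
    (hCs : ∀ s ∈ Set.Icc (1 / 2 : ℝ) (3 / 2),
      ‖smoothDeriv L (fun ω => ((s ^ 3 : ℝ) : ℂ) * bispectrum f (s • ω)) ζ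
        - dilationProfile (bispectrum f) ζ s‖ ≤ Cs * L ^ 2)
    (hCn : ∀ k p, ∫⁻ ω, ∫⁻ ξ, ‖testKernel L ζ ω‖ₑ * ‖testKernel L ζ ξ‖ₑ
          * ENNReal.ofReal (covWeight σ k (signalFourier f p) ω ξ)
          ≤ ENNReal.ofReal (Cn * (max (σ ^ 2) (σ ^ 6) / L ^ 2))) :
    ∫⁻ s, ‖meanProfile η (bispectrum f) ζ
        - smoothDeriv L (sampleBispectrum f σ t τ E s) ζ‖ₑ ^ 2 ∂P
      ≤ ENNReal.ofReal (3 * (12 * Cd ^ 2 + Cs ^ 2 + 49 * Cn)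
          * (η ^ 2 / M + L ^ 4 + max (σ ^ 2) (σ ^ 6) / (L ^ 2 * M))) := by
  set B := bispectrum f with hBdef
  set m := max (σ ^ 2) (σ ^ 6) with hm
  have hm0 : 0 ≤ m := le_max_of_le_left (sq_nonneg σ)
  have hMr : (0 : ℝ) < M := by exact_mod_cast hM
  have hMc : (M : ℂ) ≠ 0 := by exact_mod_cast hMr.ne'
  have hpc : Continuous (dilationProfile B ζ) :=
    (continuous_dilationProfile hB).comp (g := fun p : Plane × ℝ => dilationProfile B p.1 p.2)
      (f := fun x => (ζ, x)) (by fun_prop)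
  have hτ := hmodel.measurable_τ
  let a : S → ℂ := fun s => meanProfile η B ζ - (M : ℂ)⁻¹ * ∑ j, dilationProfile B ζ (1 - τ j s)
  let n : S → ℂ := fun s => (M : ℂ)⁻¹ * ∑ j, ∑ k, testedNoise f σ t τ E (testKernel L ζ) k j s
  have ha : Measurable a := by
    refine measurable_const.sub (measurable_const.mul (Finset.measurable_fun_sum _ fun j _ => ?_))
    exact hpc.measurable.comp (measurable_const.sub (hτ j))
  have hae := ae_isRegularSample hf hK1 hK hη hη2 hL hmodel
  calc _ ≤ ∫⁻ s, (3 * ‖a s‖ₑ ^ 2 + (ENNReal.ofReal (3 * (Cs ^ 2 * L ^ 4)) + 3 * ‖n s‖ₑ ^ 2)) ∂P := by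
        refine lintegral_mono_ae ?_
        filter_upwards [hae] with s hs
        obtain ⟨-, -, h⟩ := smoothDeriv_sampleBispectrum hf hL hB hmodel hs
        let b : ℂ := (M : ℂ)⁻¹ * ∑ j, (dilationProfile B ζ (1 - τ j s)
          - smoothDeriv L (fun ω => (((1 - τ j s) ^ 3 : ℝ) : ℂ) * B ((1 - τ j s) • ω)) ζ)
        have e : meanProfile η B ζ - smoothDeriv L (sampleBispectrum f σ t τ E s) ζ
            = a s + b - n s := by
          rw [h ζ]
          simp only [a, b, n, Finset.sum_sub_distrib, mul_sub]
          ring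
        have hb : ‖b‖ ≤ Cs * L ^ 2 := by
          simp only [b]
          rw [norm_mul, norm_inv, Complex.norm_natCast, inv_mul_le_iff₀ hMr]
          refine (norm_sum_le _ _).trans ((Finset.sum_le_card_nsmul _ _ (Cs * L ^ 2)
            fun j _ => ?_).trans (by simp))
          obtain ⟨h1, h2⟩ := abs_le.1 (hs.abs_dilation_le j)
          rw [norm_sub_rev]
          exact hCs _ ⟨by linarith, by linarith⟩
        have hb2 : 3 * ‖b‖ₑ ^ 2 ≤ ENNReal.ofReal (3 * (Cs ^ 2 * L ^ 4)) := by
          rw [enorm_sq_eq_ofReal, ENNReal.ofReal_mul (by norm_num), ENNReal.ofReal_ofNat]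
          gcongr
          calc ‖b‖ ^ 2 ≤ (Cs * L ^ 2) ^ 2 := by gcongr
            _ = _ := by ring
        rw [e]
        refine (enorm_add_sub_sq_le _ _ _).trans ?_
        gcongr
    _ = 3 * ∫⁻ s, ‖a s‖ₑ ^ 2 ∂P
          + (ENNReal.ofReal (3 * (Cs ^ 2 * L ^ 4)) + 3 * ∫⁻ s, ‖n s‖ₑ ^ 2 ∂P) := by
        rw [lintegral_add_left (by fun_prop), lintegral_add_left measurable_const,
          lintegral_const_mul' _ _ (by finiteness), lintegral_const_mul' _ _ (by finiteness)]
        simp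
    _ ≤ 3 * ENNReal.ofReal (12 * Cd ^ 2 * (η ^ 2 / M))
          + (ENNReal.ofReal (3 * (Cs ^ 2 * L ^ 4))
            + 3 * (49 * ENNReal.ofReal (Cn * (m / L ^ 2)) / M)) := by
        gcongr
        · exact lintegral_mean_dilationProfile_le hmodel hη hB hη2 hCd0 hCd hM
        · exact lintegral_mean_testedNoise_le hf hK1 hK hmodel
            (continuous_testKernel_right L ζ).measurable (integrable_testKernel hL ζ) hCn
    _ = ENNReal.ofReal (3 * (12 * Cd ^ 2 * (η ^ 2 / M)) + (3 * (Cs ^ 2 * L ^ 4)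
          + 3 * (49 * (Cn * (m / L ^ 2)) / M))) := by
        rw [ENNReal.ofReal_add (by positivity) (by positivity),
          ENNReal.ofReal_add (by positivity) (by positivity),
          ENNReal.ofReal_mul (p := 3) (q := 12 * Cd ^ 2 * (η ^ 2 / M)) (by norm_num),
          ENNReal.ofReal_mul (p := 3) (q := 49 * (Cn * (m / L ^ 2)) / M) (by norm_num),
          ENNReal.ofReal_div_of_pos hMr, ENNReal.ofReal_mul (p := 49) (by norm_num),
          ENNReal.ofReal_natCast, ENNReal.ofReal_ofNat, ENNReal.ofReal_ofNat]
    _ ≤ _ := by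
        refine ENNReal.ofReal_le_ofReal ?_
        have e : 49 * (Cn * (m / L ^ 2)) / M = 49 * Cn * (m / (L ^ 2 * M)) := by field_simp
        have p1 : 0 ≤ η ^ 2 / M := by positivity
        have p2 : 0 ≤ L ^ 4 := by positivity
        have p3 : 0 ≤ m / (L ^ 2 * M) := by positivity
        have q1 : 0 ≤ Cd ^ 2 := by positivity
        have q2 : 0 ≤ Cs ^ 2 := by positivity
        rw [e]
        nlinarith [mul_nonneg q1 p2, mul_nonneg q1 p3, mul_nonneg q2 p1, mul_nonneg q2 p3,
          mul_nonneg hCn0 p1, mul_nonneg hCn0 p2]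

omit [IsProbabilityMeasure P] hM in
/-- The error of the estimator is the weighted sum of the errors before unbiasing. -/
lemma error_eq_tsum {s : S} (hs : IsRegularSample f σ L t τ E s) (ω : Plane) :
    (Summable fun k : ℕ => (((constC0 η ^ 4) ^ k * (constC1 η * constC2 η ^ 4) : ℝ) : ℂ)
      * (meanProfile η (bispectrum f) ((constC2 η * constC0 η ^ k) • ω)
        - smoothDeriv L (sampleBispectrum f σ t τ E s) ((constC2 η * constC0 η ^ k) • ω))) ∧
    bispectrum f ω - dilationUnbias η (smoothing L (sampleBispectrum f σ t τ E s)) ω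
      = ∑' k : ℕ, (((constC0 η ^ 4) ^ k * (constC1 η * constC2 η ^ 4) : ℝ) : ℂ)
        * (meanProfile η (bispectrum f) ((constC2 η * constC0 η ^ k) • ω)
          - smoothDeriv L (sampleBispectrum f σ t τ E s) ((constC2 η * constC0 η ^ k) • ω)) := by
  obtain ⟨C, hC0, hC, -⟩ := hB.norm_le
  obtain ⟨hm, hi, -⟩ := smoothDeriv_sampleBispectrum hf hL hB hmodel hs
  obtain ⟨K, hK⟩ := exists_smoothDeriv_bound hL hm hi ‖ω‖
  obtain ⟨a0, a1⟩ := constC0_bounds hη hη2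
  obtain ⟨b0, b1⟩ := constC2_bounds hη hη2
  have c1 := constC1_pos hη hη2
  obtain ⟨e1, e2⟩ := eta_bounds hη hη2
  have hball : ∀ k : ℕ, ‖(constC2 η * constC0 η ^ k) • ω‖ ≤ ‖ω‖ := fun k => by
    rw [norm_smul, Real.norm_of_nonneg (by positivity)]
    exact mul_le_of_le_one_left (norm_nonneg _)
      (mul_le_one₀ b1 (by positivity) (pow_le_one₀ a0 a1.le))
  have hsum : ∀ {g : Plane → ℂ} {c : ℝ}, (∀ ζ : Plane, ‖ζ‖ ≤ ‖ω‖ → ‖g ζ‖ ≤ c) →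
      Summable fun k : ℕ => (((constC0 η ^ 4) ^ k * (constC1 η * constC2 η ^ 4) : ℝ) : ℂ)
        * g ((constC2 η * constC0 η ^ k) • ω) := fun {g c} hg => by
    refine Summable.of_norm_bounded ((summable_weights hη hη2).mul_right c) fun k => ?_
    rw [norm_mul, Complex.norm_real, Real.norm_of_nonneg (by positivity)]
    exact mul_le_mul_of_nonneg_left (hg _ (hball k)) (by positivity)
  have hmb : ∀ ζ : Plane, ‖ζ‖ ≤ ‖ω‖ → ‖meanProfile η (bispectrum f) ζ‖
      ≤ (constC1 η)⁻¹ * ((1 + √3 * η) ^ 4 * C + (1 - √3 * η) ^ 4 * C) := fun ζ _ => by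
    have p1 : (0 : ℝ) ≤ (1 + √3 * η) ^ 4 := by positivity
    have p2 : (0 : ℝ) ≤ (1 - √3 * η) ^ 4 := pow_nonneg (by linarith) 4
    rw [meanProfile, norm_mul, norm_inv, Complex.norm_real, Real.norm_of_nonneg c1.le]
    refine mul_le_mul_of_nonneg_left ((norm_sub_le _ _).trans (add_le_add ?_ ?_)) (by positivity)
    · rw [norm_mul, Complex.norm_real, Real.norm_of_nonneg p1]
      exact mul_le_mul_of_nonneg_left (hC _) p1
    · rw [norm_mul, Complex.norm_real, Real.norm_of_nonneg p2]
      exact mul_le_mul_of_nonneg_left (hC _) p2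
  have s1 := hsum hmb
  have s2 := hsum hK
  simp_rw [mul_sub]
  refine ⟨s1.sub s2, ?_⟩
  rw [s1.tsum_sub s2, ← tsum_meanProfile hη hη2 hC, ← dilationUnbias_smoothing]

omit hM in
/-- The error is measurable jointly in the sample and the frequency, as an almost sure limit of the
partial sums of the Neumann series. -/
lemma aemeasurable_error {K : ℝ} (hK1 : 1 ≤ K) (hK : ∀ p a, ‖signalFourier f p a‖ ≤ K)
    (ν : Measure Plane) [SFinite ν] :
    AEMeasurable (fun z : S × Plane => bispectrum f z.2
      - dilationUnbias η (smoothing L (sampleBispectrum f σ t τ E z.1)) z.2) (P.prod ν) := by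
  obtain ⟨Φ, hΦ, hΦ'⟩ := exists_measurable_smoothDeriv (σ := σ) hf hB hL hmodel
  have hBc := hB.1.continuous
  have hae : ∀ᵐ z ∂(P.prod ν), IsRegularSample f σ L t τ E z.1 :=
    Measure.quasiMeasurePreserving_fst.ae (ae_isRegularSample hf hK1 hK hη hη2 hL hmodel)
  have hmc : Continuous (meanProfile η (bispectrum f)) := by unfold meanProfile; fun_prop
  refine aemeasurable_of_tendsto_metrizable_ae Filter.atTop (f := fun (N : ℕ) z =>
    ∑ k ∈ Finset.range N, (((constC0 η ^ 4) ^ k * (constC1 η * constC2 η ^ 4) : ℝ) : ℂ)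
        * (meanProfile η (bispectrum f) ((constC2 η * constC0 η ^ k) • z.2)
          - Φ (z.1, (constC2 η * constC0 η ^ k) • z.2))) (fun N => ?_) ?_
  · refine Measurable.aemeasurable (Finset.measurable_fun_sum _ fun k _ => ?_)
    refine measurable_const.mul (Measurable.sub ?_ ?_)
    · exact hmc.measurable.comp (f := fun z : S × Plane => (constC2 η * constC0 η ^ k) • z.2) (by fun_prop)
    · exact hΦ.comp (f := fun z : S × Plane => (z.1, (constC2 η * constC0 η ^ k) • z.2))
        (by fun_prop)
  · filter_upwards [hae] with z hz
    obtain ⟨h1, h2⟩ := error_eq_tsum hf hB hη hη2 hL hmodel hz z.2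
    simp_rw [hΦ' z.1 hz] at h1 h2
    rw [h2]
    exact h1.hasSum.tendsto_sum_nat

omit hM in
/-- The mean squared error on a bounded set, in terms of the error before unbiasing. -/
lemma lintegral_sqErrorOn_le {K : ℝ} (hK1 : 1 ≤ K) (hK : ∀ p a, ‖signalFourier f p a‖ ≤ K)
    {R : ℝ} {b : ℝ≥0∞} (hb : ∀ ζ : Plane, ‖ζ‖ ≤ R → ∫⁻ s, ‖meanProfile η (bispectrum f) ζ
        - smoothDeriv L (sampleBispectrum f σ t τ E s) ζ‖ₑ ^ 2 ∂P ≤ b)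
    {D : Set Plane} (hD : MeasurableSet D) (hDR : ∀ ω ∈ D, ‖ω‖ ≤ R) :
    ∫⁻ s, sqErrorOn D (bispectrum f)
      (dilationUnbias η (smoothing L (sampleBispectrum f σ t τ E s))) ∂P ≤ 8 * b * volume D := by
  obtain ⟨Φ, hΦ, hΦ'⟩ := exists_measurable_smoothDeriv (σ := σ) hf hB hL hmodel
  have hae := ae_isRegularSample hf hK1 hK hη hη2 hL hmodel
  obtain ⟨a0, a1⟩ := constC0_bounds hη hη2
  obtain ⟨b0, b1⟩ := constC2_bounds hη hη2
  have c1 := constC1_pos hη hη2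
  let w : ℕ → ℝ := fun k => (constC0 η ^ 4) ^ k * (constC1 η * constC2 η ^ 4)
  have hw0 : ∀ k, 0 ≤ w k := fun k => by positivity
  have hw : ∑' k, ENNReal.ofReal (w k) ≤ 2 := by
    rw [← ENNReal.ofReal_tsum_of_nonneg hw0 (summable_weights hη hη2)]
    exact (ENNReal.ofReal_le_ofReal (tsum_weights_le hη hη2)).trans_eq (by simp)
  let X : ℕ → Plane → S → ℂ := fun k ω s =>
    meanProfile η (bispectrum f) ((constC2 η * constC0 η ^ k) • ω)
      - smoothDeriv L (sampleBispectrum f σ t τ E s) ((constC2 η * constC0 η ^ k) • ω)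
  have hX : ∀ k ω, AEMeasurable (X k ω) P := fun k ω => by
    refine AEMeasurable.congr (f := fun s => meanProfile η (bispectrum f)
      ((constC2 η * constC0 η ^ k) • ω) - Φ (s, (constC2 η * constC0 η ^ k) • ω)) ?_ ?_
    · exact (measurable_const.sub (hΦ.comp (measurable_id.prodMk measurable_const))).aemeasurable
    · filter_upwards [hae] with s hs
      simp only [X, hΦ' s hs]
  have hpt : ∀ ω ∈ D, ∫⁻ s, ‖bispectrum f ω
      - dilationUnbias η (smoothing L (sampleBispectrum f σ t τ E s)) ω‖ₑ ^ 2 ∂P ≤ 8 * b := by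
    intro ω hω
    calc _ ≤ ∫⁻ s, 4 * ∑' k, ENNReal.ofReal (w k) * ‖X k ω s‖ₑ ^ 2 ∂P := by
          refine lintegral_mono_ae ?_
          filter_upwards [hae] with s hs
          rw [(error_eq_tsum hf hB hη hη2 hL hmodel hs ω).2]
          calc _ ≤ (∑' k, ENNReal.ofReal (w k) * ‖X k ω s‖ₑ) ^ 2 := by
                gcongr
                refine enorm_tsum_le_tsum_enorm.trans (ENNReal.tsum_le_tsum fun k => le_of_eq ?_)
                rw [enorm_mul, ← ofReal_norm (((w k : ℝ) : ℂ)), Complex.norm_real,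
                  Real.norm_of_nonneg (hw0 k)]
            _ ≤ 2 * ((∑' k, ENNReal.ofReal (w k)) * ∑' k, ENNReal.ofReal (w k) * ‖X k ω s‖ₑ ^ 2) :=
                tsum_mul_sq_le _ _
            _ ≤ 2 * (2 * ∑' k, ENNReal.ofReal (w k) * ‖X k ω s‖ₑ ^ 2) := by gcongr
            _ = _ := by rw [← mul_assoc]; norm_num
      _ = 4 * ∑' k, ENNReal.ofReal (w k) * ∫⁻ s, ‖X k ω s‖ₑ ^ 2 ∂P := by
          rw [lintegral_const_mul' _ _ (by finiteness),
            lintegral_tsum fun k => ((hX k ω).enorm.pow_const 2).const_mul _]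
          simp_rw [lintegral_const_mul' _ _ ENNReal.ofReal_ne_top]
      _ ≤ 4 * ∑' k, ENNReal.ofReal (w k) * b := by
          gcongr with k
          refine hb _ ?_
          rw [norm_smul, Real.norm_of_nonneg (by positivity)]
          exact (mul_le_of_le_one_left (norm_nonneg _)
            (mul_le_one₀ b1 (by positivity) (pow_le_one₀ a0 a1.le))).trans (hDR ω hω)
      _ ≤ 4 * (2 * b) := by
          rw [ENNReal.tsum_mul_right]
          gcongr
      _ = 8 * b := by rw [← mul_assoc]; norm_num
  unfold sqErrorOn
  rw [lintegral_lintegral_swap ((aemeasurable_error hf hB hη hη2 hL hmodel hK1 hK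
    (volume.restrict D)).enorm.pow_const 2)]
  calc _ ≤ ∫⁻ _ in D, 8 * b := setLIntegral_mono' hD hpt
    _ = 8 * b * volume D := by simp

end Error

/-! ### The risk bound -/

section Risk

open scoped ENNReal

variable {f : ℝ → ℝ}

/-- If the model is satisfied by at least one observation, then the signal has bounded support:
the observations are supported in the window, and the dilations are bounded away from `0`. -/
lemma exists_support_bound {S : Type*} [MeasurableSpace S] {P : Measure S} [IsProbabilityMeasure P]
    {η σ : ℝ} {M : ℕ} {t τ : Fin M → S → ℝ} {W : Fin M → L2Window → S → ℝ} {E : Fin M → ℝ → S → ℂ}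
    (hM : 1 ≤ M) (hη : 0 < η) (hη2 : η ^ 2 ≤ 1 / 12)
    (hmodel : NoisyDilationModel P f η σ M t τ W E) :
    ∃ ρ : ℝ, ∀ᵐ x, ρ < |x| → f x = 0 := by
  obtain ⟨s, h1, h2⟩ := (hmodel.support.and (abs_dilation_le hmodel hη)).exists
  have j : Fin M := ⟨0, hM⟩
  obtain ⟨b1, b2⟩ := abs_le.1 ((h2 j).trans (eta_bounds hη hη2).2)
  set c := 1 - τ j s with hc
  have hc0 : 0 < c := by linarith
  have hq : Measure.QuasiMeasurePreserving (fun y : ℝ => c * y + t j s) volume volume := by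
    refine (measurePreserving_add_right volume (t j s)).quasiMeasurePreserving.comp
      ⟨measurable_const_mul c, ?_⟩
    rw [Real.map_volume_mul_left hc0.ne']
    exact Measure.smul_absolutelyContinuous
  refine ⟨1 + 2 * |t j s|, ?_⟩
  filter_upwards [hq.ae (h1 j)] with y hy hlt
  have hy' := hy fun hmem => by
    have hmem := abs_le.2 ⟨hmem.1, hmem.2⟩
    have h3 : |c * y| ≤ |c * y + t j s| + |t j s| := by
      have := abs_sub (c * y + t j s) (t j s)
      simpa using this
    rw [abs_mul, abs_of_pos hc0] at h3
    nlinarith [abs_nonneg y, abs_nonneg (t j s)]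
  rw [dilatedSignal, add_sub_cancel_right, ← hc, inv_mul_cancel_left₀ hc0.ne'] at hy'
  exact hy'

/-- The risk bound for a signal of bounded support. -/
lemma exists_risk_bound (hf : MemLp f 2 volume) {ρ : ℝ} (hρ : ∀ᵐ x, ρ < |x| → f x = 0)
    {D : Set Plane} (hD : MeasurableSet D) (hDb : Bornology.IsBounded D) :
    ∃ C : ℝ, 0 < C ∧
      ∀ (S : Type*) [MeasurableSpace S] (P : Measure S) [IsProbabilityMeasure P]
        (M : ℕ) (_ : 1 ≤ M) (η σ L : ℝ) (_ : 0 < η) (_ : η ^ 2 ≤ 1 / 12) (_ : 0 < L)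
        (t τ : Fin M → S → ℝ) (W : Fin M → L2Window → S → ℝ) (E : Fin M → ℝ → S → ℂ)
        (_ : NoisyDilationModel P f η σ M t τ W E),
        AEMeasurable (fun s => sqErrorOn D (bispectrum f)
            (bispectrumEstimator η σ L
              (fun j => obsFourier f (t j s) (τ j s) (fun ω => E j ω s)))) P ∧
        ∫⁻ s, sqErrorOn D (bispectrum f)
            (bispectrumEstimator η σ L
              (fun j => obsFourier f (t j s) (τ j s) (fun ω => E j ω s))) ∂P
          ≤ ENNReal.ofReal
              (C * (η ^ 2 / M + L ^ 4 + max (σ ^ 2) (σ ^ 6) / (L ^ 2 * M))) := by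
  have hf3 := boundedC3_fourierHat hf hρ
  have hB := boundedC3_bispectrum hf hρ
  have hfc : Continuous (fourierHat f) := hf3.1.continuous
  obtain ⟨A, hA⟩ : ∃ A : ℝ, ∀ a, ‖fourierHat f a‖ ≤ A := by
    obtain ⟨-, A, hA⟩ := hf3
    refine ⟨A, fun a => ?_⟩
    rw [← norm_iteratedFDeriv_zero (𝕜 := ℝ) (f := fourierHat f)]
    exact hA 0 (by norm_num) a
  have hA0 : 0 ≤ A := (norm_nonneg _).trans (hA 0)
  have hK := norm_signalFourier_le hA
  have hK1 : 1 ≤ 2 * A + 1 := by linarith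
  set Φ : ℝ≥0∞ := 2 * ∫⁻ a, ENNReal.ofReal (‖fourierHat f a‖ ^ 2) with hΦdef
  have hΦ : Φ < ∞ := by
    have h := ((memLp_two_iff_integrable_sq_norm hfc.aestronglyMeasurable).1
      (memLp_fourierHat hf hρ)).lintegral_lt_top
    finiteness
  obtain ⟨R, hR⟩ := hDb.exists_norm_le
  obtain ⟨Cd, hCd0, hCd⟩ := exists_lipschitz_dilationProfile hB R
  obtain ⟨Cs, -, hCs⟩ := exists_smoothing_bias hB R
  obtain ⟨Cn, hCn0, hCn⟩ := exists_testKernel_covWeight_bound hK1 hΦ R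
  set C := 3 * (12 * Cd ^ 2 + Cs ^ 2 + 49 * Cn) with hC
  have hvol : volume D ≠ ∞ := hDb.measure_lt_top.ne
  refine ⟨8 * C * (volume D).toReal + 1, by positivity,
    fun S _ P _ M hM η σ L hη hη2 hL t τ W E hmodel => ⟨?_, ?_⟩⟩
  · exact ((aemeasurable_error hfc hB hη hη2 hL hmodel hK1 hK
      (volume.restrict D)).enorm.pow_const 2).lintegral_prod_right'
  · set r := η ^ 2 / M + L ^ 4 + max (σ ^ 2) (σ ^ 6) / (L ^ 2 * M) with hr
    have hm0 : 0 ≤ max (σ ^ 2) (σ ^ 6) := le_max_of_le_left (sq_nonneg σ)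
    have hr0 : 0 ≤ r := by positivity
    have h := lintegral_sqErrorOn_le (σ := σ) hfc hB hη hη2 hL hmodel hK1 hK (R := R)
      (fun ζ hζ => lintegral_profileError_le hfc hB hη hη2 hL hM hmodel hK1 hK hCd0 hCn0
        (hCd ζ hζ) (fun s hs => hCs ζ hζ s hs L hL) fun k p =>
        hCn (signalFourier f p) ((continuous_signalFourier hfc).comp (f := fun a => (p, a))
          (by fun_prop)).measurable (signalFourier_neg f p) (hK p)
          (lintegral_signalFourier_le hfc p) σ L hL ζ hζ k) hD hR
    refine h.trans ?_
    rw [← ENNReal.ofReal_toReal hvol, show (8 : ℝ≥0∞) = ENNReal.ofReal 8 by simp,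
      ← ENNReal.ofReal_mul (by norm_num), ← ENNReal.ofReal_mul (by positivity)]
    refine ENNReal.ofReal_le_ofReal ?_
    rw [← hr, ← hC, ENNReal.toReal_ofReal ENNReal.toReal_nonneg]
    nlinarith

end Risk

end DilationMRA

open DilationMRA in
theorem theorem3 (f : ℝ → ℝ) (hf : MeasureTheory.MemLp f 2 MeasureTheory.volume)
    (hC3 : ContDiff ℝ 3 (bispectrum f))
    (hdecay : ∃ κ : ℝ, 3 ≤ κ ∧ FourierDecay (fun ω => (‖ω‖ : ℂ) * bispectrum f ω) κ)
    (hmax2 : MeasureTheory.MemLp (radialMaximal 2 (bispectrum f)) 2 MeasureTheory.volume)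
    (hmax3 : MeasureTheory.MemLp (radialMaximal 3 (bispectrum f)) 2 MeasureTheory.volume)
    (D : Set Plane) (hD : MeasurableSet D) (hDb : Bornology.IsBounded D) :
    ∃ C : ℝ, 0 < C ∧
      ∀ (S : Type*) [MeasurableSpace S] (P : MeasureTheory.Measure S)
        [MeasureTheory.IsProbabilityMeasure P]
        (M : ℕ) (_ : 1 ≤ M) (η σ L : ℝ) (_ : 0 < η) (_ : η ^ 2 ≤ 1 / 12) (_ : 0 ≤ σ) (_ : 0 < L)
        (t τ : Fin M → S → ℝ) (W : Fin M → L2Window → S → ℝ) (E : Fin M → ℝ → S → ℂ)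
        (_ : NoisyDilationModel P f η σ M t τ W E),
        AEMeasurable (fun s => sqErrorOn D (bispectrum f)
            (bispectrumEstimator η σ L
              (fun j => obsFourier f (t j s) (τ j s) (fun ω => E j ω s)))) P ∧
        ∫⁻ s, sqErrorOn D (bispectrum f)
            (bispectrumEstimator η σ L
              (fun j => obsFourier f (t j s) (τ j s) (fun ω => E j ω s))) ∂P
          ≤ ENNReal.ofReal
              (C * (η ^ 2 / M + L ^ 4 + max (σ ^ 2) (σ ^ 6) / (L ^ 2 * M))) := by
  by_cases hsupp : ∃ ρ : ℝ, ∀ᵐ x, ρ < |x| → f x = 0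
  · obtain ⟨ρ, hρ⟩ := hsupp
    obtain ⟨C, hC0, hC⟩ := exists_risk_bound hf hρ hD hDb
    exact ⟨C, hC0, fun S _ P _ M hM η σ L hη hη2 _ hL t τ W E hmodel =>
      hC S P M hM η σ L hη hη2 hL t τ W E hmodel⟩
  · -- no observation of such a signal is supported in the window
    exact ⟨1, one_pos, fun S _ P _ M hM η σ L hη hη2 _ hL t τ W E hmodel =>
      absurd (exists_support_bound hM hη hη2 hmodel) hsupp⟩
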